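/- **Setting.** Let $c\ge 0$ be real. Let $W$ be a unitary positive energy representation of the Virasoro algebra with central charge $c$, not necessarily irreducible: a complex inner product space with linear operators $L_n$ ($n\in\mathbb Z$) satisfying $[L_m,L_n]=(m-n)L_{m+n}+\frac{c}{12}(m^3-m)\delta_{m+n,0}$ and $\langle L_nv,w\rangle=\langle v,L_{-n}w\rangle$, such that $W$ is spanned by eigenvectors of $L_0$, the eigenspaces of $L_0$ are finite dimensional, and its set of eigenvalues is discrete and bounded below. Let $\mathcal H$ be the Hilbert space completion of $W$, and write $L_0$ also for the closure of $L_0$ as an operator on $\mathcal H$. For a smooth complex vector field $X=f(\theta)\partial_\theta$ on $S^1$, let $\pi(X)$ be the closure of the operator $w\mapsto\sum_{n\in\mathbb Z} i\hat f(n)L_nw$ on $W$, where $\hat f(n)=\frac1{2\pi}\int_0^{2\pi}f(\theta)e^{-in\theta}d\theta$. Let $\mathcal X^{in}$ be the cone of smooth vector fields $f\partial_\theta$ with $\operatorname{Im}f\ge 0$. For $n\ge 0$ let $\mathcal H_n=D((1+L_0)^n)$ with norm $\|v\|_{\mathcal H_n}=\|(1+L_0)^nv\|$, and let $\pi(X)|_{\mathcal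 H_n}$ be the part of $\pi(X)$ in $\mathcal H_n$, with domain $\{v\in D(\pi(X))\cap\mathcal H_n : \pi(X)v\in\mathcal H_n\}$. An *evolution system* on a Banach space $E$ is a family of bounded operators $U(t,s)$, $0\le s\le t\le 1$, with $U(s,s)=1$, $U(t,r)U(r,s)=U(t,s)$ for $s\le r\le t$, and $(t,s)\mapsto U(t,s)x$ continuous for every $x\in E$. Let $Y\subset E$ be a continuously and densely embedded Banach space and $A(t)$, $t\in[0,1]$, unbounded operators on $E$. We say that the *time-ordered exponential* $\prod\operatorname{Exp}(A(t))\,dt$ *exists* on $E$ (with respect to $Y$) if there is $\omega\ge 0$ such that every $A(t)$ generates a $C_0$-semigroup $T_t$ with $\|T_t(s)\|\le e^{\omega s}$ for $s\ge 0$, and there is an evolution system $U$ on $E$ such that, for all $0\le s\le t\le 1$ and $v\in Y$, 1. $\|U(t,s)\|\le e^{\omega(t-s)}$; 2. $U(t,s)v\in D(A(t))$ and $\frac{\partial}{\partial t}U(t,s)v=A(t)U(t,s)v$; 3. $v\in D(A(s))$ and $\frac{\partial}{\partial s}U(t,s)v=-U(t,s)A(s)v$; 4. $U(t,s)Y\subset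 Y$; 5. $(t,s)\mapsto U(t,s)v\in Y$ is continuous for the norm of $Y$; and if moreover $U$ is the only evolution system that satisfies 2, 3 and a bound as in 1 for some real constant $\omega'$ in place of $\omega$. (The derivatives are in the norm of $E$, one-sided where necessary.) **Theorem.** Let $X:[0,1]\to\mathcal X^{in}$ be a smooth path, that is, $X(t)=f(t,\theta)\partial_\theta$ with $f$ smooth on $[0,1]\times S^1$. Then the time-ordered exponential $\prod_{1\ge t\ge 0}\operatorname{Exp}(\pi(X(t)))\,dt$ exists on $\mathcal H$ (with respect to $\mathcal H_1$). The same holds on $\mathcal H_n$ for every $n\ge 0$: the time-ordered exponential of the family $\pi(X(t))|_{\mathcal H_n}$ exists on $\mathcal H_n$ (with respect to $\mathcal H_{n+1}$). -/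

import Mathlib

open Set Filter Topology Real
open scoped ContDiff InnerProductSpace

noncomputable section

namespace VirasoroEvolution

/-! ### Unbounded operators -/

section UnboundedOperators

/-- The composite `g ∘ f` of two unbounded operators, on its natural domain
`{x ∈ D(f) | f x ∈ D(g)}`. -/
def natComp {E : Type*} [AddCommGroup E] [Module ℂ E] (g f : E →ₗ.[ℂ] E) : E →ₗ.[ℂ] E :=
  g.comp (f.domRestrict ((g.domain.comap f.toFun).map f.domain.subtype)) (by
    rintro ⟨x, hx1, hx2⟩
    obtain ⟨z, hz, rfl⟩ := Submodule.mem_map.1 hx1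
    exact hz)

/-- The power `A ^ n` of an unbounded operator, on its natural domain; `A ^ 0` is the identity
with domain the whole space. -/
def natPow {E : Type*} [AddCommGroup E] [Module ℂ E] (A : E →ₗ.[ℂ] E) : ℕ → (E →ₗ.[ℂ] E)
  | 0 => (LinearMap.id : E →ₗ[ℂ] E).toPMap ⊤
  | n + 1 => natComp (natPow A n) A

/-- The part of the unbounded operator `A` in a space `Y` embedded by the injective map `ι`:
it has domain `{y | ι y ∈ D(A), A (ι y) ∈ ι Y}`, and it is the restriction of `A` there. -/
def partIn {E Y : Type*} [AddCommGroup E] [Module ℂ E] [AddCommGroup Y] [Module ℂ Y]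
    (ι : Y →ₗ[ℂ] E) (A : E →ₗ.[ℂ] E) : Y →ₗ.[ℂ] Y :=
  (A.graph.comap (ι.prodMap ι)).toLinearPMap

theorem mem_graph_partIn {E Y : Type*} [AddCommGroup E] [Module ℂ E] [AddCommGroup Y]
    [Module ℂ Y] (ι : Y →ₗ[ℂ] E) (hι : Function.Injective ι) (A : E →ₗ.[ℂ] E) (x y : Y) :
    (x, y) ∈ (partIn ι A).graph ↔ (ι x, ι y) ∈ A.graph := by
  rw [partIn, Submodule.toLinearPMap_graph_eq]
  · rfl
  · rintro ⟨a, b⟩ hab h0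
    have h0' : a = 0 := h0
    subst h0'
    have h1 : (ι 0, ι b) ∈ A.graph := hab
    rw [map_zero] at h1
    exact hι ((A.graph_fst_eq_zero_snd h1 rfl).trans (map_zero ι).symm)

/-- A bound below passes from an operator to the composite. -/
theorem norm_le_natPow {E : Type*} [NormedAddCommGroup E] [NormedSpace ℂ E] (A : E →ₗ.[ℂ] E)
    (hA : ∀ x : A.domain, ‖(x : E)‖ ≤ ‖A x‖) :
    ∀ (n : ℕ) (x : (natPow A n).domain), ‖(x : E)‖ ≤ ‖natPow A n x‖
  | 0, x => le_of_eq rfl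
  | n + 1, ⟨x, hx⟩ => by
      have h1 := hA ⟨x, hx.2⟩
      obtain ⟨z, hz, hzx⟩ := Submodule.mem_map.1 hx.1
      have hz' : z = ⟨x, hx.2⟩ := Subtype.ext hzx
      subst hz'
      exact h1.trans (norm_le_natPow A hA n ⟨A ⟨x, hx.2⟩, hz⟩)

/-- The domains of the powers decrease. -/
theorem natPow_domain_succ_le {E : Type*} [AddCommGroup E] [Module ℂ E] (A : E →ₗ.[ℂ] E) :
    ∀ n : ℕ, (natPow A (n + 1)).domain ≤ (natPow A n).domain
  | 0 => fun _ _ => Submodule.mem_top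
  | n + 1 => fun x hx => by
      obtain ⟨z, hz, rfl⟩ := Submodule.mem_map.1 hx.1
      exact ⟨Submodule.mem_map.2 ⟨z, natPow_domain_succ_le A n hz, rfl⟩, hx.2⟩

end UnboundedOperators

/-! ### Semigroups, evolution systems and time-ordered exponentials -/

section Evolution

variable {E Y : Type*} [NormedAddCommGroup E] [NormedSpace ℂ E]
  [NormedAddCommGroup Y] [NormedSpace ℂ Y]

/-- `C₀`-semigroups of bounded operators; only the values `T s` with `0 ≤ s` matter. -/
structure IsC0Semigroup (T : ℝ → E →L[ℂ] E) : Prop where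
  zero : T 0 = 1
  add : ∀ s t : ℝ, 0 ≤ s → 0 ≤ t → T (s + t) = T s * T t
  continuous : ∀ x : E, Tendsto (fun t => T t x) (𝓝[>] 0) (𝓝 x)

/-- `A` is the generator of `T`: its domain consists of exactly those `x` for which
`lim_{t ↘ 0} (T t x - x) / t` exists, and `A x` is this limit. -/
def IsGenerator (A : E →ₗ.[ℂ] E) (T : ℝ → E →L[ℂ] E) : Prop :=
  ∀ x y : E, (x, y) ∈ A.graph ↔ Tendsto (fun t : ℝ => t⁻¹ • (T t x - x)) (𝓝[>] 0) (𝓝 y)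

/-- The triangle of all `(t, s)` with `0 ≤ s ≤ t ≤ 1`. -/
def triangle : Set (ℝ × ℝ) := {p | 0 ≤ p.2 ∧ p.2 ≤ p.1 ∧ p.1 ≤ 1}

/-- Evolution systems on `E` over `[0, 1]`; only the values `U t s` with `0 ≤ s ≤ t ≤ 1` matter. -/
structure IsEvolutionSystem (U : ℝ → ℝ → E →L[ℂ] E) : Prop where
  refl : ∀ s ∈ Icc (0 : ℝ) 1, U s s = 1
  trans : ∀ t r s : ℝ, 0 ≤ s → s ≤ r → r ≤ t → t ≤ 1 → U t r * U r s = U t s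
  continuousOn : ∀ x : E, ContinuousOn (fun p : ℝ × ℝ => U p.1 p.2 x) triangle

/-- `‖U(t,s)‖ ≤ e^{κ(t-s)}`. -/
def HasGrowthBound (κ : ℝ) (U : ℝ → ℝ → E →L[ℂ] E) : Prop :=
  ∀ t s : ℝ, (t, s) ∈ triangle → ‖U t s‖ ≤ exp (κ * (t - s))

/-- `∂/∂t U(t,s) v = A(t) U(t,s) v` for `v ∈ Y`, including that `U(t,s) v ∈ D(A(t))`. The
derivative is in the norm of `E`, one-sided at the ends of `[s, 1]`. -/
def HasForwardDeriv (ι : Y →ₗ[ℂ] E) (A : ℝ → E →ₗ.[ℂ] E) (U : ℝ → ℝ → E →L[ℂ] E) : Prop :=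
  ∀ (v : Y) (t s : ℝ), (t, s) ∈ triangle → ∃ w : E, (U t s (ι v), w) ∈ (A t).graph ∧
    HasDerivWithinAt (fun t' => U t' s (ι v)) w (Icc s 1) t

/-- `∂/∂s U(t,s) v = - U(t,s) A(s) v` for `v ∈ Y`, including that `v ∈ D(A(s))`. The
derivative is in the norm of `E`, one-sided at the ends of `[0, t]`. -/
def HasBackwardDeriv (ι : Y →ₗ[ℂ] E) (A : ℝ → E →ₗ.[ℂ] E) (U : ℝ → ℝ → E →L[ℂ] E) : Prop :=
  ∀ (v : Y) (t s : ℝ), (t, s) ∈ triangle → ∃ w : E, (ι v, w) ∈ (A s).graph ∧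
    HasDerivWithinAt (fun s' => U t s' (ι v)) (-(U t s w)) (Icc 0 t) s

/-- `U` is the time-ordered exponential `∏_{t ≥ τ ≥ s} Exp(A(τ) dτ)` of the family `A` of
generators on `E`, with respect to the space `Y` embedded in `E` by `ι`. -/
structure IsTimeOrderedExponential (ι : Y →ₗ[ℂ] E) (A : ℝ → E →ₗ.[ℂ] E)
    (U : ℝ → ℝ → E →L[ℂ] E) : Prop where
  evolutionSystem : IsEvolutionSystem U
  /-- Every `A(t)` generates a `C₀`-semigroup, with a common growth rate, which is also a growth
  rate of `U`. -/
  growth : ∃ κ : ℝ, 0 ≤ κ ∧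
    (∀ t ∈ Icc (0 : ℝ) 1, ∃ T : ℝ → E →L[ℂ] E, IsC0Semigroup T ∧ IsGenerator (A t) T ∧
      ∀ s : ℝ, 0 ≤ s → ‖T s‖ ≤ exp (κ * s)) ∧
    HasGrowthBound κ U
  forward : HasForwardDeriv ι A U
  backward : HasBackwardDeriv ι A U
  /-- `U(t,s)` maps `Y` to `Y`, and `(t,s) ↦ U(t,s) v ∈ Y` is continuous for every `v ∈ Y`. -/
  regular : ∀ v : Y, ∃ u : ℝ × ℝ → Y,
    (∀ p ∈ triangle, ι (u p) = U p.1 p.2 (ι v)) ∧ ContinuousOn u triangle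

/-- The time-ordered exponential of the family `A` exists: there is an evolution system as in
`IsTimeOrderedExponential`, and it is the only exponentially bounded evolution system with the
two differential equations. -/
def TimeOrderedExponentialExists (ι : Y →ₗ[ℂ] E) (A : ℝ → E →ₗ.[ℂ] E) : Prop :=
  ∃ U : ℝ → ℝ → E →L[ℂ] E, IsTimeOrderedExponential ι A U ∧
    ∀ V : ℝ → ℝ → E →L[ℂ] E, IsEvolutionSystem V → (∃ κ : ℝ, HasGrowthBound κ V) →
      HasForwardDeriv ι A V → HasBackwardDeriv ι A V →
      ∀ t s : ℝ, (t, s) ∈ triangle → V t s = U t s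

end Evolution

/-! ### Vector fields on the circle -/

/-- A smooth complex vector field `f(θ) ∂_θ` on the circle, given by its coefficient `f`. -/
structure VectorField where
  coeff : ℝ → ℂ
  smooth : ContDiff ℝ ∞ coeff
  periodic : Function.Periodic coeff (2 * π)

/-- The `n`-th Fourier coefficient `(1 / 2π) ∫_0^{2π} f(θ) e^{-inθ} dθ` of the coefficient `f`
of a vector field. -/
def VectorField.fourier (X : VectorField) (n : ℤ) : ℂ :=
  fourierCoeffOn two_pi_pos X.coeff n

/-- The cone of inward pointing vector fields (possibly tangent to the circle somewhere). -/
def inwardCone : Set VectorField := {X | ∀ θ : ℝ, 0 ≤ (X.coeff θ).im}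

/-- `X` restricts to a smooth path `[0, 1] → inwardCone`; values outside `[0, 1]` are
irrelevant. Smoothness is joint smoothness of the coefficient on `[0, 1] × ℝ`, that is, smoothness
of the path for the `C^∞` topology. -/
structure IsSmoothInwardPath (X : ℝ → VectorField) : Prop where
  smooth : ContDiffOn ℝ ∞ (fun p : ℝ × ℝ => (X p.1).coeff p.2) (Icc 0 1 ×ˢ univ)
  inward : ∀ t ∈ Icc (0 : ℝ) 1, X t ∈ inwardCone

/-! ### Unitary positive energy representations of the Virasoro algebra -/

section Representation

variable {H : Type*} [NormedAddCommGroup H] [InnerProductSpace ℂ H]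

/-- A unitary positive energy representation of the Virasoro algebra with central charge `c` on
the complex inner product space `W` (a linear subspace of `H`). -/
structure UnitaryPositiveEnergyRep (c : ℝ) (W : Submodule ℂ H) where
  /-- The operators of the basis elements `L_n`; the central element acts as the identity. -/
  L : ℤ → W →ₗ[ℂ] W
  commutator : ∀ (m n : ℤ) (w : W), L m (L n w) - L n (L m w) =
    ((m : ℂ) - n) • L (m + n) w +
      (if m + n = 0 then (c : ℂ) / 12 * ((m : ℂ) ^ 3 - m) else 0) • w
  unitary : ∀ (n : ℤ) (v w : W), ⟪L n v, w⟫_ℂ = ⟪v, L (-n) w⟫_ℂ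
  /-- `W` is spanned by the eigenvectors of `L_0`. -/
  diagonalizable : ⨆ μ : ℂ, Module.End.eigenspace (L 0) μ = ⊤
  finiteDimensional : ∀ μ : ℂ, FiniteDimensional ℂ (Module.End.eigenspace (L 0) μ)
  discrete : IsDiscrete {μ : ℂ | Module.End.HasEigenvalue (L 0) μ}
  boundedBelow : ∃ m : ℝ, ∀ μ : ℂ, Module.End.HasEigenvalue (L 0) μ → m ≤ μ.re

namespace UnitaryPositiveEnergyRep

variable {c : ℝ} {W : Submodule ℂ H} (ρ : UnitaryPositiveEnergyRep c W)

/-- The graph of the operator `w ↦ ∑ n, i f̂(n) L_n w` on `W`, for the vector field `f ∂_θ`. Here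
`i e^{inθ} ↔ i L_n`, that is, `L_n` corresponds to `-i e^{inθ} ∂_θ = z^{n+1} ∂_z`. -/
def smearedGraph (X : VectorField) : Submodule ℂ (H × H) where
  carrier := {p | ∃ w : W, (w : H) = p.1 ∧
    HasSum (fun n : ℤ => (Complex.I * X.fourier n) • (ρ.L n w : H)) p.2}
  add_mem' := by
    rintro a b ⟨v, hv, hv'⟩ ⟨w, hw, hw'⟩
    refine ⟨v + w, by simp [hv, hw], ?_⟩
    simpa using hv'.add hw'
  zero_mem' := ⟨0, rfl, by simp [hasSum_zero]⟩
  smul_mem' := by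
    rintro k a ⟨v, hv, hv'⟩
    refine ⟨k • v, by simp [hv], ?_⟩
    simpa [smul_comm k] using hv'.const_smul k

/-- The sum of the series is unique, so `smearedGraph` is the graph of an operator. -/
theorem mem_graph_smeared (X : VectorField) (p : H × H) :
    p ∈ (ρ.smearedGraph X).toLinearPMap.graph ↔ ∃ w : W, (w : H) = p.1 ∧
      HasSum (fun n : ℤ => (Complex.I * X.fourier n) • (ρ.L n w : H)) p.2 := by
  rw [Submodule.toLinearPMap_graph_eq]
  · rfl
  · rintro ⟨a, b⟩ ⟨w, hw, hs⟩ h0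
    have hw0 : w = 0 := Subtype.ext (hw.trans h0)
    subst hw0
    have hs0 : HasSum (fun _ : ℤ => (0 : H)) b := by simpa using hs
    exact hs0.unique hasSum_zero

/-- The closed unbounded operator `π(X)` on `H`: the closure of `w ↦ ∑ n, i f̂(n) L_n w`,
`w ∈ W`, where `X = f ∂_θ`. -/
def op (X : VectorField) : H →ₗ.[ℂ] H :=
  (ρ.smearedGraph X).toLinearPMap.closure

/-- The closed unbounded operator `L_0` on `H`: the closure of `L_0` on `W`. -/
def closedL0 : H →ₗ.[ℂ] H :=
  (⟨W, W.subtype ∘ₗ ρ.L 0⟩ : H →ₗ.[ℂ] H).closure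

/-- The unbounded operator `(1 + L_0) ^ n` on `H`. -/
def energyPow (n : ℕ) : H →ₗ.[ℂ] H :=
  natPow ((LinearMap.id : H →ₗ[ℂ] H) +ᵥ ρ.closedL0) n

theorem isSymmetric_L0 : (ρ.L 0).IsSymmetric := fun v w => by
  simpa using ρ.unitary 0 v w

/-- `L_1` lowers a negative eigenvalue of `L_0` by one, without annihilating the eigenvector. -/
theorem hasEigenvalue_sub_one {μ : ℂ} (hμ : Module.End.HasEigenvalue (ρ.L 0) μ)
    (hneg : μ.re < 0) : Module.End.HasEigenvalue (ρ.L 0) (μ - 1) := by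
  obtain ⟨v, hv⟩ := hμ.exists_hasEigenvector
  have hv1 : ρ.L 0 v = μ • v := hv.apply_eq_smul
  have hv2 : v ≠ 0 := hv.2
  refine Module.End.hasEigenvalue_of_hasEigenvector (x := ρ.L 1 v) ⟨?_, ?_⟩
  · rw [Module.End.mem_eigenspace_iff]
    have h := ρ.commutator 0 1 v
    simp only [hv1, map_smul] at h
    norm_num at h
    rw [sub_eq_iff_eq_add] at h
    rw [h, sub_smul, one_smul]
    abel
  · intro h0
    have h := ρ.commutator 1 (-1) v
    norm_num [h0, hv1] at h
    have h2 := ρ.unitary 1 (ρ.L (-1) v) v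
    rw [h, smul_smul, inner_smul_left, inner_self_eq_norm_sq_to_K, inner_self_eq_norm_sq_to_K] at h2
    have h3 := congrArg Complex.re h2
    have hpos : 0 < ‖v‖ ^ 2 := by positivity
    have hnn : 0 ≤ ‖ρ.L (-1) v‖ ^ 2 := by positivity
    simp only [RingHom.map_mul, Complex.coe_algebraMap, ← Complex.ofReal_pow,
      Complex.re_mul_ofReal, Complex.ofReal_re] at h3
    have h4 : ((starRingEnd ℂ) 2 * (starRingEnd ℂ) μ).re = 2 * μ.re := by simp
    rw [h4] at h3
    nlinarith

/-- The eigenvalues of `L_0` are non-negative. -/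
theorem eigenvalue_nonneg {μ : ℂ} (hμ : Module.End.HasEigenvalue (ρ.L 0) μ) : 0 ≤ μ.re := by
  by_contra! hneg
  obtain ⟨m, hm⟩ := ρ.boundedBelow
  have key : ∀ k : ℕ, Module.End.HasEigenvalue (ρ.L 0) (μ - k) := by
    intro k
    induction k with
    | zero => simpa using hμ
    | succ k ih =>
      have h := ρ.hasEigenvalue_sub_one ih (by
        simp only [Complex.sub_re, Complex.natCast_re]
        have : (0 : ℝ) ≤ k := k.cast_nonneg
        linarith)
      convert h using 1
      push_cast
      ring
  obtain ⟨k, hk⟩ := exists_nat_gt (μ.re - m)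
  have h := hm _ (key k)
  simp only [Complex.sub_re, Complex.natCast_re] at h
  linarith

/-- `L_0` is a non-negative operator. -/
theorem inner_L0_nonneg (w : W) : 0 ≤ (⟪w, ρ.L 0 w⟫_ℂ).re := by
  classical
  have hw : w ∈ ⨆ μ : ℂ, Module.End.eigenspace (ρ.L 0) μ := by
    rw [ρ.diagonalizable]; exact Submodule.mem_top
  obtain ⟨f, hf⟩ := (Submodule.mem_iSup_iff_exists_dfinsupp' _ _).1 hw
  have hsum : w = ∑ μ ∈ f.support, (f μ : W) := hf.symm
  have hL : ρ.L 0 w = ∑ μ ∈ f.support, ((μ • f μ : Module.End.eigenspace (ρ.L 0) μ) : W) := by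
    rw [hsum, map_sum]
    refine Finset.sum_congr rfl fun μ _ => ?_
    rw [Submodule.coe_smul]
    exact Module.End.mem_eigenspace_iff.1 (f μ).2
  have hO := ρ.isSymmetric_L0.orthogonalFamily_eigenspaces.inner_sum
    (fun μ => f μ) (fun μ => μ • f μ) f.support
  simp only [Submodule.coe_subtypeₗᵢ, Submodule.coe_subtype] at hO
  rw [hL]
  nth_rewrite 1 [hsum]
  rw [hO, Complex.re_sum]
  refine Finset.sum_nonneg fun μ hμ => ?_
  have hne : f μ ≠ 0 := by simpa using hμ
  have hev : Module.End.HasEigenvalue (ρ.L 0) μ :=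
    Module.End.hasEigenvalue_of_hasEigenvector
      (x := (f μ : W)) ⟨(f μ).2, fun h => hne (Subtype.ext h)⟩
  have h1 := ρ.eigenvalue_nonneg hev
  rw [inner_smul_right, inner_self_eq_norm_sq_to_K]
  simp only [Complex.coe_algebraMap, ← Complex.ofReal_pow, Complex.re_mul_ofReal]
  positivity

/-- The operator `1 + L_0` is bounded below by one. -/
theorem norm_le_energy (x : ((LinearMap.id : H →ₗ[ℂ] H) +ᵥ ρ.closedL0).domain) :
    ‖(x : H)‖ ≤ ‖((LinearMap.id : H →ₗ[ℂ] H) +ᵥ ρ.closedL0) x‖ := by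
  have key : ∀ w : W, ‖w‖ ≤ ‖w + ρ.L 0 w‖ := by
    intro w
    by_cases h0 : w = 0
    · simp [h0]
    have h1 : ‖w‖ ^ 2 ≤ ‖w‖ * ‖w + ρ.L 0 w‖ := by
      have h2 := ρ.inner_L0_nonneg w
      have h3 : (⟪w, w + ρ.L 0 w⟫_ℂ).re ≤ ‖w‖ * ‖w + ρ.L 0 w‖ := re_inner_le_norm (𝕜 := ℂ) _ _
      rw [inner_add_right, Complex.add_re, inner_self_eq_norm_sq_to_K] at h3
      simp only [Complex.coe_algebraMap, ← Complex.ofReal_pow, Complex.ofReal_re] at h3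
      linarith
    have h4 : 0 < ‖w‖ := norm_pos_iff.2 h0
    nlinarith
  set A : H →ₗ.[ℂ] H := ⟨W, W.subtype ∘ₗ ρ.L 0⟩ with hAdef
  have hA : ∀ p ∈ A.graph, ‖p.1‖ ≤ ‖p.1 + p.2‖ := by
    intro p hp
    obtain ⟨w, hw1, hw2⟩ := (LinearPMap.mem_graph_iff _).1 hp
    have hw2' : ((ρ.L 0 w : W) : H) = p.2 := hw2
    rw [← hw1, ← hw2']
    exact key w
  have hcl : ∀ p ∈ A.closure.graph, ‖p.1‖ ≤ ‖p.1 + p.2‖ := by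
    by_cases hc : A.IsClosable
    · rw [← hc.graph_closure_eq_closure_graph]
      intro p hp
      have hclosed : IsClosed {p : H × H | ‖p.1‖ ≤ ‖p.1 + p.2‖} :=
        isClosed_le (by fun_prop) (by fun_prop)
      exact closure_minimal (fun q hq => hA q hq) hclosed hp
    · rwa [LinearPMap.closure_def' hc]
  have h := hcl (x, A.closure ⟨x, x.2⟩) (LinearPMap.mem_graph _ _)
  exact h

/-- The space `H_n = D((1 + L_0) ^ n)`, to be given the norm `‖x‖_n = ‖(1 + L_0) ^ n x‖`. -/
def Sobolev (n : ℕ) : Type _ := (ρ.energyPow n).domain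

namespace Sobolev

variable (n : ℕ)

instance : AddCommGroup (ρ.Sobolev n) := inferInstanceAs (AddCommGroup (ρ.energyPow n).domain)

instance : Module ℂ (ρ.Sobolev n) := inferInstanceAs (Module ℂ (ρ.energyPow n).domain)

/-- The inclusion `H_n ⊆ H`. -/
def incl : ρ.Sobolev n →ₗ[ℂ] H := (ρ.energyPow n).domain.subtype

/-- The operator `(1 + L_0) ^ n : H_n → H`. -/
def energy : ρ.Sobolev n →ₗ[ℂ] H := (ρ.energyPow n).toFun

theorem norm_incl_le_energy (x : ρ.Sobolev n) : ‖incl ρ n x‖ ≤ ‖energy ρ n x‖ :=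
  norm_le_natPow _ ρ.norm_le_energy n x

theorem energy_injective : Function.Injective (energy ρ n) := by
  rw [injective_iff_map_eq_zero]
  intro x hx
  have h := norm_incl_le_energy ρ n x
  rw [hx, norm_zero, norm_le_zero_iff] at h
  exact Subtype.ext h

/-- The norm `‖x‖_n = ‖(1 + L_0) ^ n x‖`. -/
instance : NormedAddCommGroup (ρ.Sobolev n) :=
  NormedAddCommGroup.induced (ρ.Sobolev n) H (energy ρ n) (energy_injective ρ n)

instance : NormedSpace ℂ (ρ.Sobolev n) :=
  NormedSpace.induced ℂ (ρ.Sobolev n) H (energy ρ n)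

theorem norm_def (x : ρ.Sobolev n) : ‖x‖ = ‖energy ρ n x‖ := rfl

/-- The inclusion `H_{n+1} ⊆ H_n`. -/
def inclSucc : ρ.Sobolev (n + 1) →ₗ[ℂ] ρ.Sobolev n :=
  Submodule.inclusion (natPow_domain_succ_le _ n)

end Sobolev

/-- The part of `π(X)` in `H_n`, with domain `{x ∈ D(π(X)) ∩ H_n | π(X) x ∈ H_n}`. -/
def opPart (n : ℕ) (X : VectorField) : ρ.Sobolev n →ₗ.[ℂ] ρ.Sobolev n :=
  partIn (Sobolev.incl ρ n) (ρ.op X)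

end UnitaryPositiveEnergyRep
end Representation
end VirasoroEvolution

end

/-! Write `Λ = 1 + L_0` and `R = Λ⁻¹`, a bounded injective operator with dense range, so that `H_k`
is the range of `R ^ k`. The linear energy bounds (`norm_L_le`) turn the unbounded family `A(t) =
π(X(t))` into the bounded, norm continuous families `K k t = Λ ^ k A(t) Λ ^ (-k-1)` on the fixed
Hilbert space, related by `R K_{k+1} = K_k R`. The theorem then rests on quasi-dissipativity, `Re
⟨A(t) w, w⟩ ≤ κ ‖w‖²` uniformly in `t`, on every `H_k`. The level `k = 0` implies the others,
because `[Λ ^ k, A(t)] Λ ^ (-k)` is bounded (`norm_conj_sub_le`).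

Given this, the evolution system is a strong limit. With `J_N = 1 - (1 - R) ^ N = R Q_N`, the
bounded operators `J_N K_k Q_N` are quasi-dissipative with the same constant. Their evolution
systems come from a Dyson series, and by Duhamel's formula they form a Cauchy sequence on the dense
range of `R²`, since `‖(1 - J_N) R‖ → 0`. The limits intertwine the levels, which gives invariance
and continuity on `H_{k+1}`. The integral equations pass to the limit and yield both differential
equations. Uniqueness follows by differentiating `V(t,r) U(r,s) v` in `r`. Freezing the time gives
semigroups, whose generators are the closures of `K_k R⁻¹`. At level `k` this is the part of the
level `0` generator in `H_k`.

Quasi-dissipativity at level `0` is a quantum energy inequality. The real part of `f` contributes a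
skew operator, so it remains to bound `T(h) = ∑ ĥ(n) L_n` below for `h = Im f ≥ 0`. If `h > 0`, a
change of coordinate on the circle makes `h ∂_θ` constant, and a positive multiple of `L_0` is
non-negative; the price is a Schwinger term proportional to `c`. Rather than representing
diffeomorphisms, the proof transports `h` to a constant along a path of real vector fields
(`exists_flattening`). The evolution for that path exists by the abstract theorem already proved,
since skew operators are dissipative with constant `0`, and `⟨u, T(F) u⟩` changes along it only by
the integrated Virasoro cocycle (`exists_inner_Kop_transport`), an explicit multiple of a difference
of means of `F - F_θ² / F`. For `h ≥ 0`, apply this to `h + ε`. Glaeser's inequality `h'² ≤ 2 M h`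
(`sq_deriv_le_of_nonneg`) keeps the constant bounded as `ε → 0`, and compactness of `[0,1]` and of
the circle makes it uniform in `t`. -/

noncomputable section

namespace VirasoroEvolution

/-! ### Linear differential equations and evolution systems in the bounded case -/

section LinearODE

variable {F : Type*} [NormedAddCommGroup F] [NormedSpace ℝ F]

/-- The terms of the Dyson series of `y' = B(t) y`, `y 0 = y₀`. -/
def dysonTerm (B : ℝ → F →L[ℝ] F) (y₀ : F) : ℕ → ℝ → F
  | 0 => fun _ => y₀
  | n + 1 => fun t => ∫ r in (0 : ℝ)..t, B r (dysonTerm B y₀ n r)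

variable {B : ℝ → F →L[ℝ] F} {y₀ : F}

theorem continuous_dysonTerm (hB : Continuous B) (n : ℕ) : Continuous (dysonTerm B y₀ n) := by
  induction n with
  | zero => exact continuous_const
  | succ n ih =>
    exact intervalIntegral.continuous_primitive
      (fun a b => (hB.clm_apply ih).intervalIntegrable a b) 0

/-- Each integration raises the power of `|t|` and divides by the next integer, so the Dyson series
is dominated by an exponential series, uniformly on `|t| ≤ T`. -/
theorem norm_dysonTerm_le (hB : Continuous B) {M T : ℝ} (hM : 0 ≤ M)
    (hBM : ∀ t, |t| ≤ T → ‖B t‖ ≤ M) (n : ℕ) (t : ℝ) (ht : |t| ≤ T) :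
    ‖dysonTerm B y₀ n t‖ ≤ ‖y₀‖ * ((M ^ n / n.factorial) * |t| ^ n) := by
  induction n generalizing t with
  | zero => simp [dysonTerm]
  | succ n ih =>
    have hsub : ∀ r ∈ uIoc 0 t, |r| ≤ T := fun r hr => by
      have h1 := abs_sub_left_of_mem_uIcc (uIoc_subset_uIcc hr)
      simp only [sub_zero] at h1
      exact h1.trans ht
    calc ‖dysonTerm B y₀ (n + 1) t‖
        ≤ ∫ r in uIoc 0 t, ‖B r (dysonTerm B y₀ n r)‖ :=
          intervalIntegral.norm_integral_le_integral_norm_uIoc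
      _ ≤ ∫ r in uIoc 0 t, (M * (‖y₀‖ * (M ^ n / n.factorial))) * |r - 0| ^ n := by
          refine MeasureTheory.setIntegral_mono_on ?_ ?_ measurableSet_uIoc fun r hr => ?_
          · exact (intervalIntegrable_iff.1
              ((hB.clm_apply (continuous_dysonTerm hB n)).norm.intervalIntegrable 0 t))
          · exact (intervalIntegrable_iff.1
              ((by fun_prop : Continuous fun r : ℝ => (M * (‖y₀‖ * (M ^ n / n.factorial))) *
                |r - 0| ^ n).intervalIntegrable 0 t))
          · refine ((B r).le_opNorm _).trans ?_
            rw [sub_zero, mul_assoc, mul_assoc]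
            exact mul_le_mul (hBM r (hsub r hr)) (ih r (hsub r hr)) (norm_nonneg _) hM
      _ = ‖y₀‖ * ((M ^ (n + 1) / (n + 1).factorial) * |t| ^ (n + 1)) := by
          rw [MeasureTheory.integral_const_mul, integral_pow_abs_sub_uIoc, sub_zero,
            Nat.factorial_succ]
          push_cast
          field_simp
          ring

/-- Global existence for linear differential equations with continuous bounded coefficients. -/
theorem exists_linearODE_solution [CompleteSpace F] (hB : Continuous B) (y₀ : F) :
    ∃ y : ℝ → F, y 0 = y₀ ∧ ∀ t, HasDerivAt y (B t (y t)) t := by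
  have hD : ∀ n t, HasDerivAt (dysonTerm B y₀ (n + 1)) (B t (dysonTerm B y₀ n t)) t :=
    fun n t => ((hB.clm_apply (continuous_dysonTerm hB n))).deriv_integral _ 0 t ▸
      (intervalIntegral.differentiable_integral_of_continuous
        (hB.clm_apply (continuous_dysonTerm hB n)) t).hasDerivAt
  have key : ∀ T : ℝ, ∃ u : ℕ → ℝ, Summable u ∧
      (∀ n t, |t| ≤ T → ‖dysonTerm B y₀ n t‖ ≤ u n) ∧
      ∃ M : ℝ, ∀ t, |t| ≤ T → ‖B t‖ ≤ M := by
    intro T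
    obtain ⟨M, hM⟩ := (isCompact_Icc (a := -T) (b := T)).exists_bound_of_continuousOn
      hB.continuousOn
    have hM' : ∀ t, |t| ≤ T → ‖B t‖ ≤ max M 0 :=
      fun t ht => (hM t (abs_le.1 ht)).trans (le_max_left _ _)
    refine ⟨fun n => ‖y₀‖ * ((max M 0 * |T|) ^ n / n.factorial),
      (Real.summable_pow_div_factorial _).mul_left _, fun n t ht => ?_, max M 0, hM'⟩
    refine (norm_dysonTerm_le hB (le_max_right _ _) hM' n t ht).trans ?_
    beta_reduce
    rw [mul_pow, mul_div_right_comm]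
    have : |t| ≤ |T| := ht.trans (le_abs_self T)
    gcongr
  have hsum : ∀ t, Summable fun n => dysonTerm B y₀ n t := fun t => by
    obtain ⟨u, hu, hle, -⟩ := key |t|
    exact Summable.of_norm_bounded hu fun n => hle n t le_rfl
  refine ⟨fun t => ∑' n, dysonTerm B y₀ n t, ?_, fun t => ?_⟩
  · beta_reduce
    rw [tsum_eq_single 0]
    · rfl
    · rintro (_ | n) hn
      · exact absurd rfl hn
      · simp [dysonTerm]
  -- The radius exceeds `|t|` so that the series can be differentiated on an open interval
  -- containing both `0` and `t`. The constant term is split off because only the terms of positive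
  -- index are integrals.
  · obtain ⟨u, hu, hle, M, hM⟩ := key (|t| + 1)
    have h1 : ∀ y, y = (fun t => y₀ + ∑' n, dysonTerm B y₀ (n + 1) t) →
        HasDerivAt y (∑' n, B t (dysonTerm B y₀ n t)) t := by
      rintro _ rfl
      refine HasDerivAt.const_add _ ?_
      refine hasDerivAt_tsum_of_isPreconnected (u := fun n => M * u n) (hu.mul_left M)
        isOpen_Ioo (isPreconnected_Ioo (a := -(|t| + 1)) (b := |t| + 1)) (fun n y _ => hD n y)
        (fun n y hy => ?_) (y₀ := 0) ?_ ?_ ?_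
      · have hy' : |y| ≤ |t| + 1 := (abs_lt.2 hy).le
        exact ((B y).le_opNorm _).trans (mul_le_mul (hM y hy') (hle n y hy') (norm_nonneg _)
          ((norm_nonneg _).trans (hM y hy')))
      · constructor <;> [skip; skip] <;> linarith [abs_nonneg t]
      · exact (summable_nat_add_iff 1).2 (hsum 0)
      · constructor <;> linarith [neg_abs_le t, le_abs_self t]
    have h2 := h1 (fun t => ∑' n, dysonTerm B y₀ n t) (funext fun t => (hsum t).tsum_eq_zero_add)
    rwa [← (B t).map_tsum (hsum t)] at h2

end LinearODE

section BoundedEvolution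

variable {E : Type*} [NormedAddCommGroup E] [NormedSpace ℂ E] [CompleteSpace E]

/-- The evolution system of a continuous family of bounded operators. -/
theorem exists_bounded_evolution {A : ℝ → E →L[ℂ] E} (hA : Continuous A) {M : NNReal}
    (hM : ∀ t, ‖A t‖ ≤ M) :
    ∃ U : ℝ → ℝ → E →L[ℂ] E, Continuous (fun p : ℝ × ℝ => U p.1 p.2) ∧ (∀ s, U s s = 1) ∧
      (∀ t s, HasDerivAt (fun t => U t s) (A t * U t s) t) ∧
      (∀ t s, HasDerivAt (fun s => U t s) (-(U t s * A s)) s) := by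
  have hL : Continuous fun t => (ContinuousLinearMap.mul ℝ (E →L[ℂ] E)) (A t) :=
    (ContinuousLinearMap.continuous _).comp hA
  have hR : Continuous fun t => -(ContinuousLinearMap.mul ℝ (E →L[ℂ] E)).flip (A t) :=
    ((ContinuousLinearMap.continuous _).comp hA).neg
  obtain ⟨Φ, hΦ0, hΦ⟩ := exists_linearODE_solution hL 1
  obtain ⟨Ψ, hΨ0, hΨ⟩ := exists_linearODE_solution hR 1
  replace hΦ : ∀ t, HasDerivAt Φ (A t * Φ t) t := fun t => by simpa using hΦ t
  replace hΨ : ∀ t, HasDerivAt Ψ (-(Ψ t * A t)) t := fun t => by simpa using hΨ t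
  -- The product and the constant `1` both solve the linear equation `x' = A x - x A`, which is
  -- globally Lipschitz by the bound on `A`. This makes `Φ t * Ψ s` the evolution system.
  have h1 : ∀ t, Φ t * Ψ t = 1 := by
    have hL : ∀ t, LipschitzOnWith (2 * M) (fun x : E →L[ℂ] E => A t * x - x * A t) univ :=
      fun t => (LipschitzWith.of_dist_le_mul fun x y => by
        rw [dist_eq_norm, dist_eq_norm, show A t * x - x * A t - (A t * y - y * A t) =
          A t * (x - y) - (x - y) * A t by noncomm_ring]
        refine (norm_sub_le _ _).trans ?_
        have h1 := (norm_mul_le (A t) (x - y)).trans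
          (mul_le_mul_of_nonneg_right (hM t) (norm_nonneg _))
        have h2 := (norm_mul_le (x - y) (A t)).trans
          (mul_le_mul_of_nonneg_left (hM t) (norm_nonneg _))
        push_cast
        linarith).lipschitzOnWith
    have h := ODE_solution_unique_univ (f := fun t => Φ t * Ψ t) (g := fun _ => 1) (t₀ := 0)
      (v := fun t x => A t * x - x * A t) hL
      (fun t => ⟨((hΦ t).mul (hΨ t)).congr_deriv
        (by simp only [mul_assoc, mul_neg, sub_eq_add_neg]), mem_univ _⟩)
      (fun t => ⟨by simpa using hasDerivAt_const t (1 : E →L[ℂ] E), mem_univ _⟩)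
      (by simp [hΦ0, hΨ0])
    exact fun t => congrFun h t
  refine ⟨fun t s => Φ t * Ψ s, ?_, h1, fun t s => ?_, fun t s => ?_⟩
  · have hΦc : Continuous Φ := continuous_iff_continuousAt.2 fun t => (hΦ t).continuousAt
    have hΨc : Continuous Ψ := continuous_iff_continuousAt.2 fun t => (hΨ t).continuousAt
    exact (hΦc.comp continuous_fst).mul (hΨc.comp continuous_snd)
  · simpa [mul_assoc] using (hΦ t).mul_const (Ψ s)
  · simpa [mul_assoc] using (hΨ s).const_mul (Φ t)

end BoundedEvolution

end VirasoroEvolution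

end

/-! ### Strong product rule, and comparison of bounded evolution systems -/

noncomputable section

namespace VirasoroEvolution

section StrongLimits

variable {E F : Type*} [NormedAddCommGroup E] [NormedSpace ℂ E]
  [NormedAddCommGroup F] [NormedSpace ℂ F]

theorem tendsto_apply_of_norm_le {ι : Type*} {l : Filter ι} {T : ι → E →L[ℂ] F} {T₀ : E →L[ℂ] F}
    {y : ι → E} {y₀ : E} {C : ℝ} (hC : ∀ i, ‖T i‖ ≤ C)
    (hT : Tendsto (fun i => T i y₀) l (𝓝 (T₀ y₀))) (hy : Tendsto y l (𝓝 y₀)) :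
    Tendsto (fun i => T i (y i)) l (𝓝 (T₀ y₀)) := by
  have h1 : Tendsto (fun i => T i (y i - y₀)) l (𝓝 0) := by
    refine squeeze_zero_norm (fun i => ((T i).le_opNorm _).trans
      (mul_le_mul_of_nonneg_right (hC i) (norm_nonneg _))) ?_
    have := ((hy.sub_const y₀).norm.const_mul C)
    simpa using this
  have h2 := h1.add hT
  simpa using h2

/-- The product rule for a strongly differentiable family of operators. -/
theorem hasDerivWithinAt_apply_of_norm_le {V : ℝ → E →L[ℂ] F} {y : ℝ → E} {y' : E} {d : F}
    {s : Set ℝ} {r : ℝ} {C : ℝ} (hC : ∀ r' ∈ s, ‖V r'‖ ≤ C) (hy : HasDerivWithinAt y y' s r)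
    (hcont : ContinuousWithinAt (fun r' => V r' y') s r)
    (hV : HasDerivWithinAt (fun r' => V r' (y r)) d s r) :
    HasDerivWithinAt (fun r' => V r' (y r')) (V r y' + d) s r := by
  -- Norm continuity of `V` is not available: the remainder of `y` is controlled by the uniform
  -- bound on `V`, and its linear part by strong continuity at the single vector `y'`.
  have h1 : HasDerivWithinAt (fun r' => V r' (y r' - y r)) (V r y') s r := by
    rw [hasDerivWithinAt_iff_isLittleO] at hy ⊢
    have e : ∀ r', V r' (y r' - y r) - V r (y r - y r) - (r' - r) • V r y' =
        V r' (y r' - y r - (r' - r) • y') + (r' - r) • (V r' y' - V r y') := fun r' => by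
      simp only [map_sub, sub_self, map_zero, smul_sub, sub_zero,
        ContinuousLinearMap.map_smul_of_tower]
      abel
    simp only [e]
    refine Asymptotics.IsLittleO.add ?_ ?_
    · refine Asymptotics.IsBigO.trans_isLittleO ?_ hy
      refine Asymptotics.IsBigO.of_bound C ?_
      filter_upwards [self_mem_nhdsWithin] with r' hr'
      exact ((V r').le_opNorm _).trans (mul_le_mul_of_nonneg_right (hC r' hr') (norm_nonneg _))
    · have h2 : (fun r' => V r' y' - V r y') =o[𝓝[s] r] (fun _ => (1 : ℝ)) := by
        rw [Asymptotics.isLittleO_one_iff]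
        simpa using hcont.tendsto.sub_const (V r y')
      simpa using (Asymptotics.isBigO_refl (fun r' => r' - r) (𝓝[s] r)).smul_isLittleO h2
  exact (h1.add hV).congr_of_eventuallyEq (.of_forall fun r' => by simp) (by simp)

theorem _root_.HasDerivAt.apply_const {V : ℝ → E →L[ℂ] F} {V' : E →L[ℂ] F} {r : ℝ}
    (hV : HasDerivAt V V' r) (x : E) : HasDerivAt (fun r => V r x) (V' x) r :=
  ((ContinuousLinearMap.apply ℂ F x).restrictScalars ℝ).hasFDerivAt.comp_hasDerivAt r hV

end StrongLimits

section BoundedEvolution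

/-- `U` is the evolution system of the continuous family `A` of bounded operators. -/
structure IsBoundedEvolution {E : Type*} [NormedAddCommGroup E] [NormedSpace ℂ E]
    (A : ℝ → E →L[ℂ] E) (U : ℝ → ℝ → E →L[ℂ] E) : Prop where
  continuous : Continuous (fun p : ℝ × ℝ => U p.1 p.2)
  refl : ∀ s, U s s = 1
  forward : ∀ t s, HasDerivAt (fun t => U t s) (A t * U t s) t
  backward : ∀ t s, HasDerivAt (fun s => U t s) (-(U t s * A s)) s

namespace IsBoundedEvolution

variable {E : Type*} [NormedAddCommGroup E] [NormedSpace ℂ E] {A A' : ℝ → E →L[ℂ] E}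
  {U V : ℝ → ℝ → E →L[ℂ] E}

/-- Duhamel's formula. The curve `r ↦ U t r * B * V r s` joins `U t s * B` at `r = s` to `B * V t s`
at `r = t`; intertwining, the cocycle law and the Cauchy estimate are all read off from its
derivative. -/
theorem hasDerivAt_comp (hU : IsBoundedEvolution A U) (hV : IsBoundedEvolution A' V)
    (B : E →L[ℂ] E) (t s r : ℝ) :
    HasDerivAt (fun r => U t r * B * V r s) (U t r * (B * A' r - A r * B) * V r s) r :=
  (((hU.backward t r).mul_const B).mul (hV.forward r s)).congr_deriv (by noncomm_ring)

theorem norm_comp_sub_le (hU : IsBoundedEvolution A U) (hV : IsBoundedEvolution A' V)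
    (B : E →L[ℂ] E) {t s C : ℝ} (hst : s ≤ t) (x : E)
    (hC : ∀ r ∈ Icc s t, ‖U t r ((B * A' r - A r * B) (V r s x))‖ ≤ C) :
    ‖B (V t s x) - U t s (B x)‖ ≤ C * (t - s) := by
  have h := norm_image_sub_le_of_norm_deriv_le_segment' (a := s) (b := t) (C := C)
    (f := fun r => (U t r * B * V r s) x)
    (fun r _ => ((hU.hasDerivAt_comp hV B t s r).apply_const x).hasDerivWithinAt)
    (fun r hr => by simpa using hC r (Ico_subset_Icc_self hr)) t (right_mem_Icc.2 hst)
  simpa [hU.refl, hV.refl] using h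

theorem comp_eq (hU : IsBoundedEvolution A U) (hV : IsBoundedEvolution A' V)
    (B : E →L[ℂ] E) (hB : ∀ r, B * A' r = A r * B) {t s : ℝ} (hst : s ≤ t) (x : E) :
    B (V t s x) = U t s (B x) := by
  have h := hU.norm_comp_sub_le hV B (C := 0) hst x (fun r _ => by simp [hB])
  rw [zero_mul, norm_le_zero_iff, sub_eq_zero] at h
  exact h

theorem trans (hU : IsBoundedEvolution A U) (t r s : ℝ) (x : E) :
    U t r (U r s x) = U t s x := by
  have h : ∀ r, HasDerivAt (fun r => U t r * 1 * U r s) 0 r := fun r =>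
    (hU.hasDerivAt_comp hU 1 t s r).congr_deriv (by simp)
  have h2 := is_const_of_deriv_eq_zero (fun r => (h r).differentiableAt)
    (fun r => (h r).deriv) r s
  simpa [hU.refl] using DFunLike.congr_fun h2 x

/-- Gronwall: quasi-dissipativity makes `exp (-2κr) ‖U r s v‖²` non-increasing in `r`. -/
theorem norm_le {H : Type*} [NormedAddCommGroup H] [InnerProductSpace ℂ H]
    {A : ℝ → H →L[ℂ] H} {U : ℝ → ℝ → H →L[ℂ] H} (hU : IsBoundedEvolution A U) {κ : ℝ}
    (hA : ∀ t v, (⟪A t v, v⟫_ℂ).re ≤ κ * ‖v‖ ^ 2) {t s : ℝ} (hst : s ≤ t) :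
    ‖U t s‖ ≤ exp (κ * (t - s)) := by
  refine ContinuousLinearMap.opNorm_le_bound _ (exp_pos _).le fun v => ?_
  have hu : ∀ r, HasDerivAt (fun r => U r s v) (A r (U r s v)) r := fun r =>
    (hU.forward r s).apply_const v
  have hn : ∀ r, HasDerivAt (fun r => ‖U r s v‖ ^ 2) (2 * (⟪A r (U r s v), U r s v⟫_ℂ).re) r := by
    intro r
    have h1 := Complex.reCLM.hasFDerivAt.comp_hasDerivAt r ((hu r).inner ℂ (hu r))
    have h2 : (Complex.reCLM ∘ fun r => ⟪U r s v, U r s v⟫_ℂ) = fun r => ‖U r s v‖ ^ 2 := by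
      ext r
      exact inner_self_eq_norm_sq (𝕜 := ℂ) (U r s v)
    rw [h2] at h1
    refine h1.congr_deriv ?_
    have h3 : (⟪U r s v, A r (U r s v)⟫_ℂ).re = (⟪A r (U r s v), U r s v⟫_ℂ).re :=
      inner_re_symm (𝕜 := ℂ) _ _
    simp only [Complex.reCLM_apply, Complex.add_re, h3]
    ring
  have hg : ∀ r, HasDerivAt (fun r => exp (-(2 * κ) * r) * ‖U r s v‖ ^ 2)
      (exp (-(2 * κ) * r) * (2 * (⟪A r (U r s v), U r s v⟫_ℂ).re - 2 * κ * ‖U r s v‖ ^ 2)) r := by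
    intro r
    have h1 : HasDerivAt (fun r => exp (-(2 * κ) * r)) (exp (-(2 * κ) * r) * (-(2 * κ))) r := by
      simpa using ((hasDerivAt_id r).const_mul (-(2 * κ))).exp
    exact (h1.mul (hn r)).congr_deriv (by ring)
  have hanti : Antitone (fun r => exp (-(2 * κ) * r) * ‖U r s v‖ ^ 2) :=
    antitone_of_deriv_nonpos (fun r => (hg r).differentiableAt) fun r => by
      rw [(hg r).deriv]
      have := hA r (U r s v)
      exact mul_nonpos_of_nonneg_of_nonpos (exp_pos _).le (by linarith)
  have h := hanti hst
  simp only [hU.refl, one_apply_eq_self] at h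
  have h4 : ‖U t s v‖ ^ 2 ≤ (exp (κ * (t - s)) * ‖v‖) ^ 2 := by
    have h5 : exp (κ * (t - s)) ^ 2 = exp (2 * κ * t) * exp (-(2 * κ) * s) := by
      rw [← exp_add, ← exp_nat_mul]; congr 1; push_cast; ring
    have h6 : exp (2 * κ * t) * exp (-(2 * κ) * t) = 1 := by
      rw [← exp_add, ← exp_zero]; congr 1; ring
    rw [mul_pow, h5, mul_assoc]
    calc ‖U t s v‖ ^ 2 = exp (2 * κ * t) * (exp (-(2 * κ) * t) * ‖U t s v‖ ^ 2) := by
          rw [← mul_assoc, h6, one_mul]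
      _ ≤ _ := mul_le_mul_of_nonneg_left h (exp_pos _).le
  exact (sq_le_sq₀ (norm_nonneg _) (by positivity)).1 h4

end IsBoundedEvolution

end BoundedEvolution

end VirasoroEvolution

end

/-! ### Regularization of a dissipative family on a scale of spaces -/

noncomputable section

namespace VirasoroEvolution

variable {H : Type*} [NormedAddCommGroup H] [InnerProductSpace ℂ H]

/-- A scale of spaces `R ^ k H`, with a sequence of bounded regularizations `J N = R Q N` of the
identity. -/
structure RegularizedScale (H : Type*) [NormedAddCommGroup H] [InnerProductSpace ℂ H] where
  R : H →L[ℂ] H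
  J : ℕ → H →L[ℂ] H
  Q : ℕ → H →L[ℂ] H
  J_eq : ∀ N, J N = R * Q N
  comm : ∀ N, R * Q N = Q N * R
  symm : ∀ N x y, ⟪J N x, y⟫_ℂ = ⟪x, J N y⟫_ℂ
  norm_J_le : ∀ N, ‖J N‖ ≤ 1
  tendsto_zero : Tendsto (fun N => ‖(1 - J N) * R‖) atTop (𝓝 0)
  injective : Function.Injective R
  dense : DenseRange R

/-- A continuous bounded family of operators `A t`, which map each space of the scale to the
preceding one and are quasi-dissipative on each. Here `K k t` is `Λ ^ k A(t) Λ ^ (-k-1)`, where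
`Λ` is the inverse of `R`. -/
structure IsDissipativeFamily (S : RegularizedScale H) (K : ℕ → ℝ → H →L[ℂ] H) (κ : ℕ → ℝ)
    (M : ℕ → NNReal) : Prop where
  continuous : ∀ k, Continuous (K k)
  bound : ∀ k t, ‖K k t‖ ≤ M k
  intertwine : ∀ k t, S.R * K (k + 1) t = K k t * S.R
  growth_nonneg : ∀ k, 0 ≤ κ k
  dissipative : ∀ k t v, (⟪K k t v, S.R v⟫_ℂ).re ≤ κ k * ‖S.R v‖ ^ 2

namespace RegularizedScale

variable (S : RegularizedScale H)

theorem R_mul_J (N : ℕ) : S.R * S.J N = S.J N * S.R := by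
  rw [S.J_eq, mul_assoc, ← S.comm]

theorem Q_mul_R (N : ℕ) : S.Q N * S.R = S.J N := by rw [S.J_eq, S.comm]

theorem norm_J_apply_le (N : ℕ) (x : H) : ‖S.J N x‖ ≤ ‖x‖ :=
  ((S.J N).le_opNorm x).trans (mul_le_of_le_one_left (norm_nonneg _) (S.norm_J_le N))

theorem dense_mul : DenseRange fun v => S.R (S.R v) := S.dense.comp S.dense S.R.continuous

/-- Convergence holds on the dense range of `R` by `tendsto_zero`, and spreads to all vectors
because the `J N` are contractions. -/
theorem tendsto_J (x : H) : Tendsto (fun N => S.J N x) atTop (𝓝 x) := by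
  rw [Metric.tendsto_atTop]
  intro ε hε
  obtain ⟨v, hv⟩ := S.dense.exists_dist_lt x (show 0 < ε / 3 by positivity)
  have h1 : Tendsto (fun N => ‖(1 - S.J N) * S.R‖ * ‖v‖) atTop (𝓝 0) := by
    simpa using S.tendsto_zero.mul_const ‖v‖
  obtain ⟨N₀, hN₀⟩ := (h1.eventually_lt_const (show 0 < ε / 3 by positivity)).exists_forall_of_atTop
  refine ⟨N₀, fun N hN => ?_⟩
  have h2 := ((((1 - S.J N) * S.R).le_opNorm v).trans_lt (hN₀ N hN))
  rw [dist_eq_norm] at hv ⊢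
  have e : S.J N x - x = -(S.J N (S.R v - x)) - (x - S.R v) - ((1 - S.J N) * S.R) v := by
    simp only [ContinuousLinearMap.mul_def, ContinuousLinearMap.comp_apply,
      sub_apply, one_apply_eq_self, map_sub]
    abel
  rw [e]
  refine (norm_sub_le _ _).trans_lt ?_
  have h4 := norm_sub_le (-(S.J N (S.R v - x))) (x - S.R v)
  rw [norm_neg] at h4
  have h5 := S.norm_J_apply_le N (S.R v - x)
  rw [norm_sub_rev (S.R v)] at h5
  linarith

end RegularizedScale

namespace IsDissipativeFamily

variable {S : RegularizedScale H} {K : ℕ → ℝ → H →L[ℂ] H} {κ : ℕ → ℝ} {M : ℕ → NNReal}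

/-- Bounded approximations of `Λ ^ k A(t) Λ ^ (-k)`. -/
def approx (S : RegularizedScale H) (K : ℕ → ℝ → H →L[ℂ] H) (k N : ℕ) (t : ℝ) : H →L[ℂ] H :=
  S.J N * K k t * S.Q N

/-- On the range of `R` the factor `Q N` becomes `J N`, so the approximations are bounded there
uniformly in `N`, although `Q N` is not assumed to be uniformly bounded. -/
theorem approx_R_apply (k N : ℕ) (t : ℝ) (x : H) :
    approx S K k N t (S.R x) = S.J N (K k t (S.J N x)) := by
  have h1 : S.Q N (S.R x) = S.J N x := DFunLike.congr_fun (S.Q_mul_R N) x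
  rw [← h1]
  rfl

theorem tendsto_approx_R (k : ℕ) (t : ℝ) {y : ℕ → H} {y₀ : H} (hy : Tendsto y atTop (𝓝 y₀)) :
    Tendsto (fun N => approx S K k N t (S.R (y N))) atTop (𝓝 (K k t y₀)) := by
  simp only [approx_R_apply]
  have h1 : Tendsto (fun N => S.J N (y N)) atTop (𝓝 y₀) :=
    tendsto_apply_of_norm_le (T₀ := 1) S.norm_J_le (S.tendsto_J y₀) hy
  exact tendsto_apply_of_norm_le (T₀ := 1) S.norm_J_le (S.tendsto_J _)
    (((K k t).continuous.tendsto _).comp h1)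

variable (h : IsDissipativeFamily S K κ M)
include h

theorem norm_approx_R_le (k N : ℕ) (t : ℝ) (x : H) : ‖approx S K k N t (S.R x)‖ ≤ M k * ‖x‖ := by
  rw [approx_R_apply]
  refine (S.norm_J_apply_le N _).trans (((K k t).le_opNorm _).trans ?_)
  exact mul_le_mul (h.bound k t) (S.norm_J_apply_le N x) (norm_nonneg _) (M k).2

/-- Symmetry moves the left factor `J N = R Q N` to the other side, which leaves the dissipativity
form of `K k t` at the vector `Q N v`. Since `J N` is a contraction and `κ k ≥ 0`, the constant is
independent of `N`. -/
theorem dissipative_approx (k N : ℕ) (t : ℝ) (v : H) :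
    (⟪approx S K k N t v, v⟫_ℂ).re ≤ κ k * ‖v‖ ^ 2 := by
  have h1 := h.dissipative k t (S.Q N v)
  have h2 : S.R (S.Q N v) = S.J N v := by rw [S.J_eq]; rfl
  rw [h2] at h1
  have h3 : ⟪approx S K k N t v, v⟫_ℂ = ⟪K k t (S.Q N v), S.J N v⟫_ℂ := S.symm N _ _
  rw [h3]
  refine h1.trans (mul_le_mul_of_nonneg_left ?_ (h.growth_nonneg k))
  have := S.norm_J_apply_le N v
  gcongr

theorem approx_intertwine (k N : ℕ) (t : ℝ) :
    S.R * approx S K (k + 1) N t = approx S K k N t * S.R := by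
  rw [approx, approx, ← mul_assoc, ← mul_assoc, S.R_mul_J, mul_assoc (S.J N), h.intertwine,
    mul_assoc, mul_assoc, mul_assoc, mul_assoc, S.comm]

/-- Moving one `R` through `K k t`, at the cost of passing to level `k + 1`, places an `R` next to
each occurrence of `1 - J N`. This gives operator norm convergence on the range of `R²`, uniformly
in `t`. -/
theorem norm_approx_sub_le (k N : ℕ) (t : ℝ) :
    ‖(approx S K k N t * S.R - K k t) * S.R‖ ≤ ‖(1 - S.J N) * S.R‖ * (M k + M (k + 1)) := by
  have e : (approx S K k N t * S.R - K k t) * S.R =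
      -(((1 - S.J N) * S.R) * K (k + 1) t * S.J N + K k t * ((1 - S.J N) * S.R)) := by
    have h1 : approx S K k N t * S.R = S.J N * K k t * S.J N := by
      rw [approx, mul_assoc, S.Q_mul_R]
    have h2 : K k t * S.J N * S.R = S.R * K (k + 1) t * S.J N := by
      rw [h.intertwine, mul_assoc, ← S.R_mul_J, mul_assoc]
    have h3 : (approx S K k N t * S.R - K k t) * S.R =
        S.J N * (K k t * S.J N * S.R) - K k t * S.R := by rw [h1]; noncomm_ring
    have h4 : ((1 - S.J N) * S.R) * K (k + 1) t * S.J N =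
        (1 - S.J N) * (S.R * K (k + 1) t * S.J N) := by noncomm_ring
    rw [h3, h4, ← h2]
    noncomm_ring
  rw [e, norm_neg, mul_add]
  refine (norm_add_le _ _).trans ?_
  rw [add_comm]
  refine add_le_add ?_ ?_
  · refine (norm_mul_le _ _).trans ?_
    rw [mul_comm]
    exact mul_le_mul_of_nonneg_left (h.bound k t) (norm_nonneg _)
  · refine (norm_mul_le _ _).trans ((mul_le_of_le_one_right (norm_nonneg _)
      (S.norm_J_le N)).trans ((norm_mul_le _ _).trans ?_))
    exact mul_le_mul_of_nonneg_left (h.bound (k + 1) t) (norm_nonneg _)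

variable [CompleteSpace H]

theorem exists_approxEvol (k N : ℕ) : ∃ U, IsBoundedEvolution (approx S K k N) U := by
  have hb : ∀ t, ‖approx S K k N t‖ ≤ (‖S.J N‖₊ * M k * ‖S.Q N‖₊ : NNReal) := fun t => by
    push_cast
    refine (norm_mul_le _ _).trans (mul_le_mul_of_nonneg_right ((norm_mul_le _ _).trans ?_)
      (norm_nonneg _))
    exact mul_le_mul_of_nonneg_left (h.bound k t) (norm_nonneg _)
  obtain ⟨U, h1, h2, h3, h4⟩ := exists_bounded_evolution
    ((continuous_const.mul (h.continuous k)).mul continuous_const) hb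
  exact ⟨U, h1, h2, h3, h4⟩

/-- The evolution system of the bounded approximations. -/
def approxEvol (k N : ℕ) : ℝ → ℝ → H →L[ℂ] H := (h.exists_approxEvol k N).choose

theorem isBoundedEvolution (k N : ℕ) :
    IsBoundedEvolution (approx S K k N) (h.approxEvol k N) := (h.exists_approxEvol k N).choose_spec

theorem norm_approxEvol_le (k N : ℕ) {t s : ℝ} (hst : s ≤ t) :
    ‖h.approxEvol k N t s‖ ≤ exp (κ k * (t - s)) :=
  (h.isBoundedEvolution k N).norm_le (h.dissipative_approx k N) hst

theorem approxEvol_intertwine (k N : ℕ) {t s : ℝ} (hst : s ≤ t) (x : H) :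
    S.R (h.approxEvol (k + 1) N t s x) = h.approxEvol k N t s (S.R x) :=
  (h.isBoundedEvolution k N).comp_eq (h.isBoundedEvolution (k + 1) N) S.R
    (h.approx_intertwine k N) hst x

/-- Duhamel's formula with `B = 1`. By intertwining, an orbit starting at `R² y` is `R²` of the
orbit of `y` at level `k + 2`, whose growth is bounded uniformly in `N'`, so the error of the
generators is small along the whole orbit. -/
theorem norm_approxEvol_sub_le (k N N' : ℕ) {t s : ℝ} (hst : s ≤ t) (y : H) :
    ‖h.approxEvol k N' t s (S.R (S.R y)) - h.approxEvol k N t s (S.R (S.R y))‖ ≤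
      exp (κ k * (t - s)) * ((‖(1 - S.J N') * S.R‖ + ‖(1 - S.J N) * S.R‖) *
        (M k + M (k + 1)) * (exp (κ (k + 2) * (t - s)) * ‖y‖)) * (t - s) := by
  have h0 := (h.isBoundedEvolution k N).norm_comp_sub_le (h.isBoundedEvolution k N') 1 hst
    (S.R (S.R y)) (C := exp (κ k * (t - s)) * ((‖(1 - S.J N') * S.R‖ + ‖(1 - S.J N) * S.R‖) *
        (M k + M (k + 1)) * (exp (κ (k + 2) * (t - s)) * ‖y‖))) ?_
  · simpa using h0
  intro r hr
  set z := h.approxEvol (k + 2) N' r s y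
  have hz : ‖z‖ ≤ exp (κ (k + 2) * (t - s)) * ‖y‖ := by
    refine (ContinuousLinearMap.le_opNorm _ _).trans (mul_le_mul_of_nonneg_right
      ((h.norm_approxEvol_le _ _ hr.1).trans (exp_le_exp.2 ?_)) (norm_nonneg _))
    exact mul_le_mul_of_nonneg_left (by linarith [hr.2]) (h.growth_nonneg _)
  have hzR : h.approxEvol k N' r s (S.R (S.R y)) = S.R (S.R z) := by
    rw [← h.approxEvol_intertwine k N' hr.1, ← h.approxEvol_intertwine (k + 1) N' hr.1]
  rw [hzR]
  have e : (1 * approx S K k N' r - approx S K k N r * 1) (S.R (S.R z)) =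
      ((approx S K k N' r * S.R - K k r) * S.R) z - ((approx S K k N r * S.R - K k r) * S.R) z := by
    simp
  rw [e]
  refine (ContinuousLinearMap.le_opNorm _ _).trans (mul_le_mul
    ((h.norm_approxEvol_le _ _ hr.2).trans (exp_le_exp.2 ?_)) ?_ (norm_nonneg _) (exp_pos _).le)
  · exact mul_le_mul_of_nonneg_left (by linarith [hr.1]) (h.growth_nonneg _)
  · refine (norm_sub_le _ _).trans ?_
    rw [add_mul, add_mul]
    refine add_le_add ?_ ?_ <;>
    exact (ContinuousLinearMap.le_opNorm _ _).trans
      (mul_le_mul (h.norm_approx_sub_le _ _ _) hz (norm_nonneg _) (by positivity))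

end IsDissipativeFamily

end VirasoroEvolution

end

/-! ### The limit evolution system and its integral equations -/

noncomputable section

namespace VirasoroEvolution

variable {H : Type*} [NormedAddCommGroup H] [InnerProductSpace ℂ H]

namespace IsDissipativeFamily

variable {S : RegularizedScale H} {K : ℕ → ℝ → H →L[ℂ] H} {κ : ℕ → ℝ} {M : ℕ → NNReal}
  [CompleteSpace H] (h : IsDissipativeFamily S K κ M)
include h

/-- An `ε/3` argument from the dense range of `R²`. Replacing the final time by `max p.1 p.2`
extends everything by the identity to times below the diagonal, so that uniformity on full squares
yields joint continuity without boundary cases. -/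
theorem uniformCauchySeqOn (k : ℕ) (T : ℝ) (x : H) :
    UniformCauchySeqOn (fun N (p : ℝ × ℝ) => h.approxEvol k N (max p.1 p.2) p.2 x) atTop
      (Icc (-T) T ×ˢ Icc (-T) T) := by
  rw [Metric.uniformCauchySeqOn_iff]
  intro ε hε
  set C := exp (κ k * (2 * T))
  have hC : 0 < C := exp_pos _
  obtain ⟨y, hy⟩ := S.dense_mul.exists_dist_lt x (show 0 < ε / (3 * C) by positivity)
  have h1 : Tendsto (fun N => C * (‖(1 - S.J N) * S.R‖ * (M k + M (k + 1)) *
      (exp (κ (k + 2) * (2 * T)) * ‖y‖)) * (2 * T)) atTop (𝓝 0) := by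
    simpa using (((S.tendsto_zero.mul_const ((M k + M (k + 1) : ℝ))).mul_const
      (exp (κ (k + 2) * (2 * T)) * ‖y‖)).const_mul C).mul_const (2 * T)
  obtain ⟨N₀, hN₀⟩ := (h1.eventually_lt_const (show 0 < ε / 6 by positivity)).exists_forall_of_atTop
  refine ⟨N₀, fun m hm n hn p hp => ?_⟩
  have hp1 : p.2 ≤ max p.1 p.2 := le_max_right _ _
  have hp2 : max p.1 p.2 - p.2 ≤ 2 * T := by
    have := max_le hp.1.2 hp.2.2
    linarith [hp.2.1]
  have hp3 : 0 ≤ max p.1 p.2 - p.2 := sub_nonneg.2 hp1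
  have hexp : ∀ j, exp (κ j * (max p.1 p.2 - p.2)) ≤ exp (κ j * (2 * T)) := fun j =>
    exp_le_exp.2 (mul_le_mul_of_nonneg_left hp2 (h.growth_nonneg j))
  have hU : ∀ N z, ‖h.approxEvol k N (max p.1 p.2) p.2 z‖ ≤ C * ‖z‖ := fun N z =>
    (ContinuousLinearMap.le_opNorm _ _).trans (mul_le_mul_of_nonneg_right
      ((h.norm_approxEvol_le k N hp1).trans (hexp k)) (norm_nonneg _))
  have h2 := h.norm_approxEvol_sub_le k n m hp1 y
  have h3 : exp (κ k * (max p.1 p.2 - p.2)) * ((‖(1 - S.J m) * S.R‖ + ‖(1 - S.J n) * S.R‖) *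
        (M k + M (k + 1)) * (exp (κ (k + 2) * (max p.1 p.2 - p.2)) * ‖y‖)) *
        (max p.1 p.2 - p.2) ≤ C * ((‖(1 - S.J m) * S.R‖ + ‖(1 - S.J n) * S.R‖) *
        (M k + M (k + 1)) * (exp (κ (k + 2) * (2 * T)) * ‖y‖)) * (2 * T) := by
    have ha := hexp k
    have hb := hexp (k + 2)
    have hc : (0 : ℝ) ≤ M k + M (k + 1) := by positivity
    gcongr
  have h4 := hU m (x - S.R (S.R y))
  have h5 := hU n (x - S.R (S.R y))
  rw [dist_eq_norm] at hy ⊢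
  have h6 : C * ‖x - S.R (S.R y)‖ < ε / 3 := by
    rw [lt_div_iff₀ (by positivity)] at hy ⊢
    linarith
  have h7 := hN₀ m hm
  have h8 := hN₀ n hn
  rw [map_sub] at h4 h5
  have h9 := norm_add₃_le
    (a := h.approxEvol k m (max p.1 p.2) p.2 x - h.approxEvol k m (max p.1 p.2) p.2 (S.R (S.R y)))
    (b := h.approxEvol k m (max p.1 p.2) p.2 (S.R (S.R y)) -
      h.approxEvol k n (max p.1 p.2) p.2 (S.R (S.R y)))
    (c := -(h.approxEvol k n (max p.1 p.2) p.2 x -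
      h.approxEvol k n (max p.1 p.2) p.2 (S.R (S.R y))))
  rw [norm_neg] at h9
  have e : h.approxEvol k m (max p.1 p.2) p.2 x - h.approxEvol k n (max p.1 p.2) p.2 x =
    (h.approxEvol k m (max p.1 p.2) p.2 x - h.approxEvol k m (max p.1 p.2) p.2 (S.R (S.R y))) +
    (h.approxEvol k m (max p.1 p.2) p.2 (S.R (S.R y)) -
      h.approxEvol k n (max p.1 p.2) p.2 (S.R (S.R y))) +
    -(h.approxEvol k n (max p.1 p.2) p.2 x -
      h.approxEvol k n (max p.1 p.2) p.2 (S.R (S.R y))) := by abel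
  rw [e]
  linarith

theorem exists_tendsto (k : ℕ) (p : ℝ × ℝ) (x : H) :
    ∃ y, Tendsto (fun N => h.approxEvol k N (max p.1 p.2) p.2 x) atTop (𝓝 y) := by
  exact cauchySeq_tendsto_of_complete ((h.uniformCauchySeqOn k (max |p.1| |p.2|) x).cauchySeq
    ⟨abs_le.1 (le_max_left _ _), abs_le.1 (le_max_right _ _)⟩)

/-- The evolution system of the family of (unbounded) operators `Λ ^ k A(t) Λ ^ (-k)`. -/
def evol (k : ℕ) (t s : ℝ) : H →L[ℂ] H :=
  continuousLinearMapOfTendsto (fun N => h.approxEvol k N (max t s) s)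
    (f := fun x => (h.exists_tendsto k (t, s) x).choose)
    (tendsto_pi_nhds.2 fun x => (h.exists_tendsto k (t, s) x).choose_spec)

theorem tendsto_evol' (k : ℕ) (t s : ℝ) (x : H) :
    Tendsto (fun N => h.approxEvol k N (max t s) s x) atTop (𝓝 (h.evol k t s x)) :=
  (h.exists_tendsto k (t, s) x).choose_spec

attribute [irreducible] evol

theorem tendsto_evol (k : ℕ) {t s : ℝ} (hst : s ≤ t) (x : H) :
    Tendsto (fun N => h.approxEvol k N t s x) atTop (𝓝 (h.evol k t s x)) := by
  simpa [max_eq_left hst] using h.tendsto_evol' k t s x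

theorem continuous_evol (k : ℕ) (x : H) :
    Continuous fun p : ℝ × ℝ => h.evol k p.1 p.2 x := by
  rw [continuous_iff_continuousAt]
  intro p
  set T := max |p.1| |p.2| + 1
  have hT1 : |p.1| < T := (le_max_left _ _).trans_lt (lt_add_one _)
  have hT2 : |p.2| < T := (le_max_right _ _).trans_lt (lt_add_one _)
  have h1 := (h.uniformCauchySeqOn k T x).tendstoUniformlyOn_of_tendsto
    (f := fun p : ℝ × ℝ => h.evol k p.1 p.2 x) fun p _ => h.tendsto_evol' k p.1 p.2 x
  have h2 := h1.continuousOn (.of_forall fun N => by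
    have := ((h.isBoundedEvolution k N).continuous.comp
      ((continuous_fst.max continuous_snd).prodMk continuous_snd :
        Continuous fun p : ℝ × ℝ => (max p.1 p.2, p.2)))
    exact (this.clm_apply continuous_const).continuousOn)
  exact h2.continuousAt (prod_mem_nhds (Icc_mem_nhds (abs_lt.1 hT1).1 (abs_lt.1 hT1).2)
    (Icc_mem_nhds (abs_lt.1 hT2).1 (abs_lt.1 hT2).2))

theorem continuous_evol_comp {X : Type*} [TopologicalSpace X] (k : ℕ) (x : H) {f g : X → ℝ}
    (hf : Continuous f) (hg : Continuous g) : Continuous fun r => h.evol k (f r) (g r) x :=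
  (h.continuous_evol k x).comp (hf.prodMk hg)

theorem norm_evol_apply_le (k : ℕ) {t s : ℝ} (hst : s ≤ t) (x : H) :
    ‖h.evol k t s x‖ ≤ exp (κ k * (t - s)) * ‖x‖ :=
  le_of_tendsto (h.tendsto_evol k hst x).norm (.of_forall fun N =>
    (ContinuousLinearMap.le_opNorm _ _).trans (mul_le_mul_of_nonneg_right
      (h.norm_approxEvol_le k N hst) (norm_nonneg _)))

theorem norm_evol_le (k : ℕ) {t s : ℝ} (hst : s ≤ t) :
    ‖h.evol k t s‖ ≤ exp (κ k * (t - s)) :=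
  ContinuousLinearMap.opNorm_le_bound _ (exp_pos _).le (h.norm_evol_apply_le k hst)

theorem evol_self (k : ℕ) (s : ℝ) : h.evol k s s = 1 := by
  ext x
  refine tendsto_nhds_unique (h.tendsto_evol k le_rfl x) ?_
  simp [(h.isBoundedEvolution k _).refl]

theorem tendsto_evol_apply (k : ℕ) {t s : ℝ} (hst : s ≤ t) {y : ℕ → H} {y₀ : H}
    (hy : Tendsto y atTop (𝓝 y₀)) :
    Tendsto (fun N => h.approxEvol k N t s (y N)) atTop (𝓝 (h.evol k t s y₀)) :=
  tendsto_apply_of_norm_le (fun N => h.norm_approxEvol_le k N hst) (h.tendsto_evol k hst y₀) hy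

theorem evol_trans (k : ℕ) {t r s : ℝ} (hsr : s ≤ r) (hrt : r ≤ t) (x : H) :
    h.evol k t r (h.evol k r s x) = h.evol k t s x := by
  refine tendsto_nhds_unique (h.tendsto_evol_apply k hrt (h.tendsto_evol k hsr x)) ?_
  simpa only [(h.isBoundedEvolution k _).trans] using h.tendsto_evol k (hsr.trans hrt) x

theorem evol_intertwine (k : ℕ) {t s : ℝ} (hst : s ≤ t) (x : H) :
    S.R (h.evol (k + 1) t s x) = h.evol k t s (S.R x) := by
  refine tendsto_nhds_unique ((S.R.continuous.tendsto _).comp (h.tendsto_evol (k + 1) hst x)) ?_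
  simpa only [Function.comp_def, h.approxEvol_intertwine k _ hst] using h.tendsto_evol k hst (S.R x)

/-- The differential equation is passed to the limit in integrated form, by dominated convergence.
The domination comes from writing the approximate orbit of `R v` as `R` of the orbit of `v` at level
`k + 1`, where the generators are bounded uniformly in `N`. -/
theorem evol_R_sub_eq_integral_forward (k : ℕ) {t s : ℝ} (hst : s ≤ t) (v : H) :
    h.evol k t s (S.R v) - S.R v = ∫ r in s..t, K k r (h.evol (k + 1) r s v) := by
  have h1 : ∀ N, h.approxEvol k N t s (S.R v) - S.R v =
      ∫ r in s..t, approx S K k N r (h.approxEvol k N r s (S.R v)) := fun N => by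
    have hd : ∀ r, HasDerivAt (fun r => h.approxEvol k N r s (S.R v))
        (approx S K k N r (h.approxEvol k N r s (S.R v))) r := fun r =>
      ((h.isBoundedEvolution k N).forward r s).apply_const _
    have hc : Continuous fun r => approx S K k N r (h.approxEvol k N r s (S.R v)) :=
      ((continuous_const.mul (h.continuous k)).mul continuous_const).clm_apply
        (continuous_iff_continuousAt.2 fun r => (hd r).continuousAt)
    rw [intervalIntegral.integral_eq_sub_of_hasDerivAt (fun r _ => hd r) (hc.intervalIntegrable _ _),
      (h.isBoundedEvolution k N).refl]
    rfl
  refine tendsto_nhds_unique ((h.tendsto_evol k hst (S.R v)).sub_const (S.R v)) ?_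
  simp only [h1]
  refine intervalIntegral.tendsto_integral_filter_of_dominated_convergence
    (fun _ => M k * (exp (κ (k + 1) * (t - s)) * ‖v‖)) ?_ ?_ intervalIntegrable_const ?_
  · refine .of_forall fun N => ?_
    have hd : Continuous fun r => h.approxEvol k N r s :=
      (h.isBoundedEvolution k N).continuous.comp (continuous_id.prodMk continuous_const)
    exact (((continuous_const.mul (h.continuous k)).mul continuous_const).clm_apply
      (hd.clm_apply continuous_const)).aestronglyMeasurable
  · refine .of_forall fun N => .of_forall fun r hr => ?_
    rw [uIoc_of_le hst] at hr
    rw [← h.approxEvol_intertwine k N hr.1.le]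
    refine (h.norm_approx_R_le k N r _).trans (mul_le_mul_of_nonneg_left ?_ (M k).2)
    refine (ContinuousLinearMap.le_opNorm _ _).trans (mul_le_mul_of_nonneg_right
      ((h.norm_approxEvol_le _ _ hr.1.le).trans (exp_le_exp.2 ?_)) (norm_nonneg _))
    exact mul_le_mul_of_nonneg_left (by linarith [hr.2]) (h.growth_nonneg _)
  · refine .of_forall fun r hr => ?_
    rw [uIoc_of_le hst] at hr
    simp only [← h.approxEvol_intertwine k _ hr.1.le]
    exact tendsto_approx_R k r (h.tendsto_evol (k + 1) hr.1.le v)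

theorem evol_R_sub_eq_integral_backward (k : ℕ) {t s : ℝ} (hst : s ≤ t) (v : H) :
    h.evol k t s (S.R v) - S.R v = ∫ r in s..t, h.evol k t r (K k r v) := by
  have hU : ∀ N, Continuous fun r => h.approxEvol k N t r := fun N =>
    (h.isBoundedEvolution k N).continuous.comp (continuous_const.prodMk continuous_id)
  have hA : ∀ N, Continuous fun r => approx S K k N r := fun N =>
    ((continuous_const.mul (h.continuous k)).mul continuous_const)
  have h1 : ∀ N, h.approxEvol k N t s (S.R v) - S.R v =
      ∫ r in s..t, h.approxEvol k N t r (approx S K k N r (S.R v)) := fun N => by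
    have hd : ∀ r, HasDerivAt (fun r => h.approxEvol k N t r (S.R v))
        (-(h.approxEvol k N t r (approx S K k N r (S.R v)))) r := fun r =>
      ((h.isBoundedEvolution k N).backward t r).apply_const _
    have hc : Continuous fun r => -(h.approxEvol k N t r (approx S K k N r (S.R v))) :=
      ((hU N).clm_apply ((hA N).clm_apply continuous_const)).neg
    have := intervalIntegral.integral_eq_sub_of_hasDerivAt (a := s) (b := t)
      (fun r _ => hd r) (hc.intervalIntegrable _ _)
    rw [(h.isBoundedEvolution k N).refl, intervalIntegral.integral_neg] at this
    rw [← neg_neg (∫ r in s..t, h.approxEvol k N t r (approx S K k N r (S.R v))), this, neg_sub]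
    rfl
  refine tendsto_nhds_unique ((h.tendsto_evol k hst (S.R v)).sub_const (S.R v)) ?_
  simp only [h1]
  refine intervalIntegral.tendsto_integral_filter_of_dominated_convergence
    (fun _ => exp (κ k * (t - s)) * (M k * ‖v‖)) ?_ ?_ intervalIntegrable_const ?_
  · exact .of_forall fun N =>
      ((hU N).clm_apply ((hA N).clm_apply continuous_const)).aestronglyMeasurable
  · refine .of_forall fun N => .of_forall fun r hr => ?_
    rw [uIoc_of_le hst] at hr
    refine (ContinuousLinearMap.le_opNorm _ _).trans (mul_le_mul ((h.norm_approxEvol_le _ _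
      hr.2).trans (exp_le_exp.2 ?_)) (h.norm_approx_R_le k N r v) (norm_nonneg _) (exp_pos _).le)
    exact mul_le_mul_of_nonneg_left (by linarith [hr.1]) (h.growth_nonneg _)
  · refine .of_forall fun r hr => ?_
    rw [uIoc_of_le hst] at hr
    exact h.tendsto_evol_apply k hr.2 (tendsto_approx_R k r tendsto_const_nhds)

end IsDissipativeFamily

end VirasoroEvolution

end

/-! ### Differential equations, uniqueness, and generators in the autonomous case -/

noncomputable section

namespace VirasoroEvolution

variable {H : Type*} [NormedAddCommGroup H] [InnerProductSpace ℂ H]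

namespace IsDissipativeFamily

section Derivatives

variable {S : RegularizedScale H} {K : ℕ → ℝ → H →L[ℂ] H} {κ : ℕ → ℝ} {M : ℕ → NNReal}
  [CompleteSpace H] (h : IsDissipativeFamily S K κ M)
include h

theorem continuous_evol_left (k : ℕ) (s : ℝ) (x : H) : Continuous fun r => h.evol k r s x :=
  h.continuous_evol_comp k x continuous_id continuous_const

theorem continuous_K_evol (k j : ℕ) (s : ℝ) (v : H) :
    Continuous fun r => K k r (h.evol j r s v) :=
  (h.continuous k).clm_apply (h.continuous_evol_comp j v continuous_id continuous_const)

theorem continuousOn_evol_K (k : ℕ) (t : ℝ) (v : H) :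
    ContinuousOn (fun r => h.evol k t r (K k r v)) (Iic t) := by
  intro r hr
  rw [ContinuousWithinAt, tendsto_iff_norm_sub_tendsto_zero]
  have h1 : Tendsto (fun r' => exp (κ k * (t - r')) * ‖K k r' v - K k r v‖ +
      ‖h.evol k t r' (K k r v) - h.evol k t r (K k r v)‖) (𝓝[Iic t] r) (𝓝 0) := by
    have h2 : Continuous fun r' => exp (κ k * (t - r')) * ‖K k r' v - K k r v‖ +
        ‖h.evol k t r' (K k r v) - h.evol k t r (K k r v)‖ := by
      have h3 : Continuous fun r' => K k r' v := (h.continuous k).clm_apply continuous_const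
      have h4 := h.continuous_evol_comp k (K k r v) (continuous_const (y := t)) continuous_id
      exact ((by fun_prop : Continuous fun r' => exp (κ k * (t - r'))).mul
        (h3.sub continuous_const).norm).add (h4.sub continuous_const).norm
    simpa using (h2.tendsto r).mono_left nhdsWithin_le_nhds
  refine squeeze_zero' (.of_forall fun _ => norm_nonneg _) ?_ h1
  filter_upwards [self_mem_nhdsWithin] with r' hr'
  have h5 := norm_add_le (h.evol k t r' (K k r' v - K k r v))
    (h.evol k t r' (K k r v) - h.evol k t r (K k r v))
  have h6 := h.norm_evol_apply_le k hr' (K k r' v - K k r v)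
  have e : h.evol k t r' (K k r' v) - h.evol k t r (K k r v) =
    h.evol k t r' (K k r' v - K k r v) + (h.evol k t r' (K k r v) - h.evol k t r (K k r v)) := by
    rw [map_sub]; abel
  rw [e]
  linarith

theorem hasDerivWithinAt_evol_forward (k : ℕ) {t s : ℝ} (hst : s ≤ t) (v : H) :
    HasDerivWithinAt (fun t' => h.evol k t' s (S.R v)) (K k t (h.evol (k + 1) t s v))
      (Ici s) t := by
  have hc := h.continuous_K_evol k (k + 1) s v
  have h1 : HasDerivAt (fun t' => S.R v + ∫ r in s..t', K k r (h.evol (k + 1) r s v))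
      (K k t (h.evol (k + 1) t s v)) t :=
    (intervalIntegral.integral_hasDerivAt_right (hc.intervalIntegrable _ _)
      (hc.stronglyMeasurableAtFilter _ _) hc.continuousAt).const_add _
  have e : ∀ t' ∈ Ici s, h.evol k t' s (S.R v) =
      S.R v + ∫ r in s..t', K k r (h.evol (k + 1) r s v) := fun t' ht' => by
    rw [← h.evol_R_sub_eq_integral_forward k ht']; abel
  exact h1.hasDerivWithinAt.congr e (e t hst)

theorem hasDerivWithinAt_evol_backward (k : ℕ) {t s : ℝ} (hst : s ≤ t) (v : H) :
    HasDerivWithinAt (fun s' => h.evol k t s' (S.R v)) (-(h.evol k t s (K k s v)))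
      (Iic t) s := by
  -- The truncation makes the integrand continuous on all of `ℝ`, so that the fundamental theorem of
  -- calculus also applies at the endpoint `s = t`; for times at most `t` it changes nothing.
  set g : ℝ → H := fun r => h.evol k t (min r t) (K k (min r t) v)
  have hc : Continuous g :=
    (h.continuousOn_evol_K k t v).comp_continuous (continuous_id.min continuous_const)
      fun r => min_le_right r t
  have h1 : HasDerivAt (fun s' => S.R v + ∫ r in s'..t, g r) (-(g s)) s :=
    (intervalIntegral.integral_hasDerivAt_left (hc.intervalIntegrable _ _)
      (hc.stronglyMeasurableAtFilter _ _) hc.continuousAt).const_add _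
  have e : ∀ s' ∈ Iic t, h.evol k t s' (S.R v) = S.R v + ∫ r in s'..t, g r := fun s' hs' => by
    have h2 : ∫ r in s'..t, g r = ∫ r in s'..t, h.evol k t r (K k r v) :=
      intervalIntegral.integral_congr fun r hr => by
        rw [uIcc_of_le hs'] at hr
        simp only [g, min_eq_left hr.2]
    rw [h2, ← h.evol_R_sub_eq_integral_backward k hs']; abel
  have h3 := h1.hasDerivWithinAt.congr e (e s hst)
  simpa only [g, min_eq_left hst] using h3

/-- Uniqueness: a strongly continuous solution `V` of the backward equation is given by
the evolution system. -/
theorem evol_unique {F : Type*} [NormedAddCommGroup F] [NormedSpace ℂ F] {V : ℝ → H →L[ℂ] F}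
    {t s C : ℝ} (hst : s ≤ t) (k : ℕ) (hC : ∀ r ∈ Icc s t, ‖V r‖ ≤ C)
    (hcont : ∀ x, ContinuousOn (fun r => V r x) (Icc s t))
    (hV : ∀ v, ∀ r ∈ Icc s t, HasDerivWithinAt (fun r => V r (S.R v)) (-(V r (K k r v)))
      (Icc s t) r) (x : H) : V s x = V t (h.evol k t s x) := by
  have key : ∀ v, V s (S.R v) = V t (h.evol k t s (S.R v)) := by
    intro v
    -- The orbit of `R v` is `R` of the orbit at level `k + 1`, so the backward equation applies to
    -- it at every time, and its contribution cancels that of the forward equation.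
    have hd : ∀ r ∈ Icc s t, HasDerivWithinAt (fun r => V r (h.evol k r s (S.R v))) 0
        (Icc s t) r := fun r hr => by
      have h1 := hV (h.evol (k + 1) r s v) r hr
      rw [h.evol_intertwine k hr.1] at h1
      have h2 := hasDerivWithinAt_apply_of_norm_le hC
        ((h.hasDerivWithinAt_evol_forward k hr.1 v).mono Icc_subset_Ici_self) (hcont _ r hr) h1
      rwa [add_neg_cancel] at h2
    have h3 := constant_of_has_deriv_right_zero (fun r hr => (hd r hr).continuousWithinAt)
      (fun r hr => (hd r (Ico_subset_Icc_self hr)).mono_of_mem_nhdsWithin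
        (Icc_mem_nhdsGE_of_mem hr)) t (right_mem_Icc.2 hst)
    rw [h3, h.evol_self]
    rfl
  have := S.dense.equalizer (g := V s) (h := fun x => V t (h.evol k t s x)) (V s).continuous
    ((V t).continuous.comp (h.evol k t s).continuous) (funext key)
  exact congrFun this x

end Derivatives

section Autonomous

variable {S : RegularizedScale H} {K : ℕ → H →L[ℂ] H} {κ : ℕ → ℝ} {M : ℕ → NNReal}
  [CompleteSpace H] (h : IsDissipativeFamily S (fun k _ => K k) κ M)
include h

/-- The translated evolution solves the same backward equation, since the generator does not depend
on time; uniqueness does the rest. -/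
theorem evol_add_right (k : ℕ) {s t : ℝ} (hs : 0 ≤ s) (x : H) :
    h.evol k (s + t) t x = h.evol k s 0 x := by
  have h1 := h.evol_unique (V := fun r => h.evol k (s + t) (r + t)) (C := exp (κ k * s)) hs k
    (fun r hr => (h.norm_evol_le k (by linarith [hr.2])).trans (exp_le_exp.2
      (mul_le_mul_of_nonneg_left (by linarith [hr.1]) (h.growth_nonneg k))))
    (fun x => (h.continuous_evol_comp k x continuous_const
      (continuous_id.add continuous_const)).continuousOn)
    (fun v r hr => by
      have h2 := h.hasDerivWithinAt_evol_backward k (t := s + t) (s := r + t)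
        (by linarith [hr.2]) v
      have h3 := h2.scomp r (((hasDerivAt_id r).add_const t).hasDerivWithinAt (s := Icc 0 s))
        (fun r' hr' => by simp only [mem_Iic, id]; linarith [hr'.2])
      exact h3.congr_deriv (by simp)) x
  simpa [h.evol_self] using h1

theorem evol_add (k : ℕ) {s t : ℝ} (hs : 0 ≤ s) (ht : 0 ≤ t) :
    h.evol k (s + t) 0 = h.evol k s 0 * h.evol k t 0 := by
  ext x
  rw [← h.evol_trans k ht (by linarith : t ≤ s + t), h.evol_add_right k hs]
  rfl

theorem isC0Semigroup (k : ℕ) : IsC0Semigroup fun t => h.evol k t 0 where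
  zero := h.evol_self k 0
  add s t hs ht := h.evol_add k hs ht
  continuous x := by
    have h1 := (h.continuous_evol_left k 0 x).tendsto 0
    simp only [h.evol_self] at h1
    exact h1.mono_left nhdsWithin_le_nhds

/-- The graph of the generator of the semigroup, as the closure of the graph of `K k R⁻¹`. -/
theorem evol_sub_eq_integral_of_mem_closure (k : ℕ) {x y : H}
    (hxy : (x, y) ∈ closure (range fun v => (S.R v, K k v))) {s : ℝ} (hs : 0 ≤ s) :
    h.evol k s 0 x - x = ∫ r in (0 : ℝ)..s, h.evol k r 0 y := by
  obtain ⟨p, hp, hlim⟩ := mem_closure_iff_seq_limit.1 hxy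
  choose v hv using hp
  have h1 : ∀ n, h.evol k s 0 (p n).1 - (p n).1 = ∫ r in (0 : ℝ)..s, h.evol k r 0 (p n).2 := by
    intro n
    rw [← hv n, h.evol_R_sub_eq_integral_backward k hs]
    have h2 := intervalIntegral.integral_comp_sub_left (a := 0) (b := s)
      (fun r => h.evol k r 0 (K k (v n))) s
    rw [sub_self, sub_zero] at h2
    rw [← h2]
    refine intervalIntegral.integral_congr fun r hr => ?_
    rw [uIcc_of_le hs] at hr
    have h3 := h.evol_add_right k (s := s - r) (t := r) (by linarith [hr.2]) (K k (v n))
    simpa using h3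
  have hx : Tendsto (fun n => (p n).1) atTop (𝓝 x) := (continuous_fst.tendsto _).comp hlim
  have hy : Tendsto (fun n => (p n).2) atTop (𝓝 y) := (continuous_snd.tendsto _).comp hlim
  refine tendsto_nhds_unique ((((h.evol k s 0).continuous.tendsto x).comp hx).sub hx) ?_
  simp only [Function.comp_def, h1]
  obtain ⟨B, hB⟩ := (Metric.isBounded_range_of_tendsto _ hy).exists_norm_le
  refine intervalIntegral.tendsto_integral_filter_of_dominated_convergence
    (fun _ => exp (κ k * s) * B) ?_ ?_ intervalIntegrable_const ?_
  · exact .of_forall fun n => (h.continuous_evol_left k 0 _).aestronglyMeasurable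
  · refine .of_forall fun n => .of_forall fun r hr => ?_
    rw [uIoc_of_le hs] at hr
    refine (h.norm_evol_apply_le k hr.1.le _).trans (mul_le_mul (exp_le_exp.2 ?_)
      (hB _ (mem_range_self n)) (norm_nonneg _) (exp_pos _).le)
    exact mul_le_mul_of_nonneg_left (by linarith [hr.2]) (h.growth_nonneg _)
  · exact .of_forall fun r _ => ((h.evol k r 0).continuous.tendsto y).comp hy

theorem tendsto_of_evol_sub_eq_integral (k : ℕ) {x y : H}
    (hxy : ∀ s : ℝ, 0 ≤ s → h.evol k s 0 x - x = ∫ r in (0 : ℝ)..s, h.evol k r 0 y) :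
    Tendsto (fun t : ℝ => t⁻¹ • (h.evol k t 0 x - x)) (𝓝[>] 0) (𝓝 y) := by
  have hc := h.continuous_evol_left k 0 y
  have h1 : HasDerivAt (fun t => ∫ r in (0 : ℝ)..t, h.evol k r 0 y) (h.evol k 0 0 y) 0 :=
    intervalIntegral.integral_hasDerivAt_right (hc.intervalIntegrable _ _)
      (hc.stronglyMeasurableAtFilter _ _) hc.continuousAt
  rw [h.evol_self] at h1
  have h2 := h1.tendsto_slope_zero_right
  simp only [zero_add, intervalIntegral.integral_same, sub_zero] at h2
  refine h2.congr' ?_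
  filter_upwards [self_mem_nhdsWithin] with t ht
  rw [hxy t (le_of_lt ht)]

/-- For `x = R u` the integral of the orbit is `R` of an integral at level `k + 1`, and the forward
integral equation computes its image. General `x` follows by density of the range of `R`. -/
theorem integral_evol_mem_closure (k : ℕ) (x : H) {s : ℝ} (hs : 0 ≤ s) :
    (∫ r in (0 : ℝ)..s, h.evol k r 0 x, h.evol k s 0 x - x) ∈
      closure (range fun v => (S.R v, K k v)) := by
  obtain ⟨u, hu⟩ : ∃ u : ℕ → H, Tendsto (fun n => S.R (u n)) atTop (𝓝 x) := by
    obtain ⟨p, hp, hlim⟩ := mem_closure_iff_seq_limit.1 (S.dense x)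
    choose u hu using hp
    exact ⟨u, by simpa only [hu] using hlim⟩
  obtain ⟨B, hB⟩ := (Metric.isBounded_range_of_tendsto _ hu).exists_norm_le
  have h1 : Tendsto (fun n => ∫ r in (0 : ℝ)..s, h.evol k r 0 (S.R (u n))) atTop
      (𝓝 (∫ r in (0 : ℝ)..s, h.evol k r 0 x)) := by
    refine intervalIntegral.tendsto_integral_filter_of_dominated_convergence
      (fun _ => exp (κ k * s) * B) ?_ ?_ intervalIntegrable_const ?_
    · exact .of_forall fun n => (h.continuous_evol_left k 0 _).aestronglyMeasurable
    · refine .of_forall fun n => .of_forall fun r hr => ?_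
      rw [uIoc_of_le hs] at hr
      refine (h.norm_evol_apply_le k hr.1.le _).trans (mul_le_mul (exp_le_exp.2 ?_)
        (hB _ (mem_range_self n)) (norm_nonneg _) (exp_pos _).le)
      exact mul_le_mul_of_nonneg_left (by linarith [hr.2]) (h.growth_nonneg _)
    · exact .of_forall fun r _ => ((h.evol k r 0).continuous.tendsto x).comp hu
  refine mem_closure_of_tendsto (h1.prodMk_nhds
    ((((h.evol k s 0).continuous.tendsto x).comp hu).sub hu)) (.of_forall fun n => ?_)
  have hc := h.continuous_evol_left (k + 1) 0 (u n)
  refine ⟨∫ r in (0 : ℝ)..s, h.evol (k + 1) r 0 (u n), ?_⟩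
  beta_reduce
  rw [← ContinuousLinearMap.intervalIntegral_comp_comm _ (hc.intervalIntegrable _ _),
    ← ContinuousLinearMap.intervalIntegral_comp_comm _ (hc.intervalIntegrable _ _)]
  refine Prod.ext ?_ ?_
  · refine intervalIntegral.integral_congr fun r hr => ?_
    rw [uIcc_of_le hs] at hr
    exact h.evol_intertwine k hr.1 _
  · exact (h.evol_R_sub_eq_integral_forward k hs _).symm

/-- The generator of the semigroup is the closure of `K k R⁻¹`. -/
theorem mem_closure_iff_tendsto (k : ℕ) (x y : H) :
    (x, y) ∈ closure (range fun v => (S.R v, K k v)) ↔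
      Tendsto (fun t : ℝ => t⁻¹ • (h.evol k t 0 x - x)) (𝓝[>] 0) (𝓝 y) := by
  refine ⟨fun hxy => h.tendsto_of_evol_sub_eq_integral k
    fun s hs => h.evol_sub_eq_integral_of_mem_closure k hxy hs, fun hxy => ?_⟩
  have hc := h.continuous_evol_left k 0 x
  have h1 : HasDerivAt (fun t => ∫ r in (0 : ℝ)..t, h.evol k r 0 x) (h.evol k 0 0 x) 0 :=
    intervalIntegral.integral_hasDerivAt_right (hc.intervalIntegrable _ _)
      (hc.stronglyMeasurableAtFilter _ _) hc.continuousAt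
  rw [h.evol_self] at h1
  have h2 := h1.tendsto_slope_zero_right
  simp only [zero_add, intervalIntegral.integral_same, sub_zero] at h2
  -- The pairs formed by the average of the orbit of `x` over `[0, t]` and the difference quotient
  -- at `t` lie in the closure, and they converge to `(x, y)` as `t ↘ 0`.
  rw [← closure_closure]
  refine mem_closure_of_tendsto (h2.prodMk_nhds hxy) ?_
  filter_upwards [self_mem_nhdsWithin] with t ht
  have h3 := h.integral_evol_mem_closure k x (le_of_lt ht)
  obtain ⟨p, hp, hlim⟩ := mem_closure_iff_seq_limit.1 h3
  choose v hv using hp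
  refine mem_closure_of_tendsto (hlim.const_smul t⁻¹) (.of_forall fun n => ⟨t⁻¹ • v n, ?_⟩)
  rw [← hv n]
  simp [ContinuousLinearMap.map_smul_of_tower]

end Autonomous

end IsDissipativeFamily

end VirasoroEvolution

end

/-! ### Passage between levels, and the abstract time-ordered exponential -/

noncomputable section

namespace VirasoroEvolution

variable {H : Type*} [NormedAddCommGroup H] [InnerProductSpace ℂ H]

theorem RegularizedScale.injective_pow (S : RegularizedScale H) (k : ℕ) :
    Function.Injective ⇑(S.R ^ k) := by
  induction k with
  | zero => exact fun x y hxy => hxy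
  | succ k ih =>
    rw [pow_succ]
    exact ih.comp S.injective

namespace IsDissipativeFamily

section Powers

variable {S : RegularizedScale H} {K : ℕ → ℝ → H →L[ℂ] H} {κ : ℕ → ℝ} {M : ℕ → NNReal}
  (h : IsDissipativeFamily S K κ M)
include h

theorem const (t : ℝ) : IsDissipativeFamily S (fun k _ => K k t) κ M where
  continuous _ := continuous_const
  bound k _ := h.bound k t
  intertwine k _ := h.intertwine k t
  growth_nonneg := h.growth_nonneg
  dissipative k _ := h.dissipative k t

theorem pow_intertwine (k : ℕ) (t : ℝ) : S.R ^ k * K k t = K 0 t * S.R ^ k := by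
  induction k with
  | zero => simp
  | succ k ih => rw [pow_succ, mul_assoc, h.intertwine, ← mul_assoc, ih, mul_assoc]

variable [CompleteSpace H]

theorem evol_pow_intertwine (k : ℕ) {t s : ℝ} (hst : s ≤ t) (x : H) :
    (S.R ^ k) (h.evol k t s x) = h.evol 0 t s ((S.R ^ k) x) := by
  induction k generalizing x with
  | zero => simp
  | succ k ih =>
    rw [pow_succ, ContinuousLinearMap.mul_def, ContinuousLinearMap.comp_apply,
      ContinuousLinearMap.comp_apply, h.evol_intertwine k hst, ih]

end Powers

/-- The generator at level `k` is the part of the generator at level `0`. If the pair lies in the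
level `0` graph, the integrated equation holds after applying `R ^ k` and is pulled back by
injectivity; the converse uses continuity of `R ^ k`. -/
theorem pow_mem_closure_iff_tendsto {S : RegularizedScale H} {K : ℕ → H →L[ℂ] H} {κ : ℕ → ℝ}
    {M : ℕ → NNReal} [CompleteSpace H] (h : IsDissipativeFamily S (fun k _ => K k) κ M) (k : ℕ)
    (x y : H) : ((S.R ^ k) x, (S.R ^ k) y) ∈ closure (range fun v => (S.R v, K 0 v)) ↔
      Tendsto (fun t : ℝ => t⁻¹ • (h.evol k t 0 x - x)) (𝓝[>] 0) (𝓝 y) := by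
  refine ⟨fun hxy => h.tendsto_of_evol_sub_eq_integral k fun s hs => ?_, fun hxy => ?_⟩
  · refine S.injective_pow k ?_
    rw [← ContinuousLinearMap.intervalIntegral_comp_comm _
      ((h.continuous_evol_left k 0 y).intervalIntegrable _ _), map_sub,
      h.evol_pow_intertwine k hs, h.evol_sub_eq_integral_of_mem_closure 0 hxy hs]
    refine intervalIntegral.integral_congr fun r hr => ?_
    rw [uIcc_of_le hs] at hr
    exact (h.evol_pow_intertwine k hr.1 y).symm
  · rw [h.mem_closure_iff_tendsto 0]
    refine (((S.R ^ k).continuous.tendsto y).comp hxy).congr' ?_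
    filter_upwards [self_mem_nhdsWithin] with t ht
    rw [Function.comp_apply, ContinuousLinearMap.map_smul_of_tower, map_sub,
      h.evol_pow_intertwine k (le_of_lt ht)]

section Transport

variable {E Y : Type*} [NormedAddCommGroup E] [NormedSpace ℂ E]
  [NormedAddCommGroup Y] [NormedSpace ℂ Y]

/-- Transport of a bounded operator along an isometry. -/
def conj (Φ : E ≃ₗᵢ[ℂ] H) (T : H →L[ℂ] H) : E →L[ℂ] E :=
  (Φ.symm.toContinuousLinearEquiv : H →L[ℂ] E) ∘L T ∘L (Φ.toContinuousLinearEquiv : E →L[ℂ] H)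

theorem conj_apply (Φ : E ≃ₗᵢ[ℂ] H) (T : H →L[ℂ] H) (x : E) : conj Φ T x = Φ.symm (T (Φ x)) := rfl

theorem norm_conj_le (Φ : E ≃ₗᵢ[ℂ] H) {T : H →L[ℂ] H} {C : ℝ} (hC : 0 ≤ C) (hT : ‖T‖ ≤ C) :
    ‖conj Φ T‖ ≤ C :=
  ContinuousLinearMap.opNorm_le_bound _ hC fun x => by
    rw [conj_apply, LinearIsometryEquiv.norm_map]
    exact (T.le_of_opNorm_le hT _).trans_eq (by rw [LinearIsometryEquiv.norm_map])

variable {S : RegularizedScale H} {K : ℕ → ℝ → H →L[ℂ] H} {κ : ℕ → ℝ} {M : ℕ → NNReal}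
  [CompleteSpace H]

omit [CompleteSpace H] in
theorem isC0Semigroup_conj {T : ℝ → H →L[ℂ] H} (hT : IsC0Semigroup T) (Φ : E ≃ₗᵢ[ℂ] H) :
    IsC0Semigroup fun t => conj Φ (T t) where
  zero := by ext x; simp [conj_apply, hT.zero]
  add s t hs ht := by ext x; simp [conj_apply, hT.add s t hs ht]
  continuous x := by
    simpa [conj_apply, Function.comp_def] using (Φ.symm.continuous.tendsto _).comp (hT.continuous (Φ x))

/-- The isometries identify `E` and `Y` with two consecutive levels, the embedding becoming `R`.
Everything is then transported from `evol k` and `evol (k + 1)`, and the condition on the graph says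
that `A t` is the part of the level `0` generator. -/
theorem timeOrderedExponentialExists (h : IsDissipativeFamily S K κ M) (k : ℕ) (Φ : E ≃ₗᵢ[ℂ] H)
    (Ψ : Y ≃ₗᵢ[ℂ] H) (ι : Y →ₗ[ℂ] E) (hι : ∀ y, Φ (ι y) = S.R (Ψ y)) (A : ℝ → E →ₗ.[ℂ] E)
    (hA : ∀ t ∈ Icc (0 : ℝ) 1, ∀ x y, (x, y) ∈ (A t).graph ↔
      ((S.R ^ k) (Φ x), (S.R ^ k) (Φ y)) ∈ closure (range fun v => (S.R v, K 0 t v))) :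
    TimeOrderedExponentialExists ι A := by
  have hgraph : ∀ t ∈ Icc (0 : ℝ) 1, ∀ v, (Φ.symm (S.R v), Φ.symm (K k t v)) ∈ (A t).graph := by
    intro t ht v
    rw [hA t ht]
    refine subset_closure ⟨(S.R ^ k) v, ?_⟩
    have h1 := DFunLike.congr_fun (h.pow_intertwine k t) v
    have h2 := DFunLike.congr_fun ((Commute.refl S.R).pow_right k).eq v
    simp only [LinearIsometryEquiv.apply_symm_apply]
    exact Prod.ext h2 h1.symm
  have hι' : ∀ v, ι (Ψ.symm v) = Φ.symm (S.R v) := fun v => by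
    rw [LinearIsometryEquiv.eq_symm_apply, hι, LinearIsometryEquiv.apply_symm_apply]
  have hΦ : ∀ {f : ℝ → H} {f' : H} {s : Set ℝ} {r : ℝ}, HasDerivWithinAt f f' s r →
      HasDerivWithinAt (fun r => Φ.symm (f r)) (Φ.symm f') s r := fun hf =>
    (((Φ.symm.toContinuousLinearEquiv : H →L[ℂ] E).restrictScalars
      ℝ).hasFDerivAt.comp_hasDerivWithinAt _ hf)
  have hbound : HasGrowthBound (κ k) fun t s => conj Φ (h.evol k t s) := fun t s hts =>
    norm_conj_le Φ (exp_pos _).le (h.norm_evol_le k hts.2.1)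
  refine ⟨fun t s => conj Φ (h.evol k t s), ⟨⟨fun s _ => ?_, fun t r s _ hsr hrt _ => ?_,
    fun x => ?_⟩, ⟨κ k, h.growth_nonneg k, fun t ht => ?_, hbound⟩, fun v t s hts => ?_,
    fun v t s hts => ?_, fun v => ?_⟩, ?_⟩
  · ext x
    simp [conj_apply, h.evol_self]
  · ext x
    simp [conj_apply, h.evol_trans k hsr hrt]
  · exact (Φ.symm.continuous.comp (h.continuous_evol k (Φ x))).continuousOn
  · refine ⟨fun s => conj Φ ((h.const t).evol k s 0),
      isC0Semigroup_conj ((h.const t).isC0Semigroup k) Φ, fun x y => ?_, fun s hs =>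
      norm_conj_le Φ (exp_pos _).le (by simpa using (h.const t).norm_evol_le k hs)⟩
    rw [hA t ht, (h.const t).pow_mem_closure_iff_tendsto k]
    have e : ∀ s : ℝ, Φ.symm (s⁻¹ • ((h.const t).evol k s 0 (Φ x) - Φ x)) =
        s⁻¹ • (conj Φ ((h.const t).evol k s 0) x - x) := fun s => by
      rw [conj_apply, ← Complex.coe_smul, ← Complex.coe_smul, map_smul, map_sub,
        LinearIsometryEquiv.symm_apply_apply]
    refine ⟨fun hlim => ?_, fun hlim => ?_⟩
    · have := (Φ.symm.continuous.tendsto _).comp hlim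
      simpa only [Function.comp_def, e, LinearIsometryEquiv.symm_apply_apply] using this
    · have := (Φ.continuous.tendsto _).comp hlim
      simpa only [Function.comp_def, ← e, LinearIsometryEquiv.apply_symm_apply] using this
  · have ht : t ∈ Icc (0 : ℝ) 1 := ⟨hts.1.trans hts.2.1, hts.2.2⟩
    refine ⟨Φ.symm (K k t (h.evol (k + 1) t s (Ψ v))), ?_, ?_⟩
    · rw [conj_apply, hι, ← h.evol_intertwine k hts.2.1]
      exact hgraph t ht _
    · simp only [conj_apply, hι]
      exact hΦ ((h.hasDerivWithinAt_evol_forward k hts.2.1 _).mono Icc_subset_Ici_self)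
  · have hs : s ∈ Icc (0 : ℝ) 1 := ⟨hts.1, hts.2.1.trans hts.2.2⟩
    refine ⟨Φ.symm (K k s (Ψ v)), ?_, ?_⟩
    · have := hgraph s hs (Ψ v)
      rwa [← hι, LinearIsometryEquiv.symm_apply_apply] at this
    · simp only [conj_apply, hι, LinearIsometryEquiv.apply_symm_apply]
      rw [← map_neg]
      exact hΦ ((h.hasDerivWithinAt_evol_backward k hts.2.1 _).mono Icc_subset_Iic_self)
  · refine ⟨fun p => Ψ.symm (h.evol (k + 1) p.1 p.2 (Ψ v)), fun p hp => ?_,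
      (Ψ.symm.continuous.comp (h.continuous_evol (k + 1) (Ψ v))).continuousOn⟩
    rw [hι', h.evol_intertwine k hp.2.1, conj_apply, hι]
  · rintro V hV ⟨κ', hκ'⟩ - hback t s hts
    -- The growth rate `κ'` of the competitor may be negative, hence the absolute value in the
    -- uniform bound on `[s, t]`.
    have h1 := h.evol_unique (V := fun r => V t r ∘L (Φ.symm.toContinuousLinearEquiv : H →L[ℂ] E))
      (C := exp (|κ'| * t)) hts.2.1 k (fun r hr => ?_) (fun x r hr => ?_) (fun v r hr => ?_)
    · ext x
      have h2 := h1 (Φ x)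
      simpa [hV.refl t ⟨hts.1.trans hts.2.1, hts.2.2⟩, conj_apply] using h2
    · refine ContinuousLinearMap.opNorm_le_bound _ (exp_pos _).le fun x => ?_
      refine ((V t r).le_opNorm _).trans ?_
      rw [show ‖((Φ.symm.toContinuousLinearEquiv : H →L[ℂ] E) : H →ₗ[ℂ] E) x‖ = ‖x‖ from
        LinearIsometryEquiv.norm_map _ _]
      refine mul_le_mul_of_nonneg_right ((hκ' t r ⟨hts.1.trans hr.1, hr.2, hts.2.2⟩).trans
        (exp_le_exp.2 ?_)) (norm_nonneg _)
      have h2 : 0 ≤ t - r := by linarith [hr.2]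
      have h3 : 0 ≤ r := hts.1.trans hr.1
      calc κ' * (t - r) ≤ |κ'| * (t - r) := mul_le_mul_of_nonneg_right (le_abs_self _) h2
        _ ≤ |κ'| * t := mul_le_mul_of_nonneg_left (by linarith) (abs_nonneg _)
    · have h2 := hV.continuousOn (Φ.symm x)
      have h3 : ContinuousOn (fun r : ℝ => (t, r)) (Icc s t) := by fun_prop
      exact h2.comp h3 (fun r hr => ⟨hts.1.trans hr.1, hr.2, hts.2.2⟩) r hr
    · have hr' : (t, r) ∈ triangle := ⟨hts.1.trans hr.1, hr.2, hts.2.2⟩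
      obtain ⟨w, hw, hd⟩ := hback (Ψ.symm v) t r hr'
      have hw' := hgraph r ⟨hts.1.trans hr.1, hr.2.trans hts.2.2⟩ v
      rw [hι'] at hw
      -- The value supplied by the backward equation is determined by the graph, so it is the
      -- transported `K k r v`.
      have hww := (A r).mem_graph_snd_inj hw hw' rfl
      rw [hww] at hd
      simp only [hι'] at hd
      exact hd.mono (Icc_subset_Icc_left hts.1)

end Transport

end IsDissipativeFamily

end VirasoroEvolution

end

/-! ### Linear energy bounds for the Virasoro operators -/

noncomputable section

namespace VirasoroEvolution

namespace UnitaryPositiveEnergyRep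

variable {H : Type*} [NormedAddCommGroup H] [InnerProductSpace ℂ H] {c : ℝ} {W : Submodule ℂ H}
  (ρ : UnitaryPositiveEnergyRep c W)

/-- The eigenspaces of `L_0`. -/
abbrev eig (μ : ℂ) : Submodule ℂ W := Module.End.eigenspace (ρ.L 0) μ

theorem mem_eig {μ : ℂ} {w : W} : w ∈ ρ.eig μ ↔ ρ.L 0 w = μ • w := Module.End.mem_eigenspace_iff

theorem exists_real_of_mem_eig {μ : ℂ} {w : W} (hw : w ∈ ρ.eig μ) (h0 : w ≠ 0) :
    ∃ r : ℝ, 0 ≤ r ∧ μ = r := by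
  have hμ : Module.End.HasEigenvalue (ρ.L 0) μ :=
    Module.End.hasEigenvalue_of_hasEigenvector ⟨hw, h0⟩
  exact ⟨μ.re, ρ.eigenvalue_nonneg hμ,
    (Complex.conj_eq_iff_re.1 (ρ.isSymmetric_L0.conj_eigenvalue_eq_self hμ)).symm⟩

theorem L_mem_eig {μ : ℂ} {w : W} (hw : w ∈ ρ.eig μ) (n : ℤ) : ρ.L n w ∈ ρ.eig (μ - n) := by
  rw [mem_eig] at hw ⊢
  have h := ρ.commutator 0 n w
  rw [hw, map_smul] at h
  by_cases hn : n = 0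
  · subst hn; simp [hw]
  · simp only [zero_add, hn, if_false, zero_smul, add_zero, Int.cast_zero, zero_sub] at h
    rw [sub_eq_iff_eq_add] at h
    rw [h, ← add_smul, sub_eq_neg_add]

theorem eig_induction {p : W → Prop} (w : W) (h0 : p 0) (hadd : ∀ v w, p v → p w → p (v + w))
    (h : ∀ μ, ∀ w ∈ ρ.eig μ, p w) : p w := by
  have hw : w ∈ ⨆ μ : ℂ, ρ.eig μ := by rw [ρ.diagonalizable]; exact Submodule.mem_top
  exact Submodule.iSup_induction _ (motive := p) hw h h0 hadd

/-- A linear map which maps the eigenspaces of `L_0` to distinct ones is bounded by a common bound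
on the eigenspaces. -/
theorem norm_le_of_homogeneous (B : W →ₗ[ℂ] H) (d : ℂ) {C : ℝ} (hC : 0 ≤ C)
    (hB : ∀ μ, ∀ w ∈ ρ.eig μ, ∃ w' ∈ ρ.eig (μ - d), B w = w')
    (hBC : ∀ μ, ∀ w ∈ ρ.eig μ, ‖B w‖ ≤ C * ‖w‖) (w : W) : ‖B w‖ ≤ C * ‖w‖ := by
  classical
  have hw : w ∈ ⨆ μ : ℂ, ρ.eig μ := by rw [ρ.diagonalizable]; exact Submodule.mem_top
  obtain ⟨f, hf⟩ := (Submodule.mem_iSup_iff_exists_dfinsupp' _ _).1 hw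
  have hsum : w = ∑ μ ∈ f.support, (f μ : W) := hf.symm
  choose g hg1 hg2 using fun μ => hB μ (f μ) (f μ).2
  have hO := ρ.isSymmetric_L0.orthogonalFamily_eigenspaces
  have h1 : ‖w‖ ^ 2 = ∑ μ ∈ f.support, ‖f μ‖ ^ 2 := by
    have := hO.norm_sum (fun μ => f μ) f.support
    simpa [← hsum] using this
  have h2 : ‖B w‖ ^ 2 = ∑ μ ∈ f.support, ‖B (f μ)‖ ^ 2 := by
    -- The shift keeps distinct eigenvalues distinct, so the images of the components are orthogonal
    -- too and Pythagoras applies on both sides.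
    have hO' := hO.comp (f := fun μ : ℂ => μ - d) (fun a b hab => sub_left_injective hab)
    have h3 := hO'.norm_sum (fun μ => ⟨g μ, hg1 μ⟩) f.support
    have h4 : B w = ((∑ μ ∈ f.support, g μ : W) : H) := by
      conv_lhs => rw [hsum]
      rw [map_sum, Submodule.coe_sum]
      exact Finset.sum_congr rfl fun μ _ => hg2 μ
    rw [h4, ← Submodule.coe_norm]
    simp only [hg2]
    simpa using h3
  have h5 : ‖B w‖ ^ 2 ≤ (C * ‖w‖) ^ 2 := by
    rw [h2, mul_pow, h1, Finset.mul_sum]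
    refine Finset.sum_le_sum fun μ _ => ?_
    rw [← mul_pow]
    have := hBC μ (f μ) (f μ).2
    exact pow_le_pow_left₀ (norm_nonneg _) this 2
  exact (sq_le_sq₀ (norm_nonneg _) (by positivity)).1 h5

theorem norm_sq_L (n : ℤ) (w : W) : ‖ρ.L n w‖ ^ 2 = (⟪w, ρ.L (-n) (ρ.L n w)⟫_ℂ).re := by
  rw [← ρ.unitary]
  exact (inner_self_eq_norm_sq (𝕜 := ℂ) (ρ.L n w)).symm

/-- The commutator `[L_n, L_{-n}]` acts on an eigenvector of `L_0` as a scalar. -/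
theorem norm_sq_L_neg {r : ℝ} {w : W} (hw : w ∈ ρ.eig r) (n : ℤ) :
    ‖ρ.L (-n) w‖ ^ 2 =
      ‖ρ.L n w‖ ^ 2 + (2 * n * r + c / 12 * ((n : ℝ) ^ 3 - n)) * ‖w‖ ^ 2 := by
  have h1 := ρ.norm_sq_L (-n) w
  have h2 := ρ.norm_sq_L n w
  have h3 := ρ.commutator n (-n) w
  rw [neg_neg] at h1
  rw [add_neg_cancel, ρ.mem_eig.1 hw, if_pos rfl, smul_smul, ← add_smul, sub_eq_iff_eq_add] at h3
  rw [h3, inner_add_right, inner_smul_right, inner_self_eq_norm_sq_to_K, Complex.add_re, ← h2] at h1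
  rw [h1, add_comm]
  congr 1
  have e : (((n : ℂ) - ((-n : ℤ) : ℂ)) * (r : ℂ) + (c : ℂ) / 12 * ((n : ℂ) ^ 3 - n)) =
      ((2 * n * r + c / 12 * ((n : ℝ) ^ 3 - n) : ℝ) : ℂ) := by push_cast; ring
  rw [e]
  simp only [Complex.coe_algebraMap, ← Complex.ofReal_pow, ← Complex.ofReal_mul,
    Complex.ofReal_re]

variable (hc : 0 ≤ c)
include hc

/-- Induction on the energy. The vector `x = L_n w` has energy `r - n`, so `‖L_n x‖` is bounded by
induction, `‖L_{-n} x‖` by the commutator, and `‖x‖² = ⟨w, L_{-n} x⟩ ≤ ‖w‖ ‖L_{-n} x‖` closes the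
loop. -/
theorem norm_sq_L_pos_le {n : ℕ} (hn : 1 ≤ n) (k : ℕ) {r : ℝ} (hr : r < k) (hr0 : 0 ≤ r) {w : W}
    (hw : w ∈ ρ.eig r) : ‖ρ.L n w‖ ^ 2 ≤ (r ^ 2 + c * n ^ 2 * r / 12) * ‖w‖ ^ 2 := by
  have hn' : (1 : ℝ) ≤ n := by exact_mod_cast hn
  induction k generalizing r w with
  | zero => exact absurd hr (by simpa using hr0)
  | succ k ih =>
    set x := ρ.L n w
    have hb : 0 ≤ r ^ 2 + c * n ^ 2 * r / 12 := by positivity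
    by_cases hx0 : x = 0
    · simpa [hx0] using mul_nonneg hb (sq_nonneg ‖w‖)
    have hx : x ∈ ρ.eig ((r - n : ℝ) : ℂ) := by
      have := ρ.L_mem_eig hw n
      push_cast at this ⊢
      exact this
    obtain ⟨r', hr', he⟩ := ρ.exists_real_of_mem_eig hx hx0
    have he' : r - n = r' := by exact_mod_cast he
    have h1 := ih (r := r - n) (by push_cast at hr; linarith) (by linarith) hx
    have h2 := ρ.norm_sq_L_neg hx n
    have h3 : ‖ρ.L (-n) x‖ ^ 2 ≤ (r ^ 2 + c * n ^ 2 * r / 12) * ‖x‖ ^ 2 := by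
      rw [h2]
      -- The bound is chosen to reproduce itself: the left side equals the right side minus `n² + c
      -- n / 12`.
      have h4 : (r - n) ^ 2 + c * n ^ 2 * (r - n) / 12 +
          (2 * (n : ℤ) * (r - n) + c / 12 * (((n : ℤ) : ℝ) ^ 3 - (n : ℤ))) ≤
          r ^ 2 + c * n ^ 2 * r / 12 := by
        push_cast
        nlinarith [mul_nonneg hc (by linarith : (0 : ℝ) ≤ n)]
      have h5 := mul_le_mul_of_nonneg_right h4 (sq_nonneg ‖x‖)
      push_cast at h5 h1 ⊢
      linarith
    have h6 : ‖x‖ ^ 2 ≤ ‖w‖ * ‖ρ.L (-n) x‖ := by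
      rw [ρ.norm_sq_L n w]
      exact re_inner_le_norm (𝕜 := ℂ) w (ρ.L (-n) x)
    have hxpos : 0 < ‖x‖ := norm_pos_iff.2 hx0
    have h7 : ‖x‖ ^ 2 * ‖x‖ ^ 2 ≤ ‖x‖ ^ 2 * ((r ^ 2 + c * n ^ 2 * r / 12) * ‖w‖ ^ 2) := by
      calc ‖x‖ ^ 2 * ‖x‖ ^ 2 ≤ (‖w‖ * ‖ρ.L (-n) x‖) * (‖w‖ * ‖ρ.L (-n) x‖) :=
            mul_le_mul h6 h6 (by positivity) (by positivity)
        _ = ‖w‖ ^ 2 * ‖ρ.L (-n) x‖ ^ 2 := by ring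
        _ ≤ ‖w‖ ^ 2 * ((r ^ 2 + c * n ^ 2 * r / 12) * ‖x‖ ^ 2) :=
            mul_le_mul_of_nonneg_left h3 (by positivity)
        _ = _ := by ring
    exact le_of_mul_le_mul_left h7 (by positivity)

/-- Linear energy bounds. -/
theorem norm_L_le (n : ℤ) {r : ℝ} (hr0 : 0 ≤ r) {w : W} (hw : w ∈ ρ.eig r) :
    ‖ρ.L n w‖ ≤ (1 + c) * (1 + |(n : ℝ)|) ^ 2 * (1 + r) * ‖w‖ := by
  have key : ‖ρ.L n w‖ ^ 2 ≤ ((1 + c) * (1 + |(n : ℝ)|) ^ 2 * (1 + r)) ^ 2 * ‖w‖ ^ 2 := by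
    -- This crude bound serves both signs of `n`: the last summand is the commutator term needed for
    -- `L_{-m}`, and for `L_m` it is non-negative and may be added.
    have hm : ∀ m : ℝ, 0 ≤ m → r ^ 2 + c * m ^ 2 * r / 12 + (2 * m * r + c / 12 * (m ^ 3 - m)) ≤
        ((1 + c) * (1 + m) ^ 2 * (1 + r)) ^ 2 := fun m hm => by
      have h1 : r ^ 2 + c * m ^ 2 * r / 12 + (2 * m * r + c / 12 * (m ^ 3 - m)) ≤
          (1 + c) * ((1 + m) ^ 4 * (1 + r) ^ 2) := by
        have e : (1 + c) * ((1 + m) ^ 4 * (1 + r) ^ 2) -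
            (r ^ 2 + c * m ^ 2 * r / 12 + (2 * m * r + c / 12 * (m ^ 3 - m))) =
          (1 + 2 * r) * (1 + m) ^ 4 + (4 * m + 6 * m ^ 2 + 4 * m ^ 3 + m ^ 4) * r ^ 2 +
          c * (1 + m) ^ 4 * (1 + r ^ 2) + c * r * (2 * (1 + 4 * m + 4 * m ^ 3 + m ^ 4) +
            (12 - 1 / 12) * m ^ 2) - (2 * m * r + c / 12 * (m ^ 3 - m)) := by ring
        have h2 : 2 * m * r ≤ (1 + 2 * r) * (1 + m) ^ 4 := by
          have : m ≤ (1 + m) ^ 4 := by nlinarith [pow_nonneg hm 3, pow_nonneg hm 4, sq_nonneg m]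
          nlinarith [mul_nonneg hr0 (sub_nonneg.2 this), pow_nonneg (by linarith : 0 ≤ 1 + m) 4]
        have h3 : c / 12 * (m ^ 3 - m) ≤ c * (1 + m) ^ 4 * (1 + r ^ 2) := by
          have h4 : (m ^ 3 - m) / 12 ≤ (1 + m) ^ 4 * (1 + r ^ 2) := by
            have : m ^ 3 - m ≤ (1 + m) ^ 4 := by
              nlinarith [pow_nonneg hm 3, pow_nonneg hm 4, sq_nonneg m]
            nlinarith [pow_nonneg (by linarith : 0 ≤ 1 + m) 4,
              mul_nonneg (pow_nonneg (by linarith : 0 ≤ 1 + m) 4) (sq_nonneg r)]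
          calc c / 12 * (m ^ 3 - m) = c * ((m ^ 3 - m) / 12) := by ring
            _ ≤ c * ((1 + m) ^ 4 * (1 + r ^ 2)) := mul_le_mul_of_nonneg_left h4 hc
            _ = _ := by ring
        have h5 : 0 ≤ (4 * m + 6 * m ^ 2 + 4 * m ^ 3 + m ^ 4) * r ^ 2 := by positivity
        have h6 : 0 ≤ c * r * (2 * (1 + 4 * m + 4 * m ^ 3 + m ^ 4) +
            (12 - 1 / 12) * m ^ 2) := by
          have : (0 : ℝ) ≤ 12 - 1 / 12 := by norm_num
          positivity
        linarith
      refine h1.trans ?_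
      have e : ((1 + c) * (1 + m) ^ 2 * (1 + r)) ^ 2 =
        (1 + c) * ((1 + c) * ((1 + m) ^ 4 * (1 + r) ^ 2)) := by ring
      rw [e]
      exact le_mul_of_one_le_left (by positivity) (by linarith)
    obtain ⟨k, hk⟩ := exists_nat_gt r
    obtain ⟨m, rfl | rfl⟩ := n.eq_nat_or_neg
    · rcases Nat.eq_zero_or_pos m with rfl | hm0
      · rw [Nat.cast_zero, ρ.mem_eig.1 hw, norm_smul, mul_pow]
        refine mul_le_mul_of_nonneg_right ?_ (by positivity)
        have := hm 0 le_rfl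
        simpa using this
      · refine (ρ.norm_sq_L_pos_le hc hm0 k hk hr0 hw).trans
          (mul_le_mul_of_nonneg_right ?_ (by positivity))
        have h1 := hm m (by positivity)
        have h2 : (1 : ℝ) ≤ m := by exact_mod_cast hm0
        have h3 : (0 : ℝ) ≤ 2 * m * r + c / 12 * ((m : ℝ) ^ 3 - m) := by
          have : (m : ℝ) ≤ m ^ 3 := le_self_pow₀ h2 (by norm_num)
          have := sub_nonneg.2 this
          positivity
        simp only [Int.cast_natCast, abs_of_nonneg (Nat.cast_nonneg (α := ℝ) m)]
        linarith
    · rcases Nat.eq_zero_or_pos m with rfl | hm0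
      · rw [Nat.cast_zero, neg_zero, ρ.mem_eig.1 hw, norm_smul, mul_pow]
        refine mul_le_mul_of_nonneg_right ?_ (by positivity)
        have := hm 0 le_rfl
        simpa using this
      · rw [ρ.norm_sq_L_neg hw]
        have h1 := hm m (by positivity)
        have h2 := ρ.norm_sq_L_pos_le hc hm0 k hk hr0 hw
        have h3 := mul_le_mul_of_nonneg_right h1 (sq_nonneg ‖w‖)
        simp only [Int.cast_natCast, Int.cast_neg, abs_neg,
          abs_of_nonneg (Nat.cast_nonneg (α := ℝ) m)]
        linarith
  rw [← mul_pow] at key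
  exact (sq_le_sq₀ (norm_nonneg _) (by positivity)).1 key

end UnitaryPositiveEnergyRep

end VirasoroEvolution

end

/-! ### Conjugation of the Virasoro operators by powers of `1 + L_0` -/

noncomputable section

namespace VirasoroEvolution

namespace UnitaryPositiveEnergyRep

variable {H : Type*} [NormedAddCommGroup H] [InnerProductSpace ℂ H] {c : ℝ} {W : Submodule ℂ H}
  (ρ : UnitaryPositiveEnergyRep c W)

/-- The operator `1 + L_0` on `W`. -/
def energyW : Module.End ℂ W := LinearMap.id + ρ.L 0

theorem energyW_apply_eig {μ : ℂ} {w : W} (hw : w ∈ ρ.eig μ) : ρ.energyW w = (1 + μ) • w := by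
  rw [energyW, LinearMap.add_apply, ρ.mem_eig.1 hw, add_smul, one_smul, LinearMap.id_apply]

theorem energyW_symmetric (v w : W) : ⟪ρ.energyW v, w⟫_ℂ = ⟪v, ρ.energyW w⟫_ℂ := by
  simp [energyW, ρ.isSymmetric_L0 v w]

theorem one_add_ne_zero {μ : ℂ} {w : W} (hw : w ∈ ρ.eig μ) (h0 : w ≠ 0) : 1 + μ ≠ 0 := by
  obtain ⟨r, hr, rfl⟩ := ρ.exists_real_of_mem_eig hw h0
  exact_mod_cast (by linarith : 0 < 1 + r).ne'

theorem norm_le_energyW (w : W) : ‖w‖ ≤ ‖ρ.energyW w‖ := by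
  by_cases h0 : w = 0
  · simp [h0]
  have h1 : ‖w‖ ^ 2 ≤ ‖w‖ * ‖ρ.energyW w‖ := by
    have h2 := ρ.inner_L0_nonneg w
    have h3 : (⟪w, w + ρ.L 0 w⟫_ℂ).re ≤ ‖w‖ * ‖w + ρ.L 0 w‖ := re_inner_le_norm (𝕜 := ℂ) _ _
    rw [inner_add_right, Complex.add_re, inner_self_eq_norm_sq_to_K] at h3
    simp only [Complex.coe_algebraMap, ← Complex.ofReal_pow, Complex.ofReal_re] at h3
    have e : ρ.energyW w = w + ρ.L 0 w := rfl
    rw [e]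
    linarith
  have h4 : 0 < ‖w‖ := norm_pos_iff.2 h0
  nlinarith

theorem energyW_bijective : Function.Bijective ρ.energyW := by
  refine ⟨(injective_iff_map_eq_zero _).2 fun w hw => ?_, fun w => ?_⟩
  · have := ρ.norm_le_energyW w
    rwa [hw, norm_zero, norm_le_zero_iff] at this
  · change w ∈ LinearMap.range ρ.energyW
    refine ρ.eig_induction w (zero_mem _) (fun v w => add_mem) fun μ w hw => ?_
    by_cases h0 : w = 0
    · rw [h0]; exact zero_mem _
    refine ⟨(1 + μ)⁻¹ • w, ?_⟩
    rw [map_smul, ρ.energyW_apply_eig hw, smul_smul, inv_mul_cancel₀ (ρ.one_add_ne_zero hw h0),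
      one_smul]

/-- The inverse of `1 + L_0` on `W`. -/
def resolventW : Module.End ℂ W := (LinearEquiv.ofBijective ρ.energyW ρ.energyW_bijective).symm

theorem energyW_resolventW (w : W) : ρ.energyW (ρ.resolventW w) = w :=
  (LinearEquiv.ofBijective ρ.energyW ρ.energyW_bijective).apply_symm_apply w

theorem resolventW_energyW (w : W) : ρ.resolventW (ρ.energyW w) = w :=
  (LinearEquiv.ofBijective ρ.energyW ρ.energyW_bijective).symm_apply_apply w

theorem resolventW_apply_eig {μ : ℂ} {w : W} (hw : w ∈ ρ.eig μ) :
    ρ.resolventW w = (1 + μ)⁻¹ • w := by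
  by_cases h0 : w = 0
  · simp [h0]
  refine ρ.energyW_bijective.1 ?_
  rw [energyW_resolventW, map_smul, ρ.energyW_apply_eig hw, smul_smul,
    inv_mul_cancel₀ (ρ.one_add_ne_zero hw h0), one_smul]

theorem energyW_pow_apply_eig {μ : ℂ} {w : W} (hw : w ∈ ρ.eig μ) (k : ℕ) :
    (ρ.energyW ^ k) w = (1 + μ) ^ k • w := by
  induction k with
  | zero => simp
  | succ k ih => rw [pow_succ', Module.End.mul_apply, ih, map_smul, ρ.energyW_apply_eig hw,
      smul_smul, pow_succ]

theorem resolventW_pow_apply_eig {μ : ℂ} {w : W} (hw : w ∈ ρ.eig μ) (k : ℕ) :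
    (ρ.resolventW ^ k) w = (1 + μ)⁻¹ ^ k • w := by
  induction k with
  | zero => simp
  | succ k ih => rw [pow_succ', Module.End.mul_apply, ih, map_smul, ρ.resolventW_apply_eig hw,
      smul_smul, pow_succ]

theorem resolventW_symmetric (v w : W) : ⟪ρ.resolventW v, w⟫_ℂ = ⟪v, ρ.resolventW w⟫_ℂ := by
  conv_lhs => rw [← ρ.energyW_resolventW w]
  rw [← ρ.energyW_symmetric, ρ.energyW_resolventW]

theorem norm_resolventW_le (w : W) : ‖ρ.resolventW w‖ ≤ 1 * ‖w‖ := by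
  have := ρ.norm_le_energyW (ρ.resolventW w)
  rwa [ρ.energyW_resolventW, ← one_mul ‖w‖] at this

/-- The operator `(1 + L_0) ^ k L_n (1 + L_0) ^ (-k-1)` on `W`. -/
def LW (k : ℕ) (n : ℤ) : Module.End ℂ W := ρ.energyW ^ k * ρ.L n * ρ.resolventW ^ (k + 1)

theorem conj_pow_apply_eig {μ : ℂ} {w : W} (hw : w ∈ ρ.eig μ) (n : ℤ) (k j : ℕ) :
    (ρ.energyW ^ k * ρ.L n * ρ.resolventW ^ j) w =
      ((1 + μ)⁻¹ ^ j * (1 + (μ - n)) ^ k) • ρ.L n w := by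
  rw [Module.End.mul_apply, ρ.resolventW_pow_apply_eig hw, map_smul, Module.End.mul_apply,
    ρ.energyW_pow_apply_eig (ρ.L_mem_eig hw n), smul_smul]

/-- The shifted energy is non-negative, and comparable to the original energy. -/
theorem energy_ratio {r : ℝ} (hr : 0 ≤ r) {n : ℤ} {w : W} (hw : w ∈ ρ.eig r)
    (h0 : ρ.L n w ≠ 0) : ∃ q : ℝ, 0 ≤ q ∧ q ≤ 1 + |(n : ℝ)| ∧ |q - 1| ≤ |(n : ℝ)| / (1 + r) ∧
      ((1 + (r : ℂ))⁻¹ * (1 + ((r : ℂ) - n))) = q := by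
  obtain ⟨r', hr', he⟩ := ρ.exists_real_of_mem_eig (ρ.L_mem_eig hw n) h0
  have he' : r - n = r' := by exact_mod_cast he
  have h1 : 0 < 1 + r := by linarith
  refine ⟨(1 + r)⁻¹ * (1 + (r - n)), by rw [he']; positivity, ?_, ?_, by push_cast; ring⟩
  · rw [inv_mul_le_iff₀ h1]
    nlinarith [neg_abs_le (n : ℝ), abs_nonneg (n : ℝ)]
  · have e : (1 + r)⁻¹ * (1 + (r - n)) - 1 = -n / (1 + r) := by field_simp; ring
    rw [e, abs_div, abs_neg, abs_of_pos h1]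

variable (hc : 0 ≤ c)
include hc

/-- On energy `r` the conjugation multiplies `L_n` by `(1 + r)⁻¹ q ^ k` with `q ≤ 1 + |n|`. The
first factor absorbs the linear growth of `L_n`; the second costs a power of `1 + |n|`, harmless for
smooth vector fields. -/
theorem norm_LW_le (k : ℕ) (n : ℤ) (w : W) :
    ‖ρ.LW k n w‖ ≤ (1 + c) * (1 + |(n : ℝ)|) ^ (k + 2) * ‖w‖ := by
  refine ρ.norm_le_of_homogeneous (W.subtype ∘ₗ ρ.LW k n) n (by positivity)
    (fun μ w hw => ⟨_, ?_, rfl⟩) (fun μ w hw => ?_) w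
  · rw [LW, ρ.conj_pow_apply_eig hw]
    exact Submodule.smul_mem _ _ (ρ.L_mem_eig hw n)
  · change ‖ρ.LW k n w‖ ≤ _
    rw [LW, ρ.conj_pow_apply_eig hw]
    by_cases h0 : ρ.L n w = 0
    · rw [h0, smul_zero, norm_zero]; positivity
    have hw0 : w ≠ 0 := fun hw0 => h0 (by rw [hw0, map_zero])
    obtain ⟨r, hr, rfl⟩ := ρ.exists_real_of_mem_eig hw hw0
    obtain ⟨q, hq0, hq1, -, hq⟩ := ρ.energy_ratio hr hw h0
    have h1 : 0 < 1 + r := by linarith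
    have e : (1 + (r : ℂ))⁻¹ ^ (k + 1) * (1 + ((r : ℂ) - n)) ^ k =
        (((1 + r)⁻¹ * q ^ k : ℝ) : ℂ) := by
      rw [pow_succ', mul_assoc, ← mul_pow, hq]; push_cast; ring
    rw [e, norm_smul, Complex.norm_real, Real.norm_of_nonneg (by positivity)]
    calc (1 + r)⁻¹ * q ^ k * ‖ρ.L n w‖
        ≤ (1 + r)⁻¹ * (1 + |(n : ℝ)|) ^ k *
          ((1 + c) * (1 + |(n : ℝ)|) ^ 2 * (1 + r) * ‖w‖) := by
          have := ρ.norm_L_le hc n hr hw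
          gcongr
      _ = _ := by field_simp; ring

/-- The commutators `[(1 + L_0) ^ k, L_n] (1 + L_0) ^ (-k)` are bounded. -/
theorem norm_conj_sub_le (k : ℕ) (n : ℤ) (w : W) :
    ‖(ρ.energyW ^ k * ρ.L n * ρ.resolventW ^ k) w - ρ.L n w‖ ≤
      k * (1 + c) * (1 + |(n : ℝ)|) ^ (k + 2) * ‖w‖ := by
  have key : ∀ μ, ∀ w ∈ ρ.eig μ, (ρ.energyW ^ k * ρ.L n * ρ.resolventW ^ k - ρ.L n) w =
      (((1 + μ)⁻¹ * (1 + (μ - n))) ^ k - 1) • ρ.L n w := fun μ w hw => by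
    rw [LinearMap.sub_apply, ρ.conj_pow_apply_eig hw, sub_smul, one_smul, mul_pow]
  refine ρ.norm_le_of_homogeneous (W.subtype ∘ₗ (ρ.energyW ^ k * ρ.L n * ρ.resolventW ^ k - ρ.L n))
    n (by positivity) (fun μ w hw => ⟨(ρ.energyW ^ k * ρ.L n * ρ.resolventW ^ k - ρ.L n) w, ?_, rfl⟩)
    (fun μ w hw => ?_) w
  · rw [key μ w hw]
    exact Submodule.smul_mem _ _ (ρ.L_mem_eig hw n)
  · change ‖(ρ.energyW ^ k * ρ.L n * ρ.resolventW ^ k - ρ.L n) w‖ ≤ _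
    rw [key μ w hw]
    by_cases h0 : ρ.L n w = 0
    · rw [h0, smul_zero, norm_zero]; positivity
    have hw0 : w ≠ 0 := fun hw0 => h0 (by rw [hw0, map_zero])
    obtain ⟨r, hr, rfl⟩ := ρ.exists_real_of_mem_eig hw hw0
    obtain ⟨q, hq0, hq1, hq2, hq⟩ := ρ.energy_ratio hr hw h0
    have h1 : 0 < 1 + r := by linarith
    have e : ((1 + (r : ℂ))⁻¹ * (1 + ((r : ℂ) - n))) ^ k - 1 = ((q ^ k - 1 : ℝ) : ℂ) := by
      rw [hq]; push_cast; ring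
    rw [e, norm_smul, Complex.norm_real, Real.norm_eq_abs]
    -- Since `q - 1 = -n / (1 + r)`, the commutator gains a factor `(1 + r)⁻¹`, which cancels the
    -- linear energy bound.
    have h2 : |q ^ k - 1| ≤ |(n : ℝ)| / (1 + r) * k * (1 + |(n : ℝ)|) ^ (k - 1) := by
      have h3 := abs_pow_sub_pow_le (q : ℝ) 1 k
      rw [one_pow, abs_one, abs_of_nonneg hq0] at h3
      refine h3.trans ?_
      have h4 : max q 1 ≤ 1 + |(n : ℝ)| := max_le hq1 (by linarith [abs_nonneg (n : ℝ)])
      gcongr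
    calc |q ^ k - 1| * ‖ρ.L n w‖
        ≤ (|(n : ℝ)| / (1 + r) * k * (1 + |(n : ℝ)|) ^ (k - 1)) *
          ((1 + c) * (1 + |(n : ℝ)|) ^ 2 * (1 + r) * ‖w‖) := by
          have := ρ.norm_L_le hc n hr hw
          gcongr
      _ = k * (1 + c) * (|(n : ℝ)| * (1 + |(n : ℝ)|) ^ (k - 1)) * (1 + |(n : ℝ)|) ^ 2 * ‖w‖ := by
          field_simp
      _ ≤ k * (1 + c) * (1 + |(n : ℝ)|) ^ (k + 2) * ‖w‖ := by
          rcases k with _ | k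
          · simp
          · have h5 : |(n : ℝ)| * (1 + |(n : ℝ)|) ^ k ≤ (1 + |(n : ℝ)|) ^ (k + 1) := by
              rw [pow_succ']
              exact mul_le_mul_of_nonneg_right (by linarith) (by positivity)
            rw [pow_add _ (k + 1) 2, add_tsub_cancel_right]
            have h6 := mul_le_mul_of_nonneg_left h5
              (by positivity : 0 ≤ ((k + 1 : ℕ) : ℝ) * (1 + c))
            have h7 := mul_le_mul_of_nonneg_right h6
              (by positivity : 0 ≤ (1 + |(n : ℝ)|) ^ 2 * ‖w‖)
            calc _ = _ := by ring
              _ ≤ _ := h7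
              _ = _ := by ring

end UnitaryPositiveEnergyRep

end VirasoroEvolution

end

/-! ### The Sobolev scale of `L_0` and bounded forms of the smeared operators -/

noncomputable section

namespace VirasoroEvolution

namespace UnitaryPositiveEnergyRep

variable {H : Type*} [NormedAddCommGroup H] [InnerProductSpace ℂ H] [CompleteSpace H] {c : ℝ}
  {W : Submodule ℂ H} (ρ : UnitaryPositiveEnergyRep c W) (hW : Dense (W : Set H))

/-- The extension of a bounded operator on `W` to `H`. -/
def extend (B : Module.End ℂ W) : H →L[ℂ] H := (W.subtype ∘ₗ B).extendOfNorm W.subtype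

include hW in
theorem extend_apply {B : Module.End ℂ W} {C : ℝ} (hB : ∀ w, ‖B w‖ ≤ C * ‖w‖) (w : W) :
    extend B w = B w :=
  LinearMap.extendOfNorm_eq (f := W.subtype ∘ₗ B) (e := W.subtype) hW.denseRange_val ⟨C, hB⟩ w

include hW in
theorem norm_extend_le {B : Module.End ℂ W} {C : ℝ} (hC : 0 ≤ C) (hB : ∀ w, ‖B w‖ ≤ C * ‖w‖) :
    ‖extend B‖ ≤ C :=
  LinearMap.opNorm_extendOfNorm_le (f := W.subtype ∘ₗ B) (e := W.subtype) hW.denseRange_val hC hB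

omit [CompleteSpace H] in
include hW in
theorem ext_of_dense {T T' : H →L[ℂ] H} (h : ∀ w : W, T w = T' w) : T = T' :=
  ContinuousLinearMap.ext fun x => congrFun (hW.denseRange_val.equalizer T.continuous T'.continuous
    (funext h)) x

/-- The bounded operator `(1 + L_0)⁻¹` on `H`. -/
def resolvent : H →L[ℂ] H := extend ρ.resolventW

include hW

theorem resolvent_apply (w : W) : ρ.resolvent w = ρ.resolventW w :=
  extend_apply hW ρ.norm_resolventW_le w

theorem resolvent_symmetric (x y : H) : ⟪ρ.resolvent x, y⟫_ℂ = ⟪x, ρ.resolvent y⟫_ℂ := by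
  refine hW.denseRange_val.induction_on₂ (isClosed_eq (by fun_prop) (by fun_prop))
    (fun v w => ?_) x y
  rw [ρ.resolvent_apply hW, ρ.resolvent_apply hW]
  exact ρ.resolventW_symmetric v w

theorem isSelfAdjoint_resolvent : IsSelfAdjoint ρ.resolvent :=
  ContinuousLinearMap.isSelfAdjoint_iff_isSymmetric.2 (ρ.resolvent_symmetric hW)

theorem dense_resolvent : DenseRange ρ.resolvent := by
  refine hW.mono fun w hw => ⟨ρ.energyW ⟨w, hw⟩, ?_⟩
  rw [ρ.resolvent_apply hW, ρ.resolventW_energyW]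

theorem resolvent_injective : Function.Injective ρ.resolvent := by
  refine (injective_iff_map_eq_zero _).2 fun x hx => ?_
  refine (ρ.dense_resolvent hW).eq_zero_of_inner_left ℂ fun y => ?_
  rw [← ρ.resolvent_symmetric hW, hx, inner_zero_left]

omit [CompleteSpace H] in
-- A substitute for the functional calculus of `L_0`, from orthogonality of the eigenspaces and
-- density of `W`.
theorem norm_le_of_diagonal (T : H →L[ℂ] H) (φ : ℝ → ℝ) {C : ℝ} (hC : 0 ≤ C)
    (hT : ∀ r : ℝ, 0 ≤ r → ∀ w ∈ ρ.eig r, T w = (φ r : ℂ) • (w : H))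
    (hφ : ∀ r : ℝ, 0 ≤ r → |φ r| ≤ C) : ‖T‖ ≤ C := by
  have hT' : ∀ μ, ∀ w ∈ ρ.eig μ, T w = (φ μ.re : ℂ) • (w : H) ∧ (w = 0 ∨ 0 ≤ μ.re) := by
    intro μ w hw
    by_cases h0 : w = 0
    · simp [h0]
    · obtain ⟨r, hr, rfl⟩ := ρ.exists_real_of_mem_eig hw h0
      exact ⟨hT r hr w hw, .inr hr⟩
  have h1 : ∀ w : W, ‖T w‖ ≤ C * ‖w‖ := by
    refine ρ.norm_le_of_homogeneous ((T : H →ₗ[ℂ] H) ∘ₗ W.subtype) 0 hC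
      (fun μ w hw => ⟨(φ μ.re : ℂ) • w, ?_, (hT' μ w hw).1⟩) fun μ w hw => ?_
    · rw [sub_zero]
      exact Submodule.smul_mem _ _ hw
    · change ‖T w‖ ≤ _
      obtain ⟨h1, rfl | h2⟩ := hT' μ w hw
      · simp
      · rw [h1, norm_smul, Complex.norm_real, Real.norm_eq_abs]
        exact mul_le_mul_of_nonneg_right (hφ _ h2) (norm_nonneg _)
  refine ContinuousLinearMap.opNorm_le_bound _ hC fun x => ?_
  exact hW.denseRange_val.induction_on (p := fun x => ‖T x‖ ≤ C * ‖x‖) x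
    (isClosed_le (by fun_prop) (by fun_prop)) h1

theorem one_sub_resolvent_pow_apply {r : ℝ} {w : W} (hw : w ∈ ρ.eig r) (N : ℕ) :
    ((1 - ρ.resolvent) ^ N) (w : H) = (((1 - (1 + r)⁻¹) ^ N : ℝ) : ℂ) • (w : H) := by
  induction N with
  | zero => simp
  | succ N ih =>
    rw [pow_succ, ContinuousLinearMap.mul_def, ContinuousLinearMap.comp_apply, sub_apply,
      ρ.resolvent_apply hW, ρ.resolventW_apply_eig hw, one_apply_eq_self]
    have e : (w : H) - (((1 + (r : ℂ))⁻¹ • w : W) : H) = (1 - (1 + (r : ℂ))⁻¹) • (w : H) := by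
      rw [sub_smul, one_smul]; rfl
    rw [e, map_smul, ih, smul_smul, pow_succ]
    push_cast
    rw [mul_comm]

/-- The scale of Sobolev spaces of `L_0`. -/
def scale : RegularizedScale H where
  R := ρ.resolvent
  J N := 1 - (1 - ρ.resolvent) ^ N
  Q N := ∑ i ∈ Finset.range N, (1 - ρ.resolvent) ^ i
  J_eq N := by
    have := mul_neg_geom_sum (1 - ρ.resolvent) N
    rw [sub_sub_cancel] at this
    exact this.symm
  comm N := by
    have h1 : Commute ρ.resolvent (1 - ρ.resolvent) :=
      (Commute.one_right _).sub_right (Commute.refl _)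
    exact (Commute.sum_right _ _ _ fun i _ => h1.pow_right i).eq
  symm N x y := by
    have h1 : IsSelfAdjoint (1 - (1 - ρ.resolvent) ^ N) :=
      (IsSelfAdjoint.one _).sub (((IsSelfAdjoint.one _).sub (ρ.isSelfAdjoint_resolvent hW)).pow N)
    exact ContinuousLinearMap.isSelfAdjoint_iff_isSymmetric.1 h1 x y
  norm_J_le N := by
    refine ρ.norm_le_of_diagonal hW _ (fun r => 1 - (1 - (1 + r)⁻¹) ^ N) zero_le_one
      (fun r _ w hw => ?_) fun r hr => ?_
    · rw [sub_apply, ρ.one_sub_resolvent_pow_apply hW hw, one_apply_eq_self]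
      push_cast
      rw [sub_smul, one_smul]
    · have h1 : (1 + r)⁻¹ ≤ 1 := inv_le_one_of_one_le₀ (by linarith)
      have h2 : 0 ≤ (1 + r)⁻¹ := by positivity
      have h3 : 0 ≤ (1 - (1 + r)⁻¹) ^ N := pow_nonneg (by linarith) N
      have h4 : (1 - (1 + r)⁻¹) ^ N ≤ 1 := pow_le_one₀ (by linarith) (by linarith)
      rw [abs_le]; constructor <;> linarith
  tendsto_zero := by
    have h1 : ∀ N : ℕ, ‖(1 - (1 - (1 - ρ.resolvent) ^ (N + 1))) * ρ.resolvent‖ ≤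
        1 / ((N : ℝ) + 1) := fun N => by
      refine ρ.norm_le_of_diagonal hW _ (fun r => (1 - (1 + r)⁻¹) ^ (N + 1) * (1 + r)⁻¹)
        (by positivity) (fun r _ w hw => ?_) fun r hr => ?_
      · rw [sub_sub_cancel, ContinuousLinearMap.mul_def, ContinuousLinearMap.comp_apply,
          ρ.resolvent_apply hW, ρ.resolventW_apply_eig hw, Submodule.coe_smul, map_smul,
          ρ.one_sub_resolvent_pow_apply hW hw, smul_smul]
        push_cast
        rw [mul_comm]
      · set x := (1 + r)⁻¹
        have hx1 : x ≤ 1 := inv_le_one_of_one_le₀ (by linarith)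
        have hx0 : 0 ≤ x := by positivity
        have hx2 : 0 ≤ (1 - x) ^ (N + 1) := pow_nonneg (by linarith) _
        rw [abs_of_nonneg (by positivity), le_div_iff₀ (by positivity)]
        -- Bernoulli bounds `(N + 1) x` by `(1 + x) ^ (N + 1)`, which combines with `(1 - x) ^ (N +
        -- 1)` to a power of `1 - x² ≤ 1`.
        have h2 := one_add_mul_le_pow (by linarith : -2 ≤ x) (N + 1)
        calc (1 - x) ^ (N + 1) * x * (N + 1) ≤ (1 - x) ^ (N + 1) * (1 + x) ^ (N + 1) := by
              rw [mul_assoc]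
              refine mul_le_mul_of_nonneg_left ?_ hx2
              push_cast at h2
              linarith
          _ = (1 - x ^ 2) ^ (N + 1) := by rw [← mul_pow]; ring
          _ ≤ 1 := pow_le_one₀ (by nlinarith) (by nlinarith)
    rw [← tendsto_add_atTop_iff_nat 1]
    exact squeeze_zero (fun _ => norm_nonneg _) h1 tendsto_one_div_add_atTop_nhds_zero_nat
  injective := ρ.resolvent_injective hW
  dense := ρ.dense_resolvent hW

end UnitaryPositiveEnergyRep

/-- Rapidly decreasing sequences. -/
def IsRapidlyDecreasing (a : ℤ → ℂ) : Prop :=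
  ∀ k : ℕ, Summable fun n => ‖a n‖ * (1 + |(n : ℝ)|) ^ k

/-- Continuous families of uniformly rapidly decreasing sequences. -/
structure IsRapidlyDecreasingPath (a : ℝ → ℤ → ℂ) : Prop where
  continuous : ∀ n, Continuous fun t => a t n
  bound : ∀ k : ℕ, ∃ u : ℤ → ℝ, Summable u ∧ ∀ t n, ‖a t n‖ * (1 + |(n : ℝ)|) ^ k ≤ u n

theorem IsRapidlyDecreasingPath.apply {a : ℝ → ℤ → ℂ} (ha : IsRapidlyDecreasingPath a) (t : ℝ) :
    IsRapidlyDecreasing (a t) := fun k => by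
  obtain ⟨u, hu, hle⟩ := ha.bound k
  exact Summable.of_nonneg_of_le (fun n => by positivity) (hle t) hu

theorem IsRapidlyDecreasing.const {a : ℤ → ℂ} (ha : IsRapidlyDecreasing a) :
    IsRapidlyDecreasingPath fun _ => a where
  continuous _ := continuous_const
  bound k := ⟨_, ha k, fun _ _ => le_rfl⟩

namespace UnitaryPositiveEnergyRep

variable {H : Type*} [NormedAddCommGroup H] [InnerProductSpace ℂ H] [CompleteSpace H] {c : ℝ}
  {W : Submodule ℂ H} (ρ : UnitaryPositiveEnergyRep c W)

/-- The bounded operator `(1 + L_0) ^ k L_n (1 + L_0) ^ (-k-1)` on `H`. -/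
def Lop (k : ℕ) (n : ℤ) : H →L[ℂ] H := extend (ρ.LW k n)

/-- The bounded operator `(1 + L_0) ^ k (∑ n, a n L_n) (1 + L_0) ^ (-k-1)` on `H`. -/
def Kop (k : ℕ) (a : ℤ → ℂ) : H →L[ℂ] H := ∑' n, a n • ρ.Lop k n

variable (hW : Dense (W : Set H)) (hc : 0 ≤ c)
include hW hc

theorem Lop_apply (k : ℕ) (n : ℤ) (w : W) : ρ.Lop k n w = ρ.LW k n w :=
  extend_apply hW (ρ.norm_LW_le hc k n) w

theorem norm_Lop_le (k : ℕ) (n : ℤ) : ‖ρ.Lop k n‖ ≤ (1 + c) * (1 + |(n : ℝ)|) ^ (k + 2) :=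
  norm_extend_le hW (by positivity) (ρ.norm_LW_le hc k n)

theorem norm_smul_Lop_le (a : ℤ → ℂ) (k : ℕ) (n : ℤ) :
    ‖a n • ρ.Lop k n‖ ≤ (1 + c) * (‖a n‖ * (1 + |(n : ℝ)|) ^ (k + 2)) := by
  rw [norm_smul]
  calc ‖a n‖ * ‖ρ.Lop k n‖ ≤ ‖a n‖ * ((1 + c) * (1 + |(n : ℝ)|) ^ (k + 2)) :=
        mul_le_mul_of_nonneg_left (ρ.norm_Lop_le hW hc k n) (norm_nonneg _)
    _ = _ := by ring

theorem resolvent_mul_Lop (k : ℕ) (n : ℤ) :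
    ρ.resolvent * ρ.Lop (k + 1) n = ρ.Lop k n * ρ.resolvent := by
  refine ext_of_dense hW fun w => ?_
  simp only [ContinuousLinearMap.mul_def, ContinuousLinearMap.comp_apply]
  rw [ρ.Lop_apply hW hc, ρ.resolvent_apply hW, ρ.resolvent_apply hW, ρ.Lop_apply hW hc]
  congr 1
  simp only [LW, pow_succ' ρ.energyW k, pow_succ ρ.resolventW (k + 1), Module.End.mul_apply,
    ρ.resolventW_energyW]

variable {a : ℤ → ℂ} (ha : IsRapidlyDecreasing a)
include ha

theorem summable_norm_smul_Lop (k : ℕ) : Summable fun n => ‖a n • ρ.Lop k n‖ :=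
  Summable.of_nonneg_of_le (fun _ => norm_nonneg _) (ρ.norm_smul_Lop_le hW hc a k)
    ((ha (k + 2)).mul_left _)

theorem hasSum_Kop (k : ℕ) : HasSum (fun n => a n • ρ.Lop k n) (ρ.Kop k a) :=
  (ρ.summable_norm_smul_Lop hW hc ha k).of_norm.hasSum

theorem hasSum_Kop_apply (k : ℕ) (w : W) :
    HasSum (fun n => a n • (ρ.LW k n w : H)) (ρ.Kop k a w) := by
  have := (ρ.hasSum_Kop hW hc ha k).mapL (ContinuousLinearMap.apply ℂ H (w : H))
  simpa [ρ.Lop_apply hW hc] using this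

theorem resolvent_mul_Kop (k : ℕ) : ρ.resolvent * ρ.Kop (k + 1) a = ρ.Kop k a * ρ.resolvent := by
  refine ((ρ.hasSum_Kop hW hc ha (k + 1)).mul_left ρ.resolvent).unique ?_
  have := (ρ.hasSum_Kop hW hc ha k).mul_right ρ.resolvent
  simpa only [mul_smul_comm, smul_mul_assoc, ρ.resolvent_mul_Lop hW hc] using this

/-- Evaluating at `Λ w` trades one `Λ⁻¹` away and leaves `Λ ^ k L_n Λ ^ (-k)` acting on `w`, the
form in which levels `k` and `0` can be compared. -/
theorem hasSum_Kop_energyW (k : ℕ) (w : W) :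
    HasSum (fun n => a n • (((ρ.energyW ^ k * ρ.L n * ρ.resolventW ^ k) w : W) : H))
      (ρ.Kop k a (ρ.energyW w)) := by
  have h1 := ρ.hasSum_Kop_apply hW hc ha k (ρ.energyW w)
  have e : ∀ n, ρ.LW k n (ρ.energyW w) = (ρ.energyW ^ k * ρ.L n * ρ.resolventW ^ k) w := fun n => by
    rw [LW, pow_succ]
    simp only [Module.End.mul_apply, ρ.resolventW_energyW]
  simpa only [e] using h1

theorem hasSum_Kop_zero (w : W) :
    HasSum (fun n => a n • (ρ.L n w : H)) (ρ.Kop 0 a (ρ.energyW w)) := by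
  simpa using ρ.hasSum_Kop_energyW hW hc ha 0 w

theorem norm_Kop_sub_le (k : ℕ) (w : W) :
    ‖ρ.Kop k a (ρ.energyW w) - ρ.Kop 0 a (ρ.energyW w)‖ ≤
      (∑' n, k * (1 + c) * (‖a n‖ * (1 + |(n : ℝ)|) ^ (k + 2))) * ‖w‖ := by
  have h1 := (ρ.hasSum_Kop_energyW hW hc ha k w).sub (ρ.hasSum_Kop_zero hW hc ha w)
  have h2 := ((ha (k + 2)).mul_left (k * (1 + c))).hasSum.mul_right ‖w‖
  refine h1.norm_le_of_bounded h2 fun n => ?_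
  rw [← smul_sub, norm_smul]
  calc ‖a n‖ * ‖(((ρ.energyW ^ k * ρ.L n * ρ.resolventW ^ k) w : W) : H) - ρ.L n w‖
      ≤ ‖a n‖ * (k * (1 + c) * (1 + |(n : ℝ)|) ^ (k + 2) * ‖w‖) :=
        mul_le_mul_of_nonneg_left (ρ.norm_conj_sub_le hc k n w) (norm_nonneg _)
    _ = _ := by ring

omit ha in
/-- A family which is quasi-dissipative on `W` is quasi-dissipative on the scale. -/
theorem exists_isDissipativeFamily {a : ℝ → ℤ → ℂ} (ha : IsRapidlyDecreasingPath a) {κ₀ : ℝ}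
    (hκ₀ : 0 ≤ κ₀)
    (hdiss : ∀ t (w : W), (⟪ρ.Kop 0 (a t) (ρ.energyW w), (w : H)⟫_ℂ).re ≤ κ₀ * ‖w‖ ^ 2) :
    ∃ κ M, IsDissipativeFamily (ρ.scale hW) (fun k t => ρ.Kop k (a t)) κ M := by
  choose u hu hle using ha.bound
  have hu0 : ∀ k n, 0 ≤ u k n := fun k n => le_trans (by positivity) (hle k 0 n)
  have hbd : ∀ k t, ‖ρ.Kop k (a t)‖ ≤ ∑' n, (1 + c) * u (k + 2) n := fun k t =>
    tsum_of_norm_bounded ((hu (k + 2)).mul_left (1 + c)).hasSum fun n =>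
      (ρ.norm_smul_Lop_le hW hc (a t) k n).trans
        (mul_le_mul_of_nonneg_left (hle _ t n) (by positivity))
  -- The growth rate at level `k` is that at level `0` plus the bound for the commutator with `Λ ^
  -- k`.
  refine ⟨fun k => κ₀ + ∑' n, k * (1 + c) * u (k + 2) n,
    fun k => (∑' n, (1 + c) * u (k + 2) n).toNNReal, ⟨fun k => ?_, fun k t => ?_,
    fun k t => ρ.resolvent_mul_Kop hW hc (ha.apply t) k, fun k => ?_, fun k t v => ?_⟩⟩
  · refine continuous_tsum (fun n => (ha.continuous n).smul continuous_const)
      ((hu (k + 2)).mul_left (1 + c)) fun n t => (ρ.norm_smul_Lop_le hW hc (a t) k n).trans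
        (mul_le_mul_of_nonneg_left (hle _ t n) (by positivity))
  · exact (hbd k t).trans (Real.le_coe_toNNReal _)
  · exact add_nonneg hκ₀ (tsum_nonneg fun n => mul_nonneg (by positivity) (hu0 _ n))
  · change (⟪ρ.Kop k (a t) v, ρ.resolvent v⟫_ℂ).re ≤ _ * ‖ρ.resolvent v‖ ^ 2
    refine hW.denseRange_val.induction_on
      (p := fun v => (⟪ρ.Kop k (a t) v, ρ.resolvent v⟫_ℂ).re ≤ _ * ‖ρ.resolvent v‖ ^ 2) v
      (isClosed_le (Complex.continuous_re.comp (by fun_prop)) (by fun_prop)) fun v => ?_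
    obtain ⟨w, rfl⟩ := ρ.energyW_bijective.2 v
    rw [ρ.resolvent_apply hW, ρ.resolventW_energyW]
    have h1 := hdiss t w
    have h2 := ρ.norm_Kop_sub_le hW hc (ha.apply t) k w
    have h3 : ∑' n, k * (1 + c) * (‖a t n‖ * (1 + |(n : ℝ)|) ^ (k + 2)) ≤
        ∑' n, k * (1 + c) * u (k + 2) n :=
      Summable.tsum_le_tsum (fun n => mul_le_mul_of_nonneg_left (hle _ t n) (by positivity))
        ((ha.apply t (k + 2)).mul_left _) ((hu (k + 2)).mul_left _)
    have h4 : (⟪ρ.Kop k (a t) (ρ.energyW w) - ρ.Kop 0 (a t) (ρ.energyW w), (w : H)⟫_ℂ).re ≤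
        (∑' n, k * (1 + c) * u (k + 2) n) * ‖w‖ ^ 2 := by
      refine (re_inner_le_norm (𝕜 := ℂ) _ _).trans ?_
      rw [sq, ← mul_assoc]
      exact mul_le_mul_of_nonneg_right (h2.trans (mul_le_mul_of_nonneg_right h3 (norm_nonneg _)))
        (norm_nonneg _)
    rw [inner_sub_left, Complex.sub_re] at h4
    rw [add_mul]
    change _ ≤ κ₀ * ‖w‖ ^ 2 + _ * ‖w‖ ^ 2
    linarith

end UnitaryPositiveEnergyRep

end VirasoroEvolution

end

/-! ### Identification of the closed operators and of the Sobolev spaces -/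

noncomputable section

namespace VirasoroEvolution

theorem mem_graph_natComp {E : Type*} [AddCommGroup E] [Module ℂ E] (g f : E →ₗ.[ℂ] E) (x z : E) :
    (x, z) ∈ (natComp g f).graph ↔ ∃ y, (x, y) ∈ f.graph ∧ (y, z) ∈ g.graph := by
  simp only [LinearPMap.mem_graph_iff]
  constructor
  · rintro ⟨⟨x', hx1, hx2⟩, rfl, hz⟩
    obtain ⟨y, hy, hyx⟩ := Submodule.mem_map.1 hx1
    have hy' : y = ⟨x', hx2⟩ := Subtype.ext hyx
    subst hy'
    exact ⟨f ⟨x', hx2⟩, ⟨⟨x', hx2⟩, rfl, rfl⟩, ⟨⟨f ⟨x', hx2⟩, hy⟩, rfl, hz⟩⟩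
  · rintro ⟨_, ⟨x', rfl, rfl⟩, y', hy, rfl⟩
    have hx1 : (x' : E) ∈ (g.domain.comap f.toFun).map f.domain.subtype :=
      Submodule.mem_map.2 ⟨x', by change f x' ∈ g.domain; rw [← hy]; exact y'.2, rfl⟩
    refine ⟨⟨x', hx1, x'.2⟩, rfl, ?_⟩
    change g ⟨f ⟨x', x'.2⟩, _⟩ = g y'
    congr 1
    exact Subtype.ext hy.symm

/-- `LinearPMap.closure` leaves a non-closable operator unchanged, so closability has to be checked
before its graph can be described as a closure. -/
theorem mem_graph_closure {E : Type*} [NormedAddCommGroup E] [NormedSpace ℂ E] {f : E →ₗ.[ℂ] E}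
    (hf : ∀ y, (0, y) ∈ closure (f.graph : Set (E × E)) → y = 0) (p : E × E) :
    p ∈ f.closure.graph ↔ p ∈ closure (f.graph : Set (E × E)) := by
  have hc : f.IsClosable := by
    refine ⟨f.graph.topologicalClosure.toLinearPMap, ?_⟩
    rw [Submodule.toLinearPMap_graph_eq]
    rintro ⟨x, y⟩ hxy h0
    have h0' : x = 0 := h0
    subst h0'
    exact hf y hxy
  rw [← hc.graph_closure_eq_closure_graph]
  rfl

namespace UnitaryPositiveEnergyRep

variable {H : Type*} [NormedAddCommGroup H] [InnerProductSpace ℂ H] [CompleteSpace H] {c : ℝ}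
  {W : Submodule ℂ H} (ρ : UnitaryPositiveEnergyRep c W) (hW : Dense (W : Set H))
include hW

/-- The graph of `L_0` on `W` consists of the pairs `(R v, v - R v)` with `v ∈ W`. As `R` is bounded
and `W` is dense, its closure consists of the same pairs with `v ∈ H`, and injectivity of `R` gives
closability. -/
theorem mem_graph_one_add_closedL0 (x y : H) :
    (x, y) ∈ ((LinearMap.id : H →ₗ[ℂ] H) +ᵥ ρ.closedL0).graph ↔ x = ρ.resolvent y := by
  set A : H →ₗ.[ℂ] H := ⟨W, W.subtype ∘ₗ ρ.L 0⟩ with hA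
  have hAW : ∀ w : W, (w : H) = ρ.resolvent (w + ρ.L 0 w) := fun w => by
    have h1 : (w : H) + ρ.L 0 w = ((ρ.energyW w : W) : H) := rfl
    rw [h1, ρ.resolvent_apply hW, ρ.resolventW_energyW]
  have hcl : ∀ p ∈ closure (A.graph : Set (H × H)), p.1 = ρ.resolvent (p.1 + p.2) := by
    intro p hp
    refine closure_minimal (t := {p : H × H | p.1 = ρ.resolvent (p.1 + p.2)}) ?_
      (isClosed_eq (by fun_prop) (by fun_prop)) hp
    intro q hq
    obtain ⟨w, hw1, hw2⟩ := (LinearPMap.mem_graph_iff _).1 hq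
    have hw2' : ((ρ.L 0 w : W) : H) = q.2 := hw2
    change q.1 = ρ.resolvent (q.1 + q.2)
    rw [← hw1, ← hw2']
    exact hAW w
  have hgr : ∀ p : H × H, p ∈ ρ.closedL0.graph ↔ p.1 = ρ.resolvent (p.1 + p.2) := by
    intro p
    change p ∈ A.closure.graph ↔ _
    rw [mem_graph_closure]
    · refine ⟨hcl p, fun hp => ?_⟩
      have h1 : ∀ v : H, (ρ.resolvent v, v - ρ.resolvent v) ∈ closure (A.graph : Set (H × H)) := by
        intro v
        refine hW.denseRange_val.induction_on (p := fun v : H =>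
          (ρ.resolvent v, v - ρ.resolvent v) ∈ closure (A.graph : Set (H × H))) v
          (isClosed_closure.preimage (by fun_prop)) fun v => subset_closure ?_
        obtain ⟨w, rfl⟩ := ρ.energyW_bijective.2 v
        rw [ρ.resolvent_apply hW, ρ.resolventW_energyW]
        refine (LinearPMap.mem_graph_iff _).2 ⟨w, rfl, ?_⟩
        change ((ρ.L 0 w : W) : H) = (w : H) + ρ.L 0 w - w
        abel
      have h2 := h1 (p.1 + p.2)
      rwa [← hp, add_sub_cancel_left] at h2
    · intro y hy
      have h1 := hcl _ hy
      simp only [zero_add] at h1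
      exact ρ.resolvent_injective hW (by rw [← h1, map_zero])
  rw [LinearPMap.mem_graph_iff]
  constructor
  · rintro ⟨x', hx', hy⟩
    have h1 := (hgr (x', ρ.closedL0 x')).1 (LinearPMap.mem_graph _ _)
    have h2 : (x' : H) + ρ.closedL0 x' = y := hy
    rw [h2] at h1
    exact hx'.symm.trans h1
  · intro hx
    have h1 : (x, y - x) ∈ ρ.closedL0.graph := (hgr _).2 (by simpa using hx)
    obtain ⟨x', hx', hy⟩ := (LinearPMap.mem_graph_iff _).1 h1
    refine ⟨x', hx', ?_⟩
    change (x' : H) + ρ.closedL0 x' = y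
    rw [hy, hx', add_sub_cancel]

theorem mem_graph_energyPow (n : ℕ) (x y : H) :
    (x, y) ∈ (ρ.energyPow n).graph ↔ x = (ρ.resolvent ^ n) y := by
  induction n generalizing x with
  | zero =>
    change (x, y) ∈ ((LinearMap.id : H →ₗ[ℂ] H).toPMap ⊤).graph ↔ _
    rw [LinearPMap.mem_graph_iff]
    constructor
    · rintro ⟨x', rfl, rfl⟩; rfl
    · intro h; exact ⟨⟨x, trivial⟩, rfl, h⟩
  | succ n ih =>
    change (x, y) ∈ (natComp (ρ.energyPow n) ((LinearMap.id : H →ₗ[ℂ] H) +ᵥ ρ.closedL0)).graph ↔ _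
    rw [mem_graph_natComp, pow_succ']
    simp only [ih, ρ.mem_graph_one_add_closedL0 hW]
    constructor
    · rintro ⟨z, rfl, rfl⟩; rfl
    · intro h; exact ⟨_, h, rfl⟩

theorem incl_eq (n : ℕ) (x : ρ.Sobolev n) :
    Sobolev.incl ρ n x = (ρ.resolvent ^ n) (Sobolev.energy ρ n x) :=
  (ρ.mem_graph_energyPow hW n _ _).1 ((ρ.energyPow n).mem_graph x)

/-- The isometry `(1 + L_0) ^ n` of `H_n` onto `H`. -/
def sobolevIsometry (n : ℕ) : ρ.Sobolev n ≃ₗᵢ[ℂ] H :=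
  LinearIsometryEquiv.mk (LinearEquiv.ofBijective (Sobolev.energy ρ n)
    ⟨Sobolev.energy_injective ρ n, fun y => by
      obtain ⟨x, -, hy⟩ := (LinearPMap.mem_graph_iff _).1
        ((ρ.mem_graph_energyPow hW n ((ρ.resolvent ^ n) y) y).2 rfl)
      exact ⟨x, hy⟩⟩) fun _ => rfl

theorem energy_inclSucc (n : ℕ) (y : ρ.Sobolev (n + 1)) :
    Sobolev.energy ρ n (Sobolev.inclSucc ρ n y) = ρ.resolvent (Sobolev.energy ρ (n + 1) y) := by
  refine (ρ.scale hW).injective_pow n ?_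
  change (ρ.resolvent ^ n) _ = (ρ.resolvent ^ n) _
  rw [← ρ.incl_eq hW]
  have h1 : Sobolev.incl ρ n (Sobolev.inclSucc ρ n y) = Sobolev.incl ρ (n + 1) y := rfl
  rw [h1, ρ.incl_eq hW, pow_succ]
  rfl

variable (hc : 0 ≤ c)
include hc

/-- The smeared operator on `W` has graph `{(R v, K v) | v ∈ W}`, and density of `W` allows all `v ∈
H` after closing. Closability is read off from the semigroup: a limit pair `(0, y)` would make `y`
the derivative at `0` of the orbit of `0`. -/
theorem mem_graph_op (X : VectorField) (hX : IsRapidlyDecreasing fun n => Complex.I * X.fourier n)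
    {κ : ℕ → ℝ} {M : ℕ → NNReal}
    (h : IsDissipativeFamily (ρ.scale hW)
      (fun k _ => ρ.Kop k fun n => Complex.I * X.fourier n) κ M) (p : H × H) :
    p ∈ (ρ.op X).graph ↔
      p ∈ closure (range fun v => (ρ.resolvent v, ρ.Kop 0 (fun n => Complex.I * X.fourier n) v)) := by
  set K := ρ.Kop 0 (fun n => Complex.I * X.fourier n)
  have h1 : closure ((ρ.smearedGraph X).toLinearPMap.graph : Set (H × H)) =
      closure (range fun v => (ρ.resolvent v, K v)) := by
    refine Subset.antisymm (closure_mono fun p hp => ?_) ?_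
    · obtain ⟨w, hw, hs⟩ := (ρ.mem_graph_smeared X p).1 hp
      refine ⟨ρ.energyW w, Prod.ext ?_ ?_⟩
      · change ρ.resolvent (ρ.energyW w) = p.1
        rw [ρ.resolvent_apply hW, ρ.resolventW_energyW, hw]
      · exact (ρ.hasSum_Kop_zero hW hc hX w).unique hs
    · refine closure_minimal ?_ isClosed_closure
      rintro _ ⟨v, rfl⟩
      refine hW.denseRange_val.induction_on (p := fun v : H =>
        (ρ.resolvent v, K v) ∈ closure ((ρ.smearedGraph X).toLinearPMap.graph : Set (H × H))) v
        (isClosed_closure.preimage (by fun_prop)) fun v => subset_closure ?_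
      obtain ⟨w, rfl⟩ := ρ.energyW_bijective.2 v
      rw [ρ.resolvent_apply hW, ρ.resolventW_energyW]
      exact (ρ.mem_graph_smeared X _).2 ⟨w, rfl, ρ.hasSum_Kop_zero hW hc hX w⟩
  rw [op, mem_graph_closure, h1]
  intro y hy
  rw [h1] at hy
  have h2 := (h.mem_closure_iff_tendsto 0 0 y).1 hy
  simp only [map_zero, sub_zero, smul_zero] at h2
  exact tendsto_nhds_unique h2 tendsto_const_nhds

omit hc in
theorem mem_graph_opPart (n : ℕ) (X : VectorField) (x y : ρ.Sobolev n) :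
    (x, y) ∈ (ρ.opPart n X).graph ↔ ((ρ.resolvent ^ n) (ρ.sobolevIsometry hW n x),
      (ρ.resolvent ^ n) (ρ.sobolevIsometry hW n y)) ∈ (ρ.op X).graph := by
  rw [opPart, mem_graph_partIn _ Subtype.val_injective, ρ.incl_eq hW, ρ.incl_eq hW]
  rfl

/-- The time-ordered exponentials exist for a path of vector fields with quasi-dissipative
operators. -/
theorem timeOrderedExponentialExists_of_dissipative (X : ℝ → VectorField) {a : ℝ → ℤ → ℂ}
    (ha : IsRapidlyDecreasingPath a)
    (haX : ∀ t ∈ Icc (0 : ℝ) 1, a t = fun n => Complex.I * (X t).fourier n) {κ₀ : ℝ}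
    (hκ₀ : 0 ≤ κ₀)
    (hdiss : ∀ t (w : W), (⟪ρ.Kop 0 (a t) (ρ.energyW w), (w : H)⟫_ℂ).re ≤ κ₀ * ‖w‖ ^ 2) :
    TimeOrderedExponentialExists (Sobolev.incl ρ 1) (fun t => ρ.op (X t)) ∧
      ∀ n : ℕ, TimeOrderedExponentialExists (Sobolev.inclSucc ρ n)
        (fun t => ρ.opPart n (X t)) := by
  obtain ⟨κ, M, h⟩ := ρ.exists_isDissipativeFamily hW hc ha hκ₀ hdiss
  have hop : ∀ t ∈ Icc (0 : ℝ) 1, ∀ p, p ∈ (ρ.op (X t)).graph ↔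
      p ∈ closure (range fun v => (ρ.resolvent v, ρ.Kop 0 (a t) v)) := by
    intro t ht p
    have h1 := ha.apply t
    have h2 := h.const t
    rw [haX t ht] at h1 h2 ⊢
    exact ρ.mem_graph_op hW hc (X t) h1 h2 p
  refine ⟨h.timeOrderedExponentialExists 0 (LinearIsometryEquiv.refl ℂ H)
    (ρ.sobolevIsometry hW 1) _ (fun y => ?_) _ fun t ht x y => hop t ht (x, y), fun n => ?_⟩
  · rw [ρ.incl_eq hW, pow_one]; rfl
  · refine h.timeOrderedExponentialExists n (ρ.sobolevIsometry hW n)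
      (ρ.sobolevIsometry hW (n + 1)) _ (ρ.energy_inclSucc hW n) _ fun t ht x y => ?_
    rw [ρ.mem_graph_opPart hW, hop t ht]
    rfl

end UnitaryPositiveEnergyRep

end VirasoroEvolution

end

/-! ### Fourier coefficients: derivatives, parameters and products -/

noncomputable section

namespace VirasoroEvolution

open MeasureTheory

/-- The Fourier coefficients of a `2π`-periodic function. -/
def fc (f : ℝ → ℂ) (n : ℤ) : ℂ := fourierCoeffOn two_pi_pos f n

/-- The function `e^{-inθ}`. -/
def expNeg (n : ℤ) (θ : ℝ) : ℂ := Complex.exp (-(n * θ * Complex.I))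

theorem continuous_expNeg (n : ℤ) : Continuous (expNeg n) := by
  unfold expNeg; fun_prop

theorem norm_expNeg (n : ℤ) (θ : ℝ) : ‖expNeg n θ‖ = 1 := by
  have e : -((n : ℂ) * θ * Complex.I) = ((-(n * θ) : ℝ) : ℂ) * Complex.I := by push_cast; ring
  rw [expNeg, e, Complex.norm_exp_ofReal_mul_I]

theorem fc_eq_integral (f : ℝ → ℂ) (n : ℤ) :
    fc f n = (1 / (2 * π)) • ∫ θ in (0 : ℝ)..(2 * π), expNeg n θ * f θ := by
  rw [fc, fourierCoeffOn_eq_integral, sub_zero]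
  congr 1
  refine intervalIntegral.integral_congr fun θ _ => ?_
  simp only [fourier_coe_apply, smul_eq_mul, expNeg]
  congr 2
  push_cast
  have : (π : ℂ) ≠ 0 := by exact_mod_cast pi_ne_zero
  field_simp

theorem norm_fc_le {f : ℝ → ℂ} {C : ℝ} (hf : ∀ θ ∈ Icc 0 (2 * π), ‖f θ‖ ≤ C) (n : ℤ) :
    ‖fc f n‖ ≤ C := by
  rw [fc_eq_integral, norm_smul, Real.norm_of_nonneg (by positivity)]
  have h1 := intervalIntegral.norm_integral_le_of_norm_le_const (a := 0) (b := 2 * π) (C := C)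
    (f := fun θ => expNeg n θ * f θ) fun θ hθ => by
      rw [uIoc_of_le two_pi_pos.le] at hθ
      rw [norm_mul, norm_expNeg, one_mul]
      exact hf θ (Ioc_subset_Icc_self hθ)
  rw [sub_zero, abs_of_pos two_pi_pos] at h1
  rw [one_div, inv_mul_le_iff₀ two_pi_pos]
  linarith

theorem fc_const_zero (C : ℂ) : fc (fun _ => C) 0 = C := by
  rw [fc_eq_integral]
  have : (π : ℂ) ≠ 0 := by exact_mod_cast pi_ne_zero
  simp [expNeg]
  field_simp

theorem intervalIntegrable_expNeg_mul {f : ℝ → ℂ} (hf : Continuous f) (n : ℤ) :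
    IntervalIntegrable (fun θ => expNeg n θ * f θ) volume 0 (2 * π) :=
  ((continuous_expNeg n).mul hf).intervalIntegrable _ _

theorem fc_add {f g : ℝ → ℂ} (hf : Continuous f) (hg : Continuous g) (n : ℤ) :
    fc (fun θ => f θ + g θ) n = fc f n + fc g n := by
  simp only [fc_eq_integral, mul_add]
  rw [intervalIntegral.integral_add (intervalIntegrable_expNeg_mul hf n)
    (intervalIntegrable_expNeg_mul hg n), smul_add]

theorem fc_const_mul (f : ℝ → ℂ) (C : ℂ) (n : ℤ) : fc (fun θ => C * f θ) n = C * fc f n :=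
  fourierCoeffOn.const_mul f C n two_pi_pos

theorem fc_neg (f : ℝ → ℂ) (n : ℤ) : fc (fun θ => -f θ) n = -fc f n := by
  simpa using fc_const_mul f (-1) n

theorem fc_sub {f g : ℝ → ℂ} (hf : Continuous f) (hg : Continuous g) (n : ℤ) :
    fc (fun θ => f θ - g θ) n = fc f n - fc g n := by
  simp only [sub_eq_add_neg]
  have h1 := fc_add hf (g := fun θ => -g θ) hg.neg n
  rw [h1, fc_neg]

theorem fc_deriv {f f' : ℝ → ℂ} (hf : ∀ θ, HasDerivAt f (f' θ) θ) (hf' : Continuous f')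
    (hp : Function.Periodic f (2 * π)) (n : ℤ) : fc f' n = Complex.I * n * fc f n := by
  have hb : f (2 * π) = f 0 := by simpa using hp 0
  by_cases hn : n = 0
  · subst hn
    rw [fc_eq_integral]
    have h1 := intervalIntegral.integral_eq_sub_of_hasDerivAt (a := 0) (b := 2 * π)
      (fun θ _ => hf θ) (hf'.intervalIntegrable _ _)
    rw [hb, sub_self] at h1
    simp [expNeg, h1]
  · have h1 := fourierCoeffOn_of_hasDerivAt two_pi_pos hn (fun θ _ => hf θ)
      (hf'.intervalIntegrable _ _)
    have hn' : (n : ℂ) ≠ 0 := by exact_mod_cast hn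
    have hπ : (π : ℂ) ≠ 0 := by exact_mod_cast pi_ne_zero
    rw [fc, fc, h1, hb, sub_self, mul_zero, zero_sub]
    push_cast
    field_simp [Complex.I_ne_zero]
    ring

theorem fc_conj_neg (f : ℝ → ℝ) (n : ℤ) :
    fc (fun θ => (f θ : ℂ)) (-n) = (starRingEnd ℂ) (fc (fun θ => (f θ : ℂ)) n) := by
  rw [fc_eq_integral, fc_eq_integral, ← Complex.coe_smul, ← Complex.coe_smul, smul_eq_mul,
    smul_eq_mul, map_mul, Complex.conj_ofReal]
  congr 1
  rw [intervalIntegral.integral_of_le two_pi_pos.le, intervalIntegral.integral_of_le two_pi_pos.le,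
    ← integral_conj]
  refine integral_congr_ae (.of_forall fun θ => ?_)
  simp only [map_mul, Complex.conj_ofReal, expNeg, ← Complex.exp_conj]
  congr 2
  simp

theorem continuous_fc {G : ℝ → ℝ → ℂ} (hG : Continuous (Function.uncurry G)) (n : ℤ) :
    Continuous fun s => fc (G s) n := by
  simp only [fc_eq_integral]
  have h1 : Continuous fun s => ∫ θ in (0 : ℝ)..(2 * π), expNeg n θ * G s θ :=
    intervalIntegral.continuous_parametric_intervalIntegral_of_continuous'
      (f := fun s θ => expNeg n θ * G s θ)
      (((continuous_expNeg n).comp continuous_snd).mul hG) _ _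
  exact h1.const_smul (1 / (2 * π) : ℝ)

theorem hasDerivAt_fc {G G' : ℝ → ℝ → ℂ} (hG : Continuous (Function.uncurry G))
    (hG' : Continuous (Function.uncurry G'))
    (hd : ∀ s θ, HasDerivAt (fun s => G s θ) (G' s θ) s) (n : ℤ) (s : ℝ) :
    HasDerivAt (fun s => fc (G s) n) (fc (G' s) n) s := by
  simp only [fc_eq_integral]
  have hc : ∀ s, Continuous (G s) := fun s => hG.comp (continuous_const.prodMk continuous_id)
  have hc' : ∀ s, Continuous (G' s) := fun s => hG'.comp (continuous_const.prodMk continuous_id)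
  obtain ⟨B, hB⟩ := ((isCompact_Icc (a := s - 1) (b := s + 1)).prod
    (isCompact_Icc (a := 0) (b := 2 * π))).exists_bound_of_continuousOn hG'.continuousOn
  have h1 := (intervalIntegral.hasDerivAt_integral_of_dominated_loc_of_deriv_le
    (F := fun s θ => expNeg n θ * G s θ) (F' := fun s θ => expNeg n θ * G' s θ)
    (bound := fun _ => B) (Icc_mem_nhds (by linarith : s - 1 < s) (by linarith : s < s + 1))
    (.of_forall fun s => ((continuous_expNeg n).mul (hc s)).aestronglyMeasurable)
    (intervalIntegrable_expNeg_mul (hc s) n)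
    ((continuous_expNeg n).mul (hc' s)).aestronglyMeasurable (.of_forall fun θ hθ s' hs' => by
      rw [uIoc_of_le two_pi_pos.le] at hθ
      rw [norm_mul, norm_expNeg, one_mul]
      exact hB (s', θ) ⟨hs', Ioc_subset_Icc_self hθ⟩)
    intervalIntegrable_const (.of_forall fun θ _ s' _ => (hd s' θ).const_mul _)).2
  exact h1.const_smul (1 / (2 * π) : ℝ)

/-- The Fourier series of a periodic function. -/
theorem hasSum_fc {g : ℝ → ℂ} (hg : Continuous g) (hgp : Function.Periodic g (2 * π))
    (hgs : Summable (fc g)) (θ : ℝ) : HasSum (fun n => fc g n * expNeg (-n) θ) (g θ) := by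
  have hT : Fact (0 < 2 * π) := ⟨two_pi_pos⟩
  have hπ : (π : ℂ) ≠ 0 := by exact_mod_cast pi_ne_zero
  let G : C(AddCircle (2 * π), ℂ) := ⟨hgp.lift, continuous_coinduced_dom.2 hg⟩
  have hG : ∀ θ : ℝ, G (θ : AddCircle (2 * π)) = g θ := fun θ => rfl
  have h1 : ∀ n, fourierCoeff G n = fc g n := fun n => by
    rw [fourierCoeff_eq_intervalIntegral _ _ 0, zero_add, fc_eq_integral]
    congr 1
    refine intervalIntegral.integral_congr fun θ _ => ?_
    simp only [fourier_coe_apply, smul_eq_mul, expNeg, hG]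
    congr 2
    push_cast
    field_simp
  have h3 := has_pointwise_sum_fourier_series_of_summable (f := G)
    (by rw [show fourierCoeff (⇑G) = fc g from funext h1]; exact hgs) (θ : AddCircle (2 * π))
  rw [hG] at h3
  convert h3 using 2 with n
  rw [h1, smul_eq_mul, fourier_coe_apply, expNeg]
  congr 2
  push_cast
  field_simp

/-- The product of periodic functions corresponds to the convolution of Fourier coefficients. -/
theorem hasSum_fc_mul {f g : ℝ → ℂ} (hf : Continuous f) (hg : Continuous g)
    (hgp : Function.Periodic g (2 * π)) (hgs : Summable (fc g)) (p : ℤ) :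
    HasSum (fun n => fc f (p - n) * fc g n) (fc (fun θ => f θ * g θ) p) := by
  obtain ⟨B, hB⟩ := (isCompact_Icc (a := 0) (b := 2 * π)).exists_bound_of_continuousOn
    hf.continuousOn
  have h1 := intervalIntegral.hasSum_integral_of_dominated_convergence (μ := volume) (a := 0)
    (b := 2 * π) (F := fun (n : ℤ) θ => fc g n * (expNeg (p - n) θ * f θ))
    (f := fun θ => expNeg p θ * (f θ * g θ)) (fun n _ => ‖fc g n‖ * B)
    (fun n => (continuous_const.mul ((continuous_expNeg _).mul hf)).aestronglyMeasurable)
    (fun n => .of_forall fun θ hθ => by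
      rw [uIoc_of_le two_pi_pos.le] at hθ
      rw [norm_mul, norm_mul, norm_expNeg, one_mul]
      exact mul_le_mul_of_nonneg_left (hB θ (Ioc_subset_Icc_self hθ)) (norm_nonneg _))
    (.of_forall fun θ _ => hgs.norm.mul_right B) intervalIntegrable_const
    (.of_forall fun θ _ => by
      have h2 := (hasSum_fc hg hgp hgs θ).mul_left (expNeg p θ * f θ)
      rw [mul_assoc] at h2
      refine h2.congr_fun fun n => ?_
      have h3 : expNeg (p - n) θ = expNeg p θ * expNeg (-n) θ := by
        rw [expNeg, expNeg, expNeg, ← Complex.exp_add]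
        congr 1
        push_cast
        ring
      rw [h3]
      ring)
  rw [fc_eq_integral (fun θ => f θ * g θ)]
  refine (h1.const_smul (1 / (2 * π) : ℝ)).congr_fun fun n => ?_
  rw [fc_eq_integral f, intervalIntegral.integral_const_mul, mul_comm, mul_smul_comm]

end VirasoroEvolution

end

/-! ### Rapid decrease of the Fourier coefficients of smooth families -/

noncomputable section

namespace VirasoroEvolution

theorem summable_inv_one_add_abs_sq : Summable fun n : ℤ => ((1 + |(n : ℝ)|) ^ 2)⁻¹ := by
  have h1 : Summable fun n : ℤ => 1 / (n : ℝ) ^ 2 :=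
    Real.summable_one_div_int_pow.2 one_lt_two
  refine Summable.of_nonneg_of_le (fun n => by positivity) (fun n => ?_)
    (h1.add (hasSum_ite_eq (0 : ℤ) (1 : ℝ)).summable)
  by_cases hn : n = 0
  · simp [hn]
  · rw [if_neg hn, add_zero, one_div]
    have : 0 < |(n : ℝ)| := abs_pos.2 (by exact_mod_cast hn)
    rw [← sq_abs (n : ℝ)]
    gcongr
    linarith

section Families

variable {S : Set ℝ} {F : ℝ × ℝ → ℂ}

/-- The partial derivative of a smooth family of functions. -/
theorem exists_contDiffOn_hasDerivAt {E : Type*} [NormedAddCommGroup E] [NormedSpace ℝ E]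
    {F : ℝ × ℝ → E} (hS : UniqueDiffOn ℝ S) (hF : ContDiffOn ℝ ∞ F (S ×ˢ univ)) :
    ∃ F' : ℝ × ℝ → E, ContDiffOn ℝ ∞ F' (S ×ˢ univ) ∧
      ∀ t ∈ S, ∀ θ, HasDerivAt (fun θ => F (t, θ)) (F' (t, θ)) θ := by
  have hU : UniqueDiffOn ℝ (S ×ˢ (univ : Set ℝ)) := hS.prod uniqueDiffOn_univ
  refine ⟨fun p => fderivWithin ℝ F (S ×ˢ univ) p (0, 1),
    (hF.fderivWithin hU (by simp)).clm_apply contDiffOn_const, fun t ht θ => ?_⟩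
  have h1 := ((hF.differentiableOn (by simp)) (t, θ) ⟨ht, mem_univ _⟩).hasFDerivWithinAt
  have h2 : HasDerivAt (fun θ : ℝ => (t, θ)) (0, 1) θ :=
    (hasDerivAt_const θ t).prodMk (hasDerivAt_id θ)
  rw [← hasDerivWithinAt_univ] at h2 ⊢
  exact h1.comp_hasDerivWithinAt θ h2 fun θ _ => ⟨ht, mem_univ _⟩

theorem periodic_of_hasDerivAt {E : Type*} [NormedAddCommGroup E] [NormedSpace ℝ E] {f f' : ℝ → E}
    {T : ℝ} (hd : ∀ θ, HasDerivAt f (f' θ) θ) (hp : Function.Periodic f T) :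
    Function.Periodic f' T := fun θ => by
  have h1 := (hd (θ + T)).comp_add_const θ T
  rw [show (fun θ => f (θ + T)) = f from funext hp] at h1
  exact h1.unique (hd θ)

/-- Induction on the power of `1 + |n|`: one more factor `|n|` is the coefficient of the derivative
in `θ`, which is again a smooth periodic family. Compactness gives uniformity in the parameter. -/
theorem exists_norm_fc_le (hS : UniqueDiffOn ℝ S) {C : Set ℝ} (hC : IsCompact C) (hCS : C ⊆ S)
    (k : ℕ) : ∀ {F : ℝ × ℝ → ℂ}, ContDiffOn ℝ ∞ F (S ×ˢ univ) →
      (∀ t ∈ S, Function.Periodic (fun θ => F (t, θ)) (2 * π)) →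
      ∃ B, ∀ t ∈ C, ∀ n, ‖fc (fun θ => F (t, θ)) n‖ * (1 + |(n : ℝ)|) ^ k ≤ B := by
  induction k with
  | zero =>
    intro F hF _
    obtain ⟨B, hB⟩ := (hC.prod (isCompact_Icc (a := 0) (b := 2 * π))).exists_bound_of_continuousOn
      (hF.continuousOn.mono (prod_mono hCS (subset_univ _)))
    refine ⟨B, fun t ht n => ?_⟩
    rw [pow_zero, mul_one]
    exact norm_fc_le (fun θ hθ => hB (t, θ) ⟨ht, hθ⟩) n
  | succ k ih =>
    intro F hF hp
    obtain ⟨F', hF', hd⟩ := exists_contDiffOn_hasDerivAt hS hF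
    have hp' : ∀ t ∈ S, Function.Periodic (fun θ => F' (t, θ)) (2 * π) := fun t ht =>
      periodic_of_hasDerivAt (hd t ht) (hp t ht)
    obtain ⟨B, hB⟩ := ih hF hp
    obtain ⟨B', hB'⟩ := ih hF' hp'
    refine ⟨B + B', fun t ht n => ?_⟩
    have hc : Continuous fun θ => F' (t, θ) :=
      hF'.continuousOn.comp_continuous (by fun_prop) fun θ => ⟨hCS ht, mem_univ _⟩
    have h1 := fc_deriv (hd t (hCS ht)) hc (hp t (hCS ht)) n
    have h2 := hB' t ht n
    rw [h1, norm_mul, norm_mul, Complex.norm_I, one_mul, Complex.norm_intCast] at h2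
    have h3 := hB t ht n
    rw [pow_succ]
    linarith

/-- The Fourier coefficients of a smooth family decrease rapidly, locally uniformly in the
parameter. -/
theorem exists_summable_norm_fc_le (hS : UniqueDiffOn ℝ S) {C : Set ℝ} (hC : IsCompact C)
    (hCS : C ⊆ S) (hF : ContDiffOn ℝ ∞ F (S ×ˢ univ))
    (hp : ∀ t ∈ S, Function.Periodic (fun θ => F (t, θ)) (2 * π)) (k : ℕ) :
    ∃ u : ℤ → ℝ, Summable u ∧
      ∀ t ∈ C, ∀ n, ‖fc (fun θ => F (t, θ)) n‖ * (1 + |(n : ℝ)|) ^ k ≤ u n := by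
  obtain ⟨B, hB⟩ := exists_norm_fc_le hS hC hCS (k + 2) hF hp
  refine ⟨_, summable_inv_one_add_abs_sq.mul_left B, fun t ht n => ?_⟩
  rw [← div_eq_mul_inv, le_div_iff₀ (by positivity), mul_assoc, ← pow_add]
  exact hB t ht n

end Families

theorem isRapidlyDecreasing_fc {f : ℝ → ℂ} (hf : ContDiff ℝ ∞ f)
    (hp : Function.Periodic f (2 * π)) : IsRapidlyDecreasing (fc f) := fun k => by
  obtain ⟨u, hu, hle⟩ := exists_summable_norm_fc_le (S := univ) (F := fun p => f p.2)
    uniqueDiffOn_univ (isCompact_singleton (x := (0 : ℝ))) (subset_univ _)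
    (hf.comp contDiff_snd).contDiffOn (fun _ _ => hp) k
  exact Summable.of_nonneg_of_le (fun n => by positivity) (hle 0 rfl) hu

/-- The Fourier coefficients of a smooth family over `[0, 1]`, extended as a constant. -/
theorem isRapidlyDecreasingPath_fc {F : ℝ × ℝ → ℂ} (hF : ContDiffOn ℝ ∞ F (Icc 0 1 ×ˢ univ))
    (hp : ∀ t ∈ Icc (0 : ℝ) 1, Function.Periodic (fun θ => F (t, θ)) (2 * π)) :
    IsRapidlyDecreasingPath fun t =>
      fc fun θ => F ((projIcc 0 1 zero_le_one t : Icc (0 : ℝ) 1), θ) where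
  continuous n := by
    refine continuous_fc (G := fun t θ => F ((projIcc 0 1 zero_le_one t : Icc (0 : ℝ) 1), θ)) ?_ n
    refine hF.continuousOn.comp_continuous (f := fun p : ℝ × ℝ =>
      (((projIcc 0 1 zero_le_one p.1 : Icc (0 : ℝ) 1) : ℝ), p.2)) ?_
      fun p => ⟨Subtype.coe_prop _, mem_univ _⟩
    exact (continuous_subtype_val.comp (continuous_projIcc.comp continuous_fst)).prodMk
      continuous_snd
  bound k := by
    obtain ⟨u, hu, hle⟩ := exists_summable_norm_fc_le (uniqueDiffOn_Icc zero_lt_one) isCompact_Icc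
      subset_rfl hF hp k
    exact ⟨u, hu, fun t n => hle _ (Subtype.coe_prop _) n⟩

theorem IsRapidlyDecreasingPath.const_mul {a : ℝ → ℤ → ℂ} (ha : IsRapidlyDecreasingPath a)
    (C : ℂ) : IsRapidlyDecreasingPath fun t n => C * a t n where
  continuous n := continuous_const.mul (ha.continuous n)
  bound k := by
    obtain ⟨u, hu, hle⟩ := ha.bound k
    refine ⟨_, hu.mul_left ‖C‖, fun t n => ?_⟩
    rw [norm_mul, mul_assoc]
    exact mul_le_mul_of_nonneg_left (hle t n) (norm_nonneg C)

theorem IsRapidlyDecreasing.const_mul {a : ℤ → ℂ} (ha : IsRapidlyDecreasing a) (C : ℂ) :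
    IsRapidlyDecreasing fun n => C * a n :=
  (ha.const.const_mul C).apply 0

theorem IsRapidlyDecreasing.add {a b : ℤ → ℂ} (ha : IsRapidlyDecreasing a)
    (hb : IsRapidlyDecreasing b) : IsRapidlyDecreasing fun n => a n + b n := fun k => by
  refine Summable.of_nonneg_of_le (fun n => by positivity) (fun n => ?_) ((ha k).add (hb k))
  rw [← add_mul]
  exact mul_le_mul_of_nonneg_right (norm_add_le _ _) (by positivity)

end VirasoroEvolution

end

/-! ### Commutation and adjoint relations of the smeared operators -/

noncomputable section

namespace VirasoroEvolution

namespace UnitaryPositiveEnergyRep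

variable {H : Type*} [NormedAddCommGroup H] [InnerProductSpace ℂ H] [CompleteSpace H] {c : ℝ}
  {W : Submodule ℂ H} (ρ : UnitaryPositiveEnergyRep c W) (hW : Dense (W : Set H)) (hc : 0 ≤ c)
include hW hc

theorem Lop_zero_mul_Lop_one_apply (m n : ℤ) (w : W) :
    (ρ.Lop 0 m * ρ.Lop 1 n) (w : H) = ρ.L m (ρ.L n (ρ.resolventW (ρ.resolventW w))) := by
  rw [ContinuousLinearMap.mul_def, ContinuousLinearMap.comp_apply, ρ.Lop_apply hW hc,
    ρ.Lop_apply hW hc]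
  simp only [LW, pow_zero, zero_add, pow_one, one_mul, pow_two, one_add_one_eq_two,
    Module.End.mul_apply, ρ.resolventW_energyW]

/-- `Lop 0 m * Lop 1 n` is `L_m L_n Λ⁻²`, so this is the Virasoro relation multiplied by `Λ⁻²`, an
identity between bounded operators that can be summed against absolutely convergent coefficients. -/
theorem commutator_Lop (m n : ℤ) :
    ρ.Lop 0 m * ρ.Lop 1 n - ρ.Lop 0 n * ρ.Lop 1 m =
      ((m : ℂ) - n) • (ρ.Lop 0 (m + n) * ρ.resolvent) +
        (if m + n = 0 then (c : ℂ) / 12 * ((m : ℂ) ^ 3 - m) else 0) •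
          (ρ.resolvent * ρ.resolvent) := by
  refine ext_of_dense hW fun w => ?_
  rw [sub_apply, ρ.Lop_zero_mul_Lop_one_apply hW hc, ρ.Lop_zero_mul_Lop_one_apply hW hc,
    ← Submodule.coe_sub, ρ.commutator]
  simp only [add_apply, smul_apply, ContinuousLinearMap.mul_def,
    ContinuousLinearMap.comp_apply, ρ.resolvent_apply hW, ρ.Lop_apply hW hc, Submodule.coe_add,
    Submodule.coe_smul, LW, pow_zero, zero_add, pow_one, one_mul, Module.End.mul_apply]

theorem hasSum_Kop_mul_Kop {a b : ℤ → ℂ} (ha : IsRapidlyDecreasing a) (hb : IsRapidlyDecreasing b)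
    (j k : ℕ) : HasSum (fun p : ℤ × ℤ => (a p.1 * b p.2) • (ρ.Lop j p.1 * ρ.Lop k p.2))
      (ρ.Kop j a * ρ.Kop k b) := by
  have h0 := summable_mul_of_summable_norm (ρ.summable_norm_smul_Lop hW hc ha j)
      (ρ.summable_norm_smul_Lop hW hc hb k)
  have h1 := HasSum.mul (ρ.hasSum_Kop hW hc ha j) (ρ.hasSum_Kop hW hc hb k) h0
  simpa only [smul_mul_smul_comm] using h1

/-- The commutation relation of smeared Virasoro operators. -/
theorem commutator_Kop {a b d : ℤ → ℂ} (ha : IsRapidlyDecreasing a) (hb : IsRapidlyDecreasing b)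
    (hd : IsRapidlyDecreasing d) {z : ℂ}
    (hab : ∀ p : ℤ, HasSum (fun n : ℤ => ((p : ℂ) - 2 * (n : ℂ)) * (a (p - n) * b n)) (d p))
    (hz : HasSum (fun n : ℤ => ((n : ℂ) - (n : ℂ) ^ 3) * (a (-n) * b n)) z) :
    ρ.Kop 0 a * ρ.Kop 1 b - ρ.Kop 0 b * ρ.Kop 1 a =
      ρ.Kop 0 d * ρ.resolvent + (c / 12 * z) • (ρ.resolvent * ρ.resolvent) := by
  have h1 := ρ.hasSum_Kop_mul_Kop hW hc ha hb 0 1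
  have h2 := (Equiv.hasSum_iff (Equiv.prodComm ℤ ℤ)).2 (ρ.hasSum_Kop_mul_Kop hW hc hb ha 0 1)
  have h3 := h1.sub h2
  -- The double sum is reindexed by total degree: the pair `(p, n)` stands for `L_{p-n}` and `L_n`.
  -- Each fibre over `p` sums to a multiple of `L_p`, with an extra central term for `p = 0`.
  let e : ℤ × ℤ ≃ ℤ × ℤ :=
    { toFun := fun p => (p.1 - p.2, p.2)
      invFun := fun p => (p.1 + p.2, p.2)
      left_inv := fun p => by simp
      right_inv := fun p => by simp }
  have h4 := (Equiv.hasSum_iff e).2 h3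
  have h5 := h4.prod_fiberwise (g := fun p => (d p) • (ρ.Lop 0 p * ρ.resolvent) +
    (if p = 0 then c / 12 * z else 0) • (ρ.resolvent * ρ.resolvent)) fun p => by
      have h0 : HasSum (fun n : ℤ => if p = 0 then
          (c / 12 : ℂ) * (((n : ℂ) - (n : ℂ) ^ 3) * (a (-n) * b n)) else 0)
          (if p = 0 then c / 12 * z else 0) := by
        split_ifs
        · exact hz.mul_left _
        · exact hasSum_zero
      have h6 := ((hab p).smul_const (ρ.Lop 0 p * ρ.resolvent)).add
        (h0.smul_const (ρ.resolvent * ρ.resolvent))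
      refine h6.congr_fun fun n => ?_
      have h7 := ρ.commutator_Lop hW hc (p - n) n
      have h8 : (b n * a (p - n)) = a (p - n) * b n := mul_comm _ _
      simp only [e, Function.comp_apply, Equiv.coe_fn_mk, Equiv.prodComm_apply, Prod.swap_prod_mk]
      rw [h8, ← smul_sub, h7, smul_add, smul_smul, smul_smul, sub_add_cancel]
      congr 2
      · push_cast; ring
      · split_ifs with hp
        · subst hp; push_cast; simp only [zero_sub]; ring
        · ring
  refine h5.unique ?_
  have h9 := ((ρ.hasSum_Kop hW hc hd 0).mul_right ρ.resolvent).add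
    ((hasSum_ite_eq (0 : ℤ) ((c : ℂ) / 12 * z)).smul_const (ρ.resolvent * ρ.resolvent))
  simpa only [smul_mul_assoc] using h9

theorem Kop_add {a b : ℤ → ℂ} (ha : IsRapidlyDecreasing a) (hb : IsRapidlyDecreasing b) (k : ℕ) :
    ρ.Kop k (fun n => a n + b n) = ρ.Kop k a + ρ.Kop k b := by
  refine (ρ.hasSum_Kop hW hc (ha.add hb) k).unique ?_
  simpa only [add_smul] using (ρ.hasSum_Kop hW hc ha k).add (ρ.hasSum_Kop hW hc hb k)

theorem Kop_const_mul {a : ℤ → ℂ} (ha : IsRapidlyDecreasing a) (C : ℂ) (k : ℕ) :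
    ρ.Kop k (fun n => C * a n) = C • ρ.Kop k a := by
  refine (ρ.hasSum_Kop hW hc (ha.const_mul C) k).unique ?_
  simpa only [mul_smul] using (ρ.hasSum_Kop hW hc ha k).const_smul C

/-- The adjoint relation for smeared Virasoro operators. -/
theorem inner_Kop_left {a b : ℤ → ℂ} (ha : IsRapidlyDecreasing a) (hb : IsRapidlyDecreasing b)
    (hab : ∀ n, b (-n) = (starRingEnd ℂ) (a n)) (x y : H) :
    ⟪ρ.Kop 0 a x, ρ.resolvent y⟫_ℂ = ⟪ρ.resolvent x, ρ.Kop 0 b y⟫_ℂ := by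
  refine hW.denseRange_val.induction_on₂ (p := fun x y =>
    ⟪ρ.Kop 0 a x, ρ.resolvent y⟫_ℂ = ⟪ρ.resolvent x, ρ.Kop 0 b y⟫_ℂ)
    (isClosed_eq (by fun_prop) (by fun_prop)) (fun v w => ?_) x y
  obtain ⟨v, rfl⟩ := ρ.energyW_bijective.2 v
  obtain ⟨w, rfl⟩ := ρ.energyW_bijective.2 w
  rw [ρ.resolvent_apply hW, ρ.resolvent_apply hW, ρ.resolventW_energyW, ρ.resolventW_energyW]
  have h1 := ((ρ.hasSum_Kop_zero hW hc ha v).mapL (innerSL ℂ (w : H))).star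
  have h2 : HasSum (fun n => ⟪(v : H), b n • (ρ.L n w : H)⟫_ℂ) _ :=
    (ρ.hasSum_Kop_zero hW hc hb w).mapL (innerSL ℂ (v : H))
  simp only [innerSL_apply_apply, Complex.star_def, inner_conj_symm] at h1
  refine h1.unique ?_
  rw [← (Equiv.neg ℤ).hasSum_iff] at h2
  refine h2.congr_fun fun n => ?_
  have h3 : ⟪(ρ.L n v : H), (w : H)⟫_ℂ = ⟪(v : H), (ρ.L (-n) w : H)⟫_ℂ := ρ.unitary n v w
  simp only [Function.comp_apply, Equiv.neg_apply]
  rw [inner_smul_left, inner_smul_right, h3, hab]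

end UnitaryPositiveEnergyRep

end VirasoroEvolution

end

/-! ### Transport of expectation values along real vector fields -/

noncomputable section

namespace VirasoroEvolution

theorem _root_.HasDerivWithinAt.clm_apply_complex {E F : Type*} [NormedAddCommGroup E]
    [NormedSpace ℂ E] [NormedAddCommGroup F] [NormedSpace ℂ F] {K : ℝ → E →L[ℂ] F}
    {K' : E →L[ℂ] F} {y : ℝ → E} {y' : E} {s : Set ℝ} {r : ℝ} (hK : HasDerivWithinAt K K' s r)
    (hy : HasDerivWithinAt y y' s r) :
    HasDerivWithinAt (fun r => K r (y r)) (K' (y r) + K r y') s r :=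
  ((ContinuousLinearMap.restrictScalarsL ℂ E F ℝ ℝ).hasFDerivAt.comp_hasDerivWithinAt r
    hK).clm_apply hy

namespace UnitaryPositiveEnergyRep

variable {H : Type*} [NormedAddCommGroup H] [InnerProductSpace ℂ H] [CompleteSpace H] {c : ℝ}
  {W : Submodule ℂ H} (ρ : UnitaryPositiveEnergyRep c W) (hW : Dense (W : Set H)) (hc : 0 ≤ c)
include hW hc

theorem hasDerivAt_Kop {a a' : ℝ → ℤ → ℂ} (ha : ∀ s, IsRapidlyDecreasing (a s)) (k : ℕ)
    {S : Set ℝ} (hSo : IsOpen S) (hS : IsPreconnected S)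
    (hd : ∀ n, ∀ s ∈ S, HasDerivAt (fun s => a s n) (a' s n) s) {u : ℤ → ℝ} (hu : Summable u)
    (hle : ∀ s ∈ S, ∀ n, ‖a' s n‖ * (1 + |(n : ℝ)|) ^ (k + 2) ≤ u n) {s : ℝ} (hs : s ∈ S) :
    HasDerivAt (fun s => ρ.Kop k (a s)) (ρ.Kop k (a' s)) s :=
  hasDerivAt_tsum_of_isPreconnected (hu.mul_left (1 + c)) hSo hS
    (fun n s hs => (hd n s hs).smul_const (ρ.Lop k n))
    (fun n s hs => (ρ.norm_smul_Lop_le hW hc (a' s) k n).trans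
      (mul_le_mul_of_nonneg_left (hle s hs n) (by positivity))) hs
    (ρ.hasSum_Kop hW hc (ha s) k).summable hs

theorem inner_Kop_skew {b : ℤ → ℂ} (hb : IsRapidlyDecreasing b)
    (hskew : ∀ n, b (-n) = -(starRingEnd ℂ) (b n)) (x y : H) :
    ⟪ρ.Kop 0 b x, ρ.resolvent y⟫_ℂ = -⟪ρ.resolvent x, ρ.Kop 0 b y⟫_ℂ := by
  rw [ρ.inner_Kop_left hW hc hb (hb.const_mul (-1)) (fun n => by rw [hskew]; ring) x y,
    ρ.Kop_const_mul hW hc hb, neg_one_smul, neg_apply, inner_neg_right]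

theorem re_inner_Kop_skew {b : ℤ → ℂ} (hb : IsRapidlyDecreasing b)
    (hskew : ∀ n, b (-n) = -(starRingEnd ℂ) (b n)) (x : H) :
    (⟪ρ.Kop 0 b x, ρ.resolvent x⟫_ℂ).re = 0 := by
  have h1 := congrArg Complex.re (ρ.inner_Kop_skew hW hc hb hskew x x)
  have h2 : (⟪ρ.resolvent x, ρ.Kop 0 b x⟫_ℂ).re = (⟪ρ.Kop 0 b x, ρ.resolvent x⟫_ℂ).re :=
    inner_re_symm (𝕜 := ℂ) _ _
  rw [Complex.neg_re, h2] at h1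
  linarith

/-- Transport of the expectation values of smeared Virasoro operators along the flow generated by
a path of real vector fields: if the vector fields `a s` are transported by `b s`, then the
expectation value changes only by the integrated Virasoro cocycle. -/
theorem exists_inner_Kop_transport {a a' b : ℝ → ℤ → ℂ} {z Ψ : ℝ → ℂ}
    (ha : ∀ s, IsRapidlyDecreasing (a s)) (ha' : ∀ s, IsRapidlyDecreasing (a' s))
    (hd : ∀ s ∈ Icc (0 : ℝ) 1, HasDerivAt (fun s => ρ.Kop 0 (a s)) (ρ.Kop 0 (a' s)) s)
    (hb : IsRapidlyDecreasingPath b) (hskew : ∀ s n, b s (-n) = -(starRingEnd ℂ) (b s n))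
    (hab : ∀ s ∈ Icc (0 : ℝ) 1, ∀ p : ℤ,
      HasSum (fun n : ℤ => ((p : ℂ) - 2 * (n : ℂ)) * (a s (p - n) * b s n)) (-1 * a' s p))
    (hz : ∀ s ∈ Icc (0 : ℝ) 1,
      HasSum (fun n : ℤ => ((n : ℂ) - (n : ℂ) ^ 3) * (a s (-n) * b s n)) (z s))
    (hΨ : ∀ s ∈ Icc (0 : ℝ) 1, HasDerivAt Ψ (c / 12 * z s) s) (w : W) :
    ∃ y : H, ⟪(w : H), ρ.Kop 0 (a 0) (ρ.energyW w)⟫_ℂ =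
      ⟪ρ.resolvent y, ρ.Kop 0 (a 1) y⟫_ℂ + (Ψ 0 - Ψ 1) * (‖w‖ : ℂ) ^ 2 := by
  -- Skewness gives dissipativity with constant `0` at the lowest level, so the abstract evolution
  -- system is available for `b`.
  obtain ⟨κ, M, h⟩ := ρ.exists_isDissipativeFamily hW hc hb le_rfl (fun t w => by
    have h1 := ρ.re_inner_Kop_skew hW hc (hb.apply t) (hskew t) (ρ.energyW w : H)
    rw [ρ.resolvent_apply hW, ρ.resolventW_energyW] at h1
    rw [h1, zero_mul])
  -- Below, `x = Λ² u` and `y = Λ u` for the orbit `u` of `w`. Two levels are needed because the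
  -- commutator involves products of two unbounded operators.
  set v : H := ((ρ.energyW (ρ.energyW w) : W) : H) with hv
  have hRv : ρ.resolvent v = ((ρ.energyW w : W) : H) := by
    rw [hv, ρ.resolvent_apply hW, ρ.resolventW_energyW]
  have hRw : ρ.resolvent ((ρ.energyW w : W) : H) = (w : H) := by
    rw [ρ.resolvent_apply hW, ρ.resolventW_energyW]
  set x : ℝ → H := fun s => h.evol 2 s 0 v
  set y : ℝ → H := fun s => h.evol 1 s 0 (ρ.resolvent v)
  have hRx : ∀ s, 0 ≤ s → ρ.resolvent (x s) = y s := fun s hs => h.evol_intertwine 1 hs v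
  have hy : ∀ s, 0 ≤ s → HasDerivWithinAt y (ρ.Kop 1 (b s) (x s)) (Ici s) s := fun s hs =>
    (h.hasDerivWithinAt_evol_forward 1 hs v).mono (Ici_subset_Ici.2 hs)
  have hRK : ∀ s, 0 ≤ s → ∀ {e : ℤ → ℂ}, IsRapidlyDecreasing e →
      ρ.resolvent (ρ.Kop 1 e (x s)) = ρ.Kop 0 e (y s) := fun s hs e he => by
    rw [← hRx s hs]
    exact congrFun (congrArg DFunLike.coe (ρ.resolvent_mul_Kop hW hc he 0)) (x s)
  have hRy : ∀ s, 0 ≤ s →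
      HasDerivWithinAt (fun s => ρ.resolvent (y s)) (ρ.Kop 0 (b s) (y s)) (Ici s) s :=
    fun s hs => by
      rw [← hRK s hs (hb.apply s)]
      exact (ρ.resolvent.restrictScalars ℝ).hasFDerivAt.comp_hasDerivWithinAt s (hy s hs)
  have hyc : Continuous y := h.continuous_evol_left 1 0 _
  have h01 : ∀ s ∈ Ico (0 : ℝ) 1, s ∈ Icc (0 : ℝ) 1 := fun s hs => Ico_subset_Icc_self hs
  -- Skewness preserves the norm of the orbit, so the central term contributes a known multiple of
  -- `‖w‖²`.
  have hN : ∀ s ∈ Icc (0 : ℝ) 1, ⟪ρ.resolvent (y s), ρ.resolvent (y s)⟫_ℂ = (‖w‖ : ℂ) ^ 2 := by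
    have h1 := constant_of_has_deriv_right_zero
      (f := fun s => ⟪ρ.resolvent (y s), ρ.resolvent (y s)⟫_ℂ) (a := 0) (b := 1)
      (Continuous.continuousOn (by fun_prop)) fun s hs => by
        refine ((hRy s hs.1).inner ℂ (hRy s hs.1)).congr_deriv ?_
        rw [ρ.inner_Kop_skew hW hc (hb.apply s) (hskew s), add_neg_cancel]
    intro s hs
    rw [h1 s hs, inner_self_eq_norm_sq_to_K]
    simp only [y, h.evol_self, one_apply_eq_self, hRv, hRw]
    rfl
  -- The commutator with the generator contributes `-a'` and the central term; the former cancels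
  -- the derivative of `a`, the latter that of `Ψ`.
  have hφ := constant_of_has_deriv_right_zero
    (f := fun s => ⟪ρ.resolvent (y s), ρ.Kop 0 (a s) (y s)⟫_ℂ - Ψ s * (‖w‖ : ℂ) ^ 2)
    (a := 0) (b := 1) ?_ (fun s hs => ?_) 1 (right_mem_Icc.2 zero_le_one)
  · refine ⟨y 1, ?_⟩
    simp only [y, h.evol_self, one_apply_eq_self, hRv, hRw] at hφ ⊢
    linear_combination -hφ
  · have h1 : ContinuousOn (fun s => ρ.Kop 0 (a s)) (Icc 0 1) := fun s hs =>
      (hd s hs).continuousAt.continuousWithinAt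
    have h2 : ContinuousOn Ψ (Icc 0 1) := fun s hs => (hΨ s hs).continuousAt.continuousWithinAt
    have h3 : Continuous fun s => ρ.resolvent (y s) := by fun_prop
    exact (ContinuousOn.inner (𝕜 := ℂ) h3.continuousOn (h1.clm_apply hyc.continuousOn)).sub
      (h2.mul continuousOn_const)
  · have h1 := ((hRy s hs.1).inner ℂ ((hd s (h01 s hs)).hasDerivWithinAt.clm_apply_complex
      (hy s hs.1))).sub ((hΨ s (h01 s hs)).hasDerivWithinAt.mul_const ((‖w‖ : ℂ) ^ 2))
    refine h1.congr_deriv ?_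
    have h2 := congrFun (congrArg DFunLike.coe (ρ.commutator_Kop hW hc (ha s) (hb.apply s)
      ((ha' s).const_mul (-1)) (hab s (h01 s hs)) (hz s (h01 s hs)))) (x s)
    rw [ρ.Kop_const_mul hW hc (ha' s)] at h2
    simp only [ContinuousLinearMap.mul_def, ContinuousLinearMap.comp_apply, sub_apply, add_apply,
      smul_apply, neg_one_smul, neg_apply, hRx s hs.1, sub_eq_iff_eq_add] at h2
    rw [h2, ← hRK s hs.1 (ha s), ρ.inner_Kop_skew hW hc (hb.apply s) (hskew s)]
    simp only [inner_add_right, inner_neg_right, inner_smul_right, hN s (h01 s hs)]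
    ring

end UnitaryPositiveEnergyRep

end VirasoroEvolution

end

/-! ### Flattening a positive vector field -/

noncomputable section

namespace VirasoroEvolution

/-- A smooth deformation `F` of the positive function `h` on the circle to a constant, which is
the transport of the vector field `h ∂_θ` by the flow of the vector fields `-G ∂_θ`, together with
its derivatives, and a function `Q` whose mean is, up to a factor, a primitive of the Virasoro
cocycle of `F ∂_θ` and `G ∂_θ`. -/
structure Flattening (h : ℝ → ℝ) where
  (F F' F₁ F₂ F₃ G G₁ Q Q' : ℝ × ℝ → ℝ)
  /-- The final value of the deformation. -/
  α : ℝ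
  contDiff_F : ContDiff ℝ ∞ F
  contDiff_F' : ContDiff ℝ ∞ F'
  contDiff_G : ContDiff ℝ ∞ G
  continuous_F₁ : Continuous F₁
  continuous_F₂ : Continuous F₂
  continuous_F₃ : Continuous F₃
  continuous_G₁ : Continuous G₁
  continuous_Q : Continuous Q
  continuous_Q' : Continuous Q'
  periodic_F : ∀ s, Function.Periodic (fun θ => F (s, θ)) (2 * π)
  periodic_F' : ∀ s, Function.Periodic (fun θ => F' (s, θ)) (2 * π)
  periodic_G : ∀ s, Function.Periodic (fun θ => G (s, θ)) (2 * π)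
  hasDerivAt_F : ∀ s θ, HasDerivAt (fun s => F (s, θ)) (F' (s, θ)) s
  hasDerivAt_Q : ∀ s θ, HasDerivAt (fun s => Q (s, θ)) (Q' (s, θ)) s
  hasDerivAt_F₁ : ∀ s θ, HasDerivAt (fun θ => F (s, θ)) (F₁ (s, θ)) θ
  hasDerivAt_F₂ : ∀ s θ, HasDerivAt (fun θ => F₁ (s, θ)) (F₂ (s, θ)) θ
  hasDerivAt_F₃ : ∀ s θ, HasDerivAt (fun θ => F₂ (s, θ)) (F₃ (s, θ)) θ
  hasDerivAt_G₁ : ∀ s θ, HasDerivAt (fun θ => G (s, θ)) (G₁ (s, θ)) θ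
  flow : ∀ s θ, F' (s, θ) = F (s, θ) * G₁ (s, θ) - F₁ (s, θ) * G (s, θ)
  anomaly : ∀ s, ∃ E E₁ : ℝ → ℝ, Continuous E₁ ∧ Function.Periodic E (2 * π) ∧
    (∀ θ, HasDerivAt E (E₁ θ) θ) ∧
    ∀ θ, (F₁ (s, θ) + F₃ (s, θ)) * G (s, θ) = -(Q' (s, θ) / 2) + E₁ θ
  F_zero : ∀ θ, F (0, θ) = h θ
  F_one : ∀ θ, F (1, θ) = α
  Q_eq : ∀ s θ, Q (s, θ) = F (s, θ) - F₁ (s, θ) ^ 2 / F (s, θ)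
  α_pos : 0 < α
  α_le : ∀ B, (∀ θ, h θ ≤ B) → α ≤ B

/-- A vector field `F ∂_θ` corresponds to the density `F⁻¹ dθ`, and densities of equal total mass
can be interpolated linearly, as in Moser's argument. So `F⁻¹` runs from `h⁻¹` to its mean, and the
flow equation becomes `(G / F)_θ = F' / F²`, solved by a primitive. -/
theorem exists_flattening {h : ℝ → ℝ} (hh : ContDiff ℝ ∞ h) (hp : Function.Periodic h (2 * π))
    (hpos : ∀ θ, 0 < h θ) : Nonempty (Flattening h) := by
  set p : ℝ → ℝ := fun θ => (h θ)⁻¹ with hpdef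
  have hps : ContDiff ℝ ∞ p := hh.inv fun θ => (hpos θ).ne'
  have hpp : Function.Periodic p (2 * π) := fun θ => by simp only [p, hp θ]
  have hp0 : ∀ θ, 0 < p θ := fun θ => inv_pos.2 (hpos θ)
  -- The mean of `h⁻¹` is forced: it makes `P - p` have mean zero, hence a periodic primitive `k`.
  -- The final value `P⁻¹` is the harmonic mean of `h`, which is at most any upper bound of `h`.
  set P : ℝ := (2 * π)⁻¹ * ∫ θ in (0 : ℝ)..2 * π, p θ with hP
  have hPle : ∀ B, (∀ θ ∈ Icc 0 (2 * π), h θ ≤ B) → B⁻¹ ≤ P := fun B hB => by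
    rw [hP, le_inv_mul_iff₀ two_pi_pos]
    have h1 := intervalIntegral.integral_mono_on (a := 0) (b := 2 * π) (f := fun _ => B⁻¹) (g := p)
      two_pi_pos.le (intervalIntegrable_const (μ := MeasureTheory.volume)) (hps.continuous.intervalIntegrable _ _)
      fun θ hθ => inv_anti₀ (hpos θ) (hB θ hθ)
    rwa [intervalIntegral.integral_const, sub_zero, smul_eq_mul] at h1
  have hP0 : 0 < P := by
    obtain ⟨B, hB⟩ := (isCompact_Icc (a := 0) (b := 2 * π)).exists_bound_of_continuousOn
      hh.continuous.continuousOn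
    have h1 : ∀ θ ∈ Icc 0 (2 * π), h θ ≤ B := fun θ hθ => (le_abs_self _).trans (hB θ hθ)
    have h2 : 0 < B := (hpos 0).trans_le (h1 0 ⟨le_rfl, two_pi_pos.le⟩)
    exact (inv_pos.2 h2).trans_le (hPle B h1)
  set k₁ : ℝ → ℝ := fun θ => P - p θ with hk₁
  have hk₁s : ContDiff ℝ ∞ k₁ := contDiff_const.sub hps
  have hk₁p : Function.Periodic k₁ (2 * π) := fun θ => by simp only [k₁, hpp θ]
  set k : ℝ → ℝ := fun θ => ∫ x in (0 : ℝ)..θ, k₁ x with hk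
  have hkd : ∀ θ, HasDerivAt k (k₁ θ) θ := fun θ =>
    intervalIntegral.integral_hasDerivAt_right (hk₁s.continuous.intervalIntegrable _ _)
      (hk₁s.continuous.stronglyMeasurableAtFilter _ _) hk₁s.continuous.continuousAt
  have hks : ContDiff ℝ ∞ k := by
    refine contDiff_infty_iff_deriv.2 ⟨fun θ => (hkd θ).differentiableAt, ?_⟩
    rwa [show deriv k = k₁ from funext fun θ => (hkd θ).deriv]
  have hkp : Function.Periodic k (2 * π) := fun θ => by
    have h1 := intervalIntegral.integral_add_adjacent_intervals
      (hk₁s.continuous.intervalIntegrable (μ := MeasureTheory.volume) 0 θ)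
      (hk₁s.continuous.intervalIntegrable θ (θ + 2 * π))
    have h2 := hk₁p.intervalIntegral_add_eq θ 0
    have h3 : ∫ x in (0 : ℝ)..2 * π, k₁ x = 0 := by
      rw [hk₁, intervalIntegral.integral_sub intervalIntegrable_const
        (hps.continuous.intervalIntegrable _ _), intervalIntegral.integral_const, hP, smul_eq_mul,
        sub_zero, mul_inv_cancel_left₀ two_pi_pos.ne', sub_self]
    rw [zero_add] at h2
    rw [hk]
    simp only
    rw [← h1, h2, h3, add_zero]
  obtain ⟨p₁, hp₁s, hp₁⟩ : ∃ p₁ : ℝ → ℝ, ContDiff ℝ ∞ p₁ ∧ ∀ θ, HasDerivAt p (p₁ θ) θ :=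
    ⟨deriv p, (contDiff_infty_iff_deriv.1 hps).2, fun θ =>
      (hps.differentiable (by simp) θ).hasDerivAt⟩
  have hk₁d : ∀ θ, HasDerivAt k₁ (-p₁ θ) θ := fun θ => (hp₁ θ).const_sub P
  -- The smooth transition keeps `u` positive for all real parameters, so that `F` is smooth on the
  -- whole plane and not only over `[0, 1]`.
  set σ := Real.smoothTransition
  have hσs : ContDiff ℝ ∞ σ := Real.smoothTransition.contDiff
  obtain ⟨σ₁, hσ₁s, hσ₁⟩ : ∃ σ₁ : ℝ → ℝ, ContDiff ℝ ∞ σ₁ ∧ ∀ s, HasDerivAt σ (σ₁ s) s :=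
    ⟨deriv σ, (contDiff_infty_iff_deriv.1 hσs).2, fun s =>
      (hσs.differentiable (by simp) s).hasDerivAt⟩
  set u : ℝ × ℝ → ℝ := fun q => p q.2 + σ q.1 * k₁ q.2 with hu
  have hus : ContDiff ℝ ∞ u := by fun_prop
  have hu0 : ∀ q, 0 < u q := fun q => by
    have h1 := Real.smoothTransition.nonneg q.1
    have h2 := Real.smoothTransition.le_one q.1
    have h3 : u q = (1 - σ q.1) * p q.2 + σ q.1 * P := by simp only [u, k₁]; ring
    rw [h3]
    rcases h1.eq_or_lt with h4 | h4
    · rw [show σ q.1 = 0 from h4.symm]; simpa using hp0 q.2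
    · have := mul_pos h4 hP0
      have := mul_nonneg (sub_nonneg.2 h2) (hp0 q.2).le
      linarith
  set F : ℝ × ℝ → ℝ := fun q => (u q)⁻¹ with hF
  have hFs : ContDiff ℝ ∞ F := hus.inv fun q => (hu0 q).ne'
  have huF : ∀ q, u q * F q = 1 := fun q => mul_inv_cancel₀ (hu0 q).ne'
  have hFp : ∀ s, Function.Periodic (fun θ => F (s, θ)) (2 * π) := fun s θ => by
    simp only [F, u, hpp θ, hk₁p θ]
  have hus' : ∀ s θ, HasDerivAt (fun s => u (s, θ)) (σ₁ s * k₁ θ) s := fun s θ =>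
    ((hσ₁ s).mul_const (k₁ θ)).const_add (p θ)
  have hFd : ∀ s θ, HasDerivAt (fun s => F (s, θ)) (-(σ₁ s * k₁ θ * F (s, θ) ^ 2)) s :=
    fun s θ => ((hus' s θ).fun_inv (hu0 _).ne').congr_deriv (by
      simp only [F, inv_pow]; ring)
  set F₁ : ℝ × ℝ → ℝ := fun q => -((1 - σ q.1) * p₁ q.2 * F q ^ 2) with hF₁
  have hF₁s : ContDiff ℝ ∞ F₁ := by fun_prop
  have hF₁d : ∀ s θ, HasDerivAt (fun θ => F (s, θ)) (F₁ (s, θ)) θ := fun s θ => by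
    have h1 : HasDerivAt (fun θ => u (s, θ)) (p₁ θ + σ s * -p₁ θ) θ :=
      (hp₁ θ).add ((hk₁d θ).const_mul (σ s))
    exact (h1.fun_inv (hu0 _).ne').congr_deriv (by simp only [F₁, F, inv_pow]; ring)
  have hF₁' : ∀ s θ, HasDerivAt (fun s => F₁ (s, θ))
      (-(σ₁ s * (-p₁ θ * F (s, θ) ^ 2 + 2 * k₁ θ * F (s, θ) * F₁ (s, θ)))) s := fun s θ => by
    have h1 := ((((hσ₁ s).const_sub 1).mul_const (p₁ θ)).mul ((hFd s θ).fun_pow 2)).fun_neg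
    exact h1.congr_deriv (by simp only [F₁]; push_cast; ring)
  have hex : ∀ A : ℝ × ℝ → ℝ, ContDiff ℝ ∞ A → ∃ A' : ℝ × ℝ → ℝ, ContDiff ℝ ∞ A' ∧
      ∀ s θ, HasDerivAt (fun θ => A (s, θ)) (A' (s, θ)) θ := fun A hA => by
    obtain ⟨A', h1, h2⟩ := exists_contDiffOn_hasDerivAt (S := univ) (F := A) uniqueDiffOn_univ
      hA.contDiffOn
    rw [univ_prod_univ, contDiffOn_univ] at h1
    exact ⟨A', h1, fun s => h2 s (mem_univ s)⟩
  obtain ⟨F₂, hF₂s, hF₂d⟩ := hex F₁ hF₁s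
  obtain ⟨F₃, hF₃s, hF₃d⟩ := hex F₂ hF₂s
  have hF₁p : ∀ s, Function.Periodic (fun θ => F₁ (s, θ)) (2 * π) := fun s =>
    periodic_of_hasDerivAt (hF₁d s) (hFp s)
  have hF₂p : ∀ s, Function.Periodic (fun θ => F₂ (s, θ)) (2 * π) := fun s =>
    periodic_of_hasDerivAt (hF₂d s) (hF₁p s)
  have hσu : ∀ q, F₁ q ^ 2 * u q = F₁ q ^ 2 / F q := fun q => by
    rw [hF]; simp only [div_inv_eq_mul]
  refine ⟨⟨F, fun q => -(σ₁ q.1 * k₁ q.2 * F q ^ 2), F₁, F₂, F₃,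
    fun q => -(σ₁ q.1 * k q.2 * F q),
    fun q => -(σ₁ q.1 * (k₁ q.2 * F q + k q.2 * F₁ q)),
    fun q => F q - F₁ q ^ 2 * u q,
    fun q => σ₁ q.1 * (-(k₁ q.2 * F q ^ 2) + 3 * k₁ q.2 * F₁ q ^ 2 - 2 * p₁ q.2 * F q * F₁ q),
    P⁻¹, hFs, by fun_prop, by fun_prop, hF₁s.continuous, hF₂s.continuous, hF₃s.continuous, ?_, ?_,
    ?_, hFp, fun s θ => ?_, fun s θ => ?_, hFd, fun s θ => ?_, hF₁d, hF₂d, hF₃d, fun s θ => ?_,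
    fun s θ => ?_, fun s => ?_, fun θ => ?_, fun θ => ?_, fun s θ => by simp only [hσu],
    inv_pos.2 hP0, fun B hB => ?_⟩⟩
  · exact ContDiff.continuous (𝕜 := ℝ) (n := ∞) (by fun_prop)
  · exact ContDiff.continuous (𝕜 := ℝ) (n := ∞) (by fun_prop)
  · exact ContDiff.continuous (𝕜 := ℝ) (n := ∞) (by fun_prop)
  · have h1 : F (s, θ + 2 * π) = F (s, θ) := hFp s θ
    simp only [h1, hk₁p θ]
  · have h1 : F (s, θ + 2 * π) = F (s, θ) := hFp s θ
    simp only [h1, hkp θ]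
  · have h1 := (hFd s θ).sub (((hF₁' s θ).fun_pow 2).mul (hus' s θ))
    refine h1.congr_deriv ?_
    have h2 := huF (s, θ)
    simp only
    push_cast
    linear_combination (-2 * F₁ (s, θ) * σ₁ s * p₁ θ * F (s, θ) +
      4 * σ₁ s * k₁ θ * F₁ (s, θ) ^ 2) * h2
  · exact (((hkd θ).mul (hF₁d s θ)).const_mul (σ₁ s)).fun_neg.congr_deriv (by ring)
      |>.congr_of_eventuallyEq (.of_forall fun θ => by simp [mul_assoc])
  · simp only; ring
  -- The function collects the boundary terms from integrating `(F₁ + F₃) G`, with `G = -σ₁ k F`, by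
  -- parts: `F F₁` and `F F₃` are the derivatives of `F² / 2` and `F F₂ - F₁² / 2`, and the
  -- resulting `k₁ F F₂` is integrated by parts once more.
  · refine ⟨fun θ => -(σ₁ s * (F₂ (s, θ) * k θ * F (s, θ) - k θ * F₁ (s, θ) ^ 2 / 2 -
      F (s, θ) * F₁ (s, θ) * k₁ θ + k θ * F (s, θ) ^ 2 / 2)), _, ?_, fun θ => ?_, fun θ =>
      ((((((hF₃d s θ).mul (hkd θ)).mul (hF₁d s θ)).sub
        (((hkd θ).mul ((hF₂d s θ).fun_pow 2)).div_const 2)).sub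
        (((hF₁d s θ).mul (hF₂d s θ)).mul (hk₁d θ))).add
        (((hkd θ).mul ((hF₁d s θ).fun_pow 2)).div_const 2)).const_mul (σ₁ s) |>.fun_neg,
      fun θ => ?_⟩
    · have h1 : ∀ {A : ℝ × ℝ → ℝ}, ContDiff ℝ ∞ A → Continuous fun θ => A (s, θ) := fun hA =>
        hA.continuous.comp (by fun_prop)
      have h2 := h1 hFs
      have h3 := h1 hF₁s
      have h4 := h1 hF₂s
      have h5 := h1 hF₃s
      have h6 := hks.continuous
      have h7 := hk₁s.continuous
      have h8 := hp₁s.continuous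
      fun_prop
    · have h1 : F (s, θ + 2 * π) = F (s, θ) := hFp s θ
      have h2 : F₁ (s, θ + 2 * π) = F₁ (s, θ) := hF₁p s θ
      have h3 : F₂ (s, θ + 2 * π) = F₂ (s, θ) := hF₂p s θ
      simp only [h1, h2, h3, hkp θ, hk₁p θ]
    · simp only [Pi.mul_apply]
      push_cast
      ring
  · simp [F, u, p, σ, Real.smoothTransition.zero]
  · simp [F, u, k₁, σ, Real.smoothTransition.one]
  · exact inv_le_of_inv_le₀ ((hpos 0).trans_le (hB 0)) (hPle B fun θ _ => hB θ)

end VirasoroEvolution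

end

/-! ### The quantum energy inequality for positive functions -/

noncomputable section

namespace VirasoroEvolution

theorem fc_const_of_ne_zero (C : ℂ) {n : ℤ} (hn : n ≠ 0) : fc (fun _ => C) n = 0 := by
  have h1 := fc_deriv (f := fun _ => C) (f' := fun _ => 0) (fun θ => hasDerivAt_const θ C)
    continuous_const (fun θ => rfl) n
  have h2 : fc (fun _ => 0) n = 0 := by simp [fc_eq_integral]
  rw [h2, eq_comm, mul_eq_zero, mul_eq_zero] at h1
  simpa [Complex.I_ne_zero, hn] using h1

theorem contDiff_ofReal_comp {E : Type*} [NormedAddCommGroup E] [NormedSpace ℝ E] {f : E → ℝ}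
    (hf : ContDiff ℝ ∞ f) : ContDiff ℝ ∞ fun x => (f x : ℂ) :=
  Complex.ofRealCLM.contDiff.comp hf

theorem periodic_ofReal {f : ℝ → ℝ} {T : ℝ} (hf : Function.Periodic f T) :
    Function.Periodic (fun x => (f x : ℂ)) T := fun x => by simp only [hf x]

theorem isRapidlyDecreasing_fc_ofReal {f : ℝ → ℝ} (hf : ContDiff ℝ ∞ f)
    (hp : Function.Periodic f (2 * π)) : IsRapidlyDecreasing (fc fun θ => (f θ : ℂ)) :=
  isRapidlyDecreasing_fc (contDiff_ofReal_comp hf) (periodic_ofReal hp)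

namespace Flattening

variable {h : ℝ → ℝ} (D : Flattening h)

theorem contDiff_left {F : ℝ × ℝ → ℝ} (hF : ContDiff ℝ ∞ F) (s : ℝ) :
    ContDiff ℝ ∞ fun θ => F (s, θ) := hF.comp (by fun_prop)

theorem summable_fc_G (s : ℝ) : Summable (fc fun θ => (D.G (s, θ) : ℂ)) := by
  have := isRapidlyDecreasing_fc_ofReal (contDiff_left D.contDiff_G s) (D.periodic_G s) 0
  simp only [pow_zero, mul_one] at this
  exact this.of_norm

theorem fc_F₁ (s : ℝ) (n : ℤ) : fc (fun θ => (D.F₁ (s, θ) : ℂ)) n =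
    Complex.I * n * fc (fun θ => (D.F (s, θ) : ℂ)) n :=
  fc_deriv (fun θ => (D.hasDerivAt_F₁ s θ).ofReal_comp)
    (Complex.continuous_ofReal.comp (D.continuous_F₁.comp (by fun_prop)))
    (periodic_ofReal (D.periodic_F s)) n

theorem fc_F₃ (s : ℝ) (n : ℤ) : fc (fun θ => (D.F₃ (s, θ) : ℂ)) n =
    -Complex.I * n ^ 3 * fc (fun θ => (D.F (s, θ) : ℂ)) n := by
  have hp₁ := periodic_of_hasDerivAt (D.hasDerivAt_F₁ s) (D.periodic_F s)
  have hp₂ := periodic_of_hasDerivAt (D.hasDerivAt_F₂ s) hp₁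
  have h1 := fc_deriv (fun θ => (D.hasDerivAt_F₂ s θ).ofReal_comp)
    (Complex.continuous_ofReal.comp (D.continuous_F₂.comp (by fun_prop))) (periodic_ofReal hp₁) n
  have h2 := fc_deriv (fun θ => (D.hasDerivAt_F₃ s θ).ofReal_comp)
    (Complex.continuous_ofReal.comp (D.continuous_F₃.comp (by fun_prop))) (periodic_ofReal hp₂) n
  rw [h2, h1, D.fc_F₁]
  linear_combination Complex.I * n ^ 3 * fc (fun θ => (D.F (s, θ) : ℂ)) n * Complex.I_mul_I

theorem fc_G₁ (s : ℝ) (n : ℤ) : fc (fun θ => (D.G₁ (s, θ) : ℂ)) n =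
    Complex.I * n * fc (fun θ => (D.G (s, θ) : ℂ)) n :=
  fc_deriv (fun θ => (D.hasDerivAt_G₁ s θ).ofReal_comp)
    (Complex.continuous_ofReal.comp (D.continuous_G₁.comp (by fun_prop)))
    (periodic_ofReal (D.periodic_G s)) n

theorem continuous_left {F : ℝ × ℝ → ℝ} (hF : Continuous F) (s : ℝ) :
    Continuous fun θ => (F (s, θ) : ℂ) :=
  Complex.continuous_ofReal.comp (hF.comp (by fun_prop))

/-- The `p`-th Fourier coefficient of the flow equation: differentiating the two factors gives `(p -
n) - n = p - 2n`, the structure constant of the Witt algebra. -/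
theorem hasSum_flow (s : ℝ) (p : ℤ) :
    HasSum (fun n : ℤ => ((p : ℂ) - 2 * (n : ℂ)) * (fc (fun θ => (D.F (s, θ) : ℂ)) (p - n) *
      (Complex.I * fc (fun θ => (D.G (s, θ) : ℂ)) n)))
      (-1 * fc (fun θ => (D.F' (s, θ) : ℂ)) p) := by
  have hF := continuous_left D.contDiff_F.continuous s
  have hF₁ := continuous_left D.continuous_F₁ s
  have hG := continuous_left D.contDiff_G.continuous s
  have hG₁ := continuous_left D.continuous_G₁ s
  have hpG := periodic_ofReal (D.periodic_G s)
  have hs₁ : Summable (fc fun θ => (D.G₁ (s, θ) : ℂ)) := by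
    have h1 := isRapidlyDecreasing_fc_ofReal (contDiff_left D.contDiff_G s) (D.periodic_G s) 1
    refine Summable.of_norm_bounded h1 fun n => ?_
    rw [D.fc_G₁, norm_mul, norm_mul, Complex.norm_I, one_mul, Complex.norm_intCast, pow_one,
      mul_comm]
    exact mul_le_mul_of_nonneg_left (by linarith) (norm_nonneg _)
  have hpG₁ := periodic_ofReal (periodic_of_hasDerivAt (D.hasDerivAt_G₁ s) (D.periodic_G s))
  have h1 := (hasSum_fc_mul hF₁ hG hpG (D.summable_fc_G s) p).sub
    (hasSum_fc_mul hF hG₁ hpG₁ hs₁ p)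
  have h2 : fc (fun θ => (D.F₁ (s, θ) : ℂ) * D.G (s, θ)) p -
      fc (fun θ => (D.F (s, θ) : ℂ) * D.G₁ (s, θ)) p = -1 * fc (fun θ => (D.F' (s, θ) : ℂ)) p := by
    have h3 := fc_sub (f := fun θ => (D.F₁ (s, θ) : ℂ) * D.G (s, θ))
      (g := fun θ => (D.F (s, θ) : ℂ) * D.G₁ (s, θ)) (hF₁.mul hG) (hF.mul hG₁) p
    rw [← h3, ← fc_const_mul]
    congr 1
    funext θ
    rw [D.flow]
    push_cast
    ring
  rw [h2] at h1
  refine h1.congr_fun fun n => ?_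
  rw [D.fc_F₁, D.fc_G₁]
  push_cast
  ring

/-- By the convolution formula the cocycle is minus the mean of `(F₁ + F₃) G`, in which the total
derivative integrates to zero. -/
theorem hasSum_anomaly (s : ℝ) :
    HasSum (fun n : ℤ => ((n : ℂ) - (n : ℂ) ^ 3) * (fc (fun θ => (D.F (s, θ) : ℂ)) (-n) *
      (Complex.I * fc (fun θ => (D.G (s, θ) : ℂ)) n)))
      (1 / 2 * fc (fun θ => (D.Q' (s, θ) : ℂ)) 0) := by
  have hF₁ := continuous_left D.continuous_F₁ s
  have hF₃ := continuous_left D.continuous_F₃ s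
  have hG := continuous_left D.contDiff_G.continuous s
  have hQ' := continuous_left D.continuous_Q' s
  have h1 := (hasSum_fc_mul (f := fun θ => (D.F₁ (s, θ) : ℂ) + D.F₃ (s, θ)) (hF₁.add hF₃) hG
    (periodic_ofReal (D.periodic_G s)) (D.summable_fc_G s) 0).mul_left (-1)
  obtain ⟨E, E₁, hE₁, hEp, hE, hEq⟩ := D.anomaly s
  have h2 : -1 * fc (fun θ => ((D.F₁ (s, θ) : ℂ) + D.F₃ (s, θ)) * D.G (s, θ)) 0 =
      1 / 2 * fc (fun θ => (D.Q' (s, θ) : ℂ)) 0 := by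
    have h3 := fc_deriv (fun θ => (hE θ).ofReal_comp) (Complex.continuous_ofReal.comp hE₁)
      (periodic_ofReal hEp) 0
    have h4 : (fun θ => ((D.F₁ (s, θ) : ℂ) + D.F₃ (s, θ)) * D.G (s, θ)) =
        fun θ => (-1 / 2 * (D.Q' (s, θ) : ℂ)) + (E₁ θ : ℂ) := by
      funext θ
      rw [← Complex.ofReal_add, ← Complex.ofReal_mul, hEq]
      push_cast
      ring
    have h5 := fc_add (f := fun θ => (-1 / 2 * (D.Q' (s, θ) : ℂ))) (g := fun θ => (E₁ θ : ℂ))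
      (continuous_const.mul hQ') (Complex.continuous_ofReal.comp hE₁) 0
    rw [h4, h5, h3, fc_const_mul]
    push_cast
    ring
  rw [h2] at h1
  refine h1.congr_fun fun n => ?_
  rw [fc_add hF₁ hF₃, D.fc_F₁, D.fc_F₃, zero_sub]
  push_cast
  ring

end Flattening

namespace UnitaryPositiveEnergyRep

variable {H : Type*} [NormedAddCommGroup H] [InnerProductSpace ℂ H] [CompleteSpace H] {c : ℝ}
  {W : Submodule ℂ H} (ρ : UnitaryPositiveEnergyRep c W) (hW : Dense (W : Set H)) (hc : 0 ≤ c)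
include hW hc

theorem re_inner_Lop_zero_nonneg (y : H) : 0 ≤ (⟪ρ.resolvent y, ρ.Lop 0 0 y⟫_ℂ).re := by
  refine hW.denseRange_val.induction_on
    (p := fun y => 0 ≤ (⟪ρ.resolvent y, ρ.Lop 0 0 y⟫_ℂ).re) y
    (isClosed_le continuous_const (Complex.continuous_re.comp (by fun_prop))) fun v => ?_
  obtain ⟨w, rfl⟩ := ρ.energyW_bijective.2 v
  rw [ρ.resolvent_apply hW, ρ.Lop_apply hW hc, ρ.resolventW_energyW]
  simp only [LW, pow_zero, zero_add, pow_one, one_mul, Module.End.mul_apply,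
    ρ.resolventW_energyW]
  exact ρ.inner_L0_nonneg w

omit hW hc in
theorem Kop_fc_const (C : ℂ) (k : ℕ) : ρ.Kop k (fc fun _ => C) = C • ρ.Lop k 0 := by
  rw [Kop, tsum_eq_single 0 fun n hn => by rw [fc_const_of_ne_zero C hn, zero_smul],
    fc_const_zero]

/-- The quantum energy inequality for positive vector fields. -/
theorem quantum_energy_inequality_of_pos {h h' : ℝ → ℝ} (hh : ContDiff ℝ ∞ h)
    (hp : Function.Periodic h (2 * π)) (hpos : ∀ θ, 0 < h θ) (hd : ∀ θ, HasDerivAt h (h' θ) θ)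
    {B C : ℝ} (hB : ∀ θ, h θ ≤ B) (hC : ∀ θ, h' θ ^ 2 ≤ C * h θ) (w : W) :
    -(c / 24 * (C + 2 * B) * ‖w‖ ^ 2) ≤
      (⟪(w : H), ρ.Kop 0 (fc fun θ => (h θ : ℂ)) (ρ.energyW w)⟫_ℂ).re := by
  obtain ⟨D⟩ := exists_flattening hh hp hpos
  have hF := fun s => isRapidlyDecreasing_fc_ofReal (Flattening.contDiff_left D.contDiff_F s)
    (D.periodic_F s)
  have hF' := fun s => isRapidlyDecreasing_fc_ofReal (Flattening.contDiff_left D.contDiff_F' s)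
    (D.periodic_F' s)
  have hG : IsRapidlyDecreasingPath fun s n => Complex.I *
      fc (fun θ => (D.G ((projIcc 0 1 zero_le_one s : Icc (0 : ℝ) 1), θ) : ℂ)) n :=
    (isRapidlyDecreasingPath_fc (F := fun q => (D.G q : ℂ))
      (contDiff_ofReal_comp D.contDiff_G).contDiffOn
      fun s _ => periodic_ofReal (D.periodic_G s)).const_mul Complex.I
  have hproj : ∀ s ∈ Icc (0 : ℝ) 1, ((projIcc 0 1 zero_le_one s : Icc (0 : ℝ) 1) : ℝ) = s :=
    fun s hs => by rw [projIcc_of_mem zero_le_one hs]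
  -- Uniform bounds on an interval larger than `[0, 1]` give two-sided differentiability at its
  -- endpoints too.
  obtain ⟨u, hu, hle⟩ := exists_summable_norm_fc_le (S := univ) (F := fun q => (D.F' q : ℂ))
    uniqueDiffOn_univ (isCompact_Icc (a := -1) (b := 2)) (subset_univ _)
    (contDiff_ofReal_comp D.contDiff_F').contDiffOn
    (fun s _ => periodic_ofReal (D.periodic_F' s)) 2
  have hcont : ∀ {F : ℝ × ℝ → ℝ}, Continuous F →
      Continuous (Function.uncurry fun s θ => (F (s, θ) : ℂ)) := fun hF =>
    Complex.continuous_ofReal.comp hF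
  obtain ⟨y, hy⟩ := ρ.exists_inner_Kop_transport hW hc
    (a := fun s => fc fun θ => (D.F (s, θ) : ℂ)) (a' := fun s => fc fun θ => (D.F' (s, θ) : ℂ))
    (z := fun s => 1 / 2 * fc (fun θ => (D.Q' (s, θ) : ℂ)) 0)
    (Ψ := fun s => c / 24 * fc (fun θ => (D.Q (s, θ) : ℂ)) 0) hF hF'
    (fun s hs => ρ.hasDerivAt_Kop hW hc hF 0 (isOpen_Ioo (a := -1) (b := 2)) isPreconnected_Ioo
      (fun n s _ => hasDerivAt_fc (hcont D.contDiff_F.continuous) (hcont D.contDiff_F'.continuous)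
        (fun s θ => (D.hasDerivAt_F s θ).ofReal_comp) n s) hu
      (fun s hs n => hle s (Ioo_subset_Icc_self hs) n) ⟨by linarith [hs.1], by linarith [hs.2]⟩)
    hG (fun s n => by
      rw [fc_conj_neg, map_mul, Complex.conj_I]
      ring)
    (fun s hs p => by
      rw [hproj s hs]
      exact D.hasSum_flow s p)
    (fun s hs => by
      rw [hproj s hs]
      exact D.hasSum_anomaly s)
    (fun s hs => ((hasDerivAt_fc (hcont D.continuous_Q) (hcont D.continuous_Q')
      (fun s θ => (D.hasDerivAt_Q s θ).ofReal_comp) 0 s).const_mul (c / 24 : ℂ)).congr_deriv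
        (by ring)) w
  simp only [D.F_zero, D.F_one] at hy
  rw [ρ.Kop_fc_const] at hy
  rw [hy, smul_apply, inner_smul_right]
  have hF₁ : ∀ θ, D.F₁ (0, θ) = h' θ := fun θ => by
    have h1 := D.hasDerivAt_F₁ 0 θ
    simp only [D.F_zero] at h1
    exact h1.unique (hd θ)
  -- At the end the function is constant, so the quotient in `Q` vanishes. At the start `Q = h - h'²
  -- / h`, which lies between `-C` and `B`; the constant `C + 2 B` then follows from `α ≤ B`.
  have hQ₁ : fc (fun θ => (D.Q (1, θ) : ℂ)) 0 = D.α := by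
    have h1 : ∀ θ, D.F₁ (1, θ) = 0 := fun θ => by
      have h1 := D.hasDerivAt_F₁ 1 θ
      simp only [D.F_one] at h1
      exact h1.unique (hasDerivAt_const θ _)
    simp only [D.Q_eq, h1, D.F_one]
    simpa using fc_const_zero (D.α : ℂ)
  have hQ₀ : ‖fc (fun θ => (D.Q (0, θ) : ℂ)) 0‖ ≤ C + B := norm_fc_le (fun θ _ => by
    rw [Complex.norm_real, D.Q_eq, D.F_zero, hF₁, Real.norm_eq_abs, abs_le]
    have h1 : h' θ ^ 2 / h θ ≤ C := by rw [div_le_iff₀ (hpos θ)]; exact hC θ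
    have h2 : 0 ≤ h' θ ^ 2 / h θ := div_nonneg (sq_nonneg _) (hpos θ).le
    have h3 := hB θ
    have h4 := hpos θ
    constructor <;> linarith) 0
  rw [hQ₁]
  have h5 := D.α_le B hB
  have h6 := mul_nonneg D.α_pos.le (ρ.re_inner_Lop_zero_nonneg hW hc y)
  set q := fc (fun θ => (D.Q (0, θ) : ℂ)) 0
  have h7 : -(C + B) ≤ q.re := (abs_le.1 ((Complex.abs_re_le_norm q).trans hQ₀)).1
  have h8 : ((c : ℂ) / 24 * q - c / 24 * D.α) * (‖w‖ : ℂ) ^ 2 =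
      ((c / 24 * ‖w‖ ^ 2 : ℝ) : ℂ) * (q - D.α) := by push_cast; ring
  rw [Complex.add_re, Complex.re_ofReal_mul, h8, Complex.re_ofReal_mul, Complex.sub_re,
    Complex.ofReal_re]
  have h9 : 0 ≤ c / 24 * ‖w‖ ^ 2 := by positivity
  nlinarith [mul_le_mul_of_nonneg_left (show -(C + 2 * B) ≤ q.re - D.α by linarith) h9]

end UnitaryPositiveEnergyRep

end VirasoroEvolution

end

/-! ### Non-negative functions and the conclusion -/

noncomputable section

namespace VirasoroEvolution

/-- Glaeser's inequality for nonnegative functions with bounded second derivative. -/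
theorem sq_deriv_le_of_nonneg {h h₁ h₂ : ℝ → ℝ} (hd₁ : ∀ x, HasDerivAt h (h₁ x) x)
    (hd₂ : ∀ x, HasDerivAt h₁ (h₂ x) x) (hnn : ∀ x, 0 ≤ h x) {M : ℝ} (hM : ∀ x, h₂ x ≤ M)
    (x : ℝ) : h₁ x ^ 2 ≤ 2 * M * h x := by
  -- The second order Taylor majorant at `x` minus `h`. It is convex because `h'' ≤ M`, with a
  -- critical zero at `t = 0`, hence non-negative; so the quadratic dominates `h ≥ 0` and its
  -- discriminant is non-positive.
  set g : ℝ → ℝ := fun t => M / 2 * t ^ 2 + h₁ x * t + h x - h (x + t) with hg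
  have hg₁ : ∀ t, HasDerivAt g (M * t + h₁ x - h₁ (x + t)) t := fun t => by
    have h1 := ((((hasDerivAt_pow 2 t).const_mul (M / 2)).add
      ((hasDerivAt_id t).const_mul (h₁ x))).add_const (h x)).sub ((hd₁ (x + t)).comp_const_add x t)
    refine h1.congr_deriv ?_
    push_cast
    ring
  have hg₂ : ∀ t, HasDerivAt (fun t => M * t + h₁ x - h₁ (x + t)) (M - h₂ (x + t)) t := fun t => by
    have h1 := (((hasDerivAt_id t).const_mul M).add_const (h₁ x)).sub
      ((hd₂ (x + t)).comp_const_add x t)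
    exact h1.congr_deriv (by ring)
  have hder : deriv g = fun t => M * t + h₁ x - h₁ (x + t) := funext fun t => (hg₁ t).deriv
  have hconv : ConvexOn ℝ univ g := by
    refine Monotone.convexOn_univ_of_deriv (fun t => (hg₁ t).differentiableAt) ?_
    rw [hder]
    refine monotone_of_deriv_nonneg (fun t => (hg₂ t).differentiableAt) fun t => ?_
    rw [(hg₂ t).deriv]
    exact sub_nonneg.2 (hM _)
  have hmin := hconv.isMinOn_of_rightDeriv_eq_zero (x := 0) (by simp) (by
    rw [(hg₁ 0).hasDerivWithinAt.derivWithin (uniqueDiffWithinAt_Ioi 0)]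
    simp)
  have h1 : ∀ t, 0 ≤ M / 2 * (t * t) + h₁ x * t + h x := fun t => by
    have h2 : g 0 ≤ g t := hmin (mem_univ t)
    have h3 : g 0 = 0 := by simp [hg]
    have h4 := hnn (x + t)
    rw [h3] at h2
    simp only [hg] at h2
    nlinarith
  have h2 := discrim_le_zero h1
  rw [discrim] at h2
  linarith

theorem exists_norm_le_of_periodic {F : ℝ × ℝ → ℝ} (hF : ContinuousOn F (Icc 0 1 ×ˢ univ))
    (hp : ∀ t ∈ Icc (0 : ℝ) 1, Function.Periodic (fun θ => F (t, θ)) (2 * π)) :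
    ∃ B, 0 ≤ B ∧ ∀ t ∈ Icc (0 : ℝ) 1, ∀ θ, F (t, θ) ≤ B := by
  obtain ⟨B, hB⟩ := ((isCompact_Icc (a := (0 : ℝ)) (b := 1)).prod
    (isCompact_Icc (a := 0) (b := 2 * π))).exists_bound_of_continuousOn
    (hF.mono (prod_mono subset_rfl (subset_univ _)))
  have h0 : (0 : ℝ) ∈ Icc (0 : ℝ) 1 := ⟨le_rfl, zero_le_one⟩
  refine ⟨B, (norm_nonneg _).trans (hB (0, 0) ⟨h0, le_rfl, two_pi_pos.le⟩), fun t ht θ => ?_⟩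
  obtain ⟨θ', hθ', h1⟩ := (hp t ht).exists_mem_Ico₀ two_pi_pos θ
  rw [h1]
  exact (le_abs_self _).trans (hB (t, θ') ⟨ht, Ico_subset_Icc_self hθ'⟩)

namespace UnitaryPositiveEnergyRep

variable {H : Type*} [NormedAddCommGroup H] [InnerProductSpace ℂ H] [CompleteSpace H] {c : ℝ}
  {W : Submodule ℂ H} (ρ : UnitaryPositiveEnergyRep c W) (hW : Dense (W : Set H)) (hc : 0 ≤ c)
include hW hc

/-- The quantum energy inequality for nonnegative vector fields. -/
theorem quantum_energy_inequality {h h₁ h₂ : ℝ → ℝ} (hh : ContDiff ℝ ∞ h)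
    (hp : Function.Periodic h (2 * π)) (hnn : ∀ θ, 0 ≤ h θ)
    (hd₁ : ∀ θ, HasDerivAt h (h₁ θ) θ) (hd₂ : ∀ θ, HasDerivAt h₁ (h₂ θ) θ)
    {B M : ℝ} (hB : ∀ θ, h θ ≤ B) (hM0 : 0 ≤ M) (hM : ∀ θ, h₂ θ ≤ M) (w : W) :
    -(c / 24 * (2 * M + 2 * B) * ‖w‖ ^ 2) ≤
      (⟪(w : H), ρ.Kop 0 (fc fun θ => (h θ : ℂ)) (ρ.energyW w)⟫_ℂ).re := by
  set X := (⟪(w : H), ρ.Kop 0 (fc fun θ => (h θ : ℂ)) (ρ.energyW w)⟫_ℂ).re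
  set Y := (⟪(w : H), ρ.Lop 0 0 (ρ.energyW w)⟫_ℂ).re
  -- Glaeser's inequality for `h` gives `h'² ≤ 2 M (h + ε)`, so `C = 2 M` serves for every `ε`, and
  -- the limit `ε ↘ 0` can be taken for fixed `w`.
  have key : ∀ ε, 0 < ε → 0 ≤ X + ε * Y + c / 24 * (2 * M + 2 * (B + ε)) * ‖w‖ ^ 2 := fun ε hε => by
    have h1 := ρ.quantum_energy_inequality_of_pos hW hc (h := fun θ => h θ + ε) (h' := h₁)
      (B := B + ε) (C := 2 * M) (hh.add contDiff_const) (fun θ => by simp only [hp θ])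
      (fun θ => by linarith [hnn θ]) (fun θ => (hd₁ θ).add_const ε)
      (fun θ => by linarith [hB θ])
      (fun θ => (sq_deriv_le_of_nonneg hd₁ hd₂ hnn hM θ).trans
        (mul_le_mul_of_nonneg_left (by linarith) (by positivity))) w
    have hε' : ContDiff ℝ ∞ fun _ : ℝ => ε := contDiff_const
    have h2 : fc (fun θ => ((h θ + ε : ℝ) : ℂ)) =
        fun n => fc (fun θ => (h θ : ℂ)) n + fc (fun _ => (ε : ℂ)) n := funext fun n => by
      simp only [Complex.ofReal_add]
      exact fc_add (contDiff_ofReal_comp hh).continuous continuous_const n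
    rw [h2, ρ.Kop_add hW hc (isRapidlyDecreasing_fc_ofReal hh hp)
      (isRapidlyDecreasing_fc_ofReal hε' fun _ => rfl), ρ.Kop_fc_const, add_apply, smul_apply,
      inner_add_right, inner_smul_right, Complex.add_re, Complex.re_ofReal_mul] at h1
    linarith
  have hlim : Tendsto (fun ε => X + ε * Y + c / 24 * (2 * M + 2 * (B + ε)) * ‖w‖ ^ 2) (𝓝[>] 0)
      (𝓝 (X + 0 * Y + c / 24 * (2 * M + 2 * (B + 0)) * ‖w‖ ^ 2)) :=
    Tendsto.mono_left (Continuous.tendsto (by fun_prop) 0) nhdsWithin_le_nhds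
  have := ge_of_tendsto hlim (eventually_mem_nhdsWithin.mono fun ε hε => key ε hε)
  rw [zero_mul, add_zero, add_zero] at this
  linarith

/-- Inward pointing vector fields give dissipative operators up to the constant in the quantum
energy inequality. -/
theorem re_inner_Kop_le {f : ℝ → ℂ} {h₁ h₂ : ℝ → ℝ} (hf : ContDiff ℝ ∞ f)
    (hp : Function.Periodic f (2 * π)) (hnn : ∀ θ, 0 ≤ (f θ).im)
    (hd₁ : ∀ θ, HasDerivAt (fun θ => (f θ).im) (h₁ θ) θ) (hd₂ : ∀ θ, HasDerivAt h₁ (h₂ θ) θ)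
    {B M : ℝ} (hB : ∀ θ, (f θ).im ≤ B) (hM0 : 0 ≤ M) (hM : ∀ θ, h₂ θ ≤ M) (w : W) :
    (⟪ρ.Kop 0 (fun n => Complex.I * fc f n) (ρ.energyW w), (w : H)⟫_ℂ).re ≤
      c / 24 * (2 * M + 2 * B) * ‖w‖ ^ 2 := by
  have hre : ContDiff ℝ ∞ fun θ => (f θ).re := Complex.reCLM.contDiff.comp hf
  have him : ContDiff ℝ ∞ fun θ => (f θ).im := Complex.imCLM.contDiff.comp hf
  have hrep : Function.Periodic (fun θ => (f θ).re) (2 * π) := fun θ => by simp only [hp θ]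
  have himp : Function.Periodic (fun θ => (f θ).im) (2 * π) := fun θ => by simp only [hp θ]
  have hg := (isRapidlyDecreasing_fc_ofReal hre hrep).const_mul Complex.I
  have hh := isRapidlyDecreasing_fc_ofReal him himp
  -- Because `i · i = -1`, the imaginary part of `f` enters with a minus sign, which turns the lower
  -- bound for `T(Im f)` into an upper bound here; the real part is skew.
  have e : (fun n => Complex.I * fc f n) = fun n => Complex.I * fc (fun θ => ((f θ).re : ℂ)) n +
      -1 * fc (fun θ => ((f θ).im : ℂ)) n := funext fun n => by
    have h1 : f = fun θ => ((f θ).re : ℂ) + Complex.I * ((f θ).im : ℂ) := funext fun θ => by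
      rw [mul_comm, Complex.re_add_im]
    have h2 := fc_add (f := fun θ => ((f θ).re : ℂ)) (g := fun θ => Complex.I * ((f θ).im : ℂ))
      (contDiff_ofReal_comp hre).continuous
      (continuous_const.mul (contDiff_ofReal_comp him).continuous) n
    rw [← h1, fc_const_mul] at h2
    rw [h2]
    linear_combination fc (fun θ => ((f θ).im : ℂ)) n * Complex.I_mul_I
  have h1 := ρ.re_inner_Kop_skew hW hc hg (fun n => by
    rw [fc_conj_neg, map_mul, Complex.conj_I]
    ring) (ρ.energyW w : H)
  rw [ρ.resolvent_apply hW, ρ.resolventW_energyW] at h1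
  have h2 := ρ.quantum_energy_inequality hW hc him himp hnn hd₁ hd₂ hB hM0 hM w
  have h3 : (⟪(w : H), ρ.Kop 0 (fc fun θ => ((f θ).im : ℂ)) (ρ.energyW w)⟫_ℂ).re =
      (⟪ρ.Kop 0 (fc fun θ => ((f θ).im : ℂ)) (ρ.energyW w), (w : H)⟫_ℂ).re :=
    inner_re_symm (𝕜 := ℂ) _ _
  rw [e, ρ.Kop_add hW hc hg (hh.const_mul (-1)), ρ.Kop_const_mul hW hc hh, add_apply,
    neg_one_smul, neg_apply, inner_add_left, inner_neg_left, Complex.add_re, Complex.neg_re, h1]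
  linarith

end UnitaryPositiveEnergyRep

/-- Only upper bounds for `Im f` and its second `θ`-derivative enter the dissipativity constant, and
both are uniform over `[0, 1]` by compactness and periodicity. Outside `[0, 1]` the coefficients are
continued as constants, so the abstract theory applies for all real times. -/
theorem IsSmoothInwardPath.timeOrderedExponentialExists {H : Type*} [NormedAddCommGroup H]
    [InnerProductSpace ℂ H] [CompleteSpace H] {c : ℝ} (hc : 0 ≤ c) {W : Submodule ℂ H}
    (hW : Dense (W : Set H)) (ρ : UnitaryPositiveEnergyRep c W) {X : ℝ → VectorField}
    (hX : IsSmoothInwardPath X) :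
    TimeOrderedExponentialExists (UnitaryPositiveEnergyRep.Sobolev.incl ρ 1)
        (fun t => ρ.op (X t)) ∧
      ∀ n : ℕ, TimeOrderedExponentialExists (UnitaryPositiveEnergyRep.Sobolev.inclSucc ρ n)
        (fun t => ρ.opPart n (X t)) := by
  have hS : UniqueDiffOn ℝ (Icc (0 : ℝ) 1) := uniqueDiffOn_Icc zero_lt_one
  have him : ContDiffOn ℝ ∞ (fun p : ℝ × ℝ => ((X p.1).coeff p.2).im) (Icc 0 1 ×ˢ univ) :=
    Complex.imCLM.contDiff.comp_contDiffOn hX.smooth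
  have himp : ∀ t ∈ Icc (0 : ℝ) 1, Function.Periodic (fun θ => ((X t).coeff θ).im) (2 * π) :=
    fun t _ θ => by simp only [(X t).periodic θ]
  obtain ⟨h₁, hs₁, hd₁⟩ := exists_contDiffOn_hasDerivAt hS him
  obtain ⟨h₂, hs₂, hd₂⟩ := exists_contDiffOn_hasDerivAt hS hs₁
  obtain ⟨B, hB0, hB⟩ := exists_norm_le_of_periodic him.continuousOn himp
  obtain ⟨M, hM0, hM⟩ := exists_norm_le_of_periodic hs₂.continuousOn fun t ht =>
    periodic_of_hasDerivAt (hd₂ t ht) (periodic_of_hasDerivAt (hd₁ t ht) (himp t ht))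
  have ha := (isRapidlyDecreasingPath_fc hX.smooth fun t _ => (X t).periodic).const_mul Complex.I
  refine ρ.timeOrderedExponentialExists_of_dissipative hW hc X ha (fun t ht => ?_)
    (κ₀ := c / 24 * (2 * M + 2 * B)) (by positivity) fun t w => ?_
  · rw [projIcc_of_mem zero_le_one ht]
    rfl
  · have ht := (projIcc (0 : ℝ) 1 zero_le_one t).2
    exact ρ.re_inner_Kop_le hW hc (X _).smooth (X _).periodic (hX.inward _ ht) (hd₁ _ ht)
      (hd₂ _ ht) (hB _ ht) hM0 (hM _ ht) w

end VirasoroEvolution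

end

theorem mainTheorem3 {H : Type*} [NormedAddCommGroup H] [InnerProductSpace ℂ H] [CompleteSpace H]
    (c : ℝ) (hc : 0 ≤ c) (W : Submodule ℂ H) (hW : Dense (W : Set H))
    (ρ : VirasoroEvolution.UnitaryPositiveEnergyRep c W)
    (X : ℝ → VirasoroEvolution.VectorField) (hX : VirasoroEvolution.IsSmoothInwardPath X) :
    VirasoroEvolution.TimeOrderedExponentialExists
        (VirasoroEvolution.UnitaryPositiveEnergyRep.Sobolev.incl ρ 1) (fun t => ρ.op (X t)) ∧
      ∀ n : ℕ, VirasoroEvolution.TimeOrderedExponentialExists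
        (VirasoroEvolution.UnitaryPositiveEnergyRep.Sobolev.inclSucc ρ n)
        (fun t => ρ.opPart n (X t)) :=
  hX.timeOrderedExponentialExists hc hW ρ
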